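/- A consumer with utility $u(x,y)-p-q$ buys $x\ge 0$ from seller 1 in period 1 and $y\ge 0$ from seller 2 in period 2; $p,q$ are the payments. Here $u$ is strictly increasing, strictly concave and twice continuously differentiable on $[0,\infty)^2$, and either supermodular ($u_{21}>0$) or submodular ($u_{21}<0$). Both sellers have constant marginal cost $k$ and post lower semicontinuous nonlinear prices $[0,\infty)\to[0,\infty)$, under which the consumer may always buy nothing for free. Seller 1 may randomize over price schedules, seller 2 posts one menu, and the consumer may randomize over her purchases in both periods. Transactions are private: seller 2 observes neither seller 1's prices nor the consumer's purchase from seller 1, and the consumer sees seller 2's menu only after her first purchase. An equilibrium is a sequential equilibrium in which a deviation by seller 1 does not change the consumer's expectation of seller 2's menu, and both sellers have finite expected profits. Only price schedules under which the consumer's problem has a solution are considered. Assume that $x^o>0$ solves $u_1(x^o,0)=k$, that $u_2(x^o,0)>k$, and that the efficient pair $x^*,y^*>0$ solves $u_1(x^*,y^*)=u_2(x^*,y^*)=k$. For $x$ between $x^*$ and $x^o$ let $\hat y(x)\ge 0$ be the solution of $u_1(x,\hat y(x))=k$, and put $$\Sigma=u(x^o,0)-kx^o,\qquad q(x)=u(x,\hat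 y(x))-kx-\Sigma .$$ **Theorem.** 1. If $u$ is supermodular, then $x^o<x^*$ and the equilibrium outcome is unique: in every equilibrium first-period consumption has support $[x^o,x^*]$ and the distribution function $F$ with $F(x)=1-\exp\Big[\int_{x^o}^{x}\frac{u_{21}(z,\hat y(z))}{k-u_2(z,\hat y(z))}\,dz\Big]$ for $x^o\le x<x^*$, $F=0$ below $x^o$ and $F=1$ from $x^*$ on; a consumer who has consumed $x$ buys $\hat y(x)$ at the price $q(x)$, which for every $x\in[x^o,x^*]$ is her only optimal choice from the menu, so the set of items (payment, quantity) chosen on the equilibrium path is $\{(q(x),\hat y(x)):x\in[x^o,x^*]\}$; the consumer's payoff is $u(0,0)$, seller 1's profit is $\Sigma-u(0,0)$, and seller 2's profit is $\int (q(x)-k\hat y(x))\,dF(x)$. 2. If $u$ is submodular, then $x^*<x^o$ and the equilibrium outcome is essentially unique. In every equilibrium (a) first-period consumption has support $[x^*,x^o]$ and the distribution function $F$ with $F(x)=\exp\Big[\int_{x}^{x^o}\frac{u_{21}(z,\hat y(z))}{u_2(z,\hat y(z))-k}\,dz\Big]$ for $x^*<x\le x^o$, $F=0$ up to $x^*$ and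 $F=1$ above $x^o$; (b) a consumer who has consumed $x$ buys $\hat y(x)$ at the price $q(x)$, which for every $x\in[x^*,x^o]$ is her only optimal choice from the menu, so the set of items (payment, quantity) chosen on the equilibrium path is $\{(q(x),\hat y(x)):x\in[x^*,x^o]\}$, and seller 2's profit is $\int (q(x)-k\hat y(x))\,dF(x)$; and (c) the payoffs of seller 1 and the consumer add up to $\Sigma$. -/

import Mathlib

open Set MeasureTheory ProbabilityTheory
open scoped NNReal ENNReal

noncomputable section

namespace PrivateTransactions

/-! ### Marginal utilities on the quadrant `[0, ∞) × [0, ∞)` (one-sided on the boundary) -/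

/-- The partial derivative `u₁`. -/
def du1 (u : ℝ → ℝ → ℝ) (x y : ℝ) : ℝ := derivWithin (fun s => u s y) (Ici 0) x

/-- The partial derivative `u₂`. -/
def du2 (u : ℝ → ℝ → ℝ) (x y : ℝ) : ℝ := derivWithin (fun t => u x t) (Ici 0) y

/-- The mixed partial derivative `u₂₁`. -/
def du21 (u : ℝ → ℝ → ℝ) (x y : ℝ) : ℝ := derivWithin (fun s => du2 u s y) (Ici 0) x

/-- The utility of consumption is strictly increasing, strictly concave and twice continuously
differentiable on the quadrant. -/
structure IsUtility (u : ℝ → ℝ → ℝ) : Prop where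
  strictMono_left : ∀ y, 0 ≤ y → StrictMonoOn (fun x => u x y) (Ici 0)
  strictMono_right : ∀ x, 0 ≤ x → StrictMonoOn (fun y => u x y) (Ici 0)
  strictConcave : StrictConcaveOn ℝ (Ici (0 : ℝ) ×ˢ Ici (0 : ℝ)) (fun z : ℝ × ℝ => u z.1 z.2)
  contDiff : ContDiffOn ℝ 2 (fun z : ℝ × ℝ => u z.1 z.2) (Ici (0 : ℝ) ×ˢ Ici (0 : ℝ))

/-- (Strict) supermodularity of a twice continuously differentiable utility: `u₂₁ > 0`. -/
def Supermodular (u : ℝ → ℝ → ℝ) : Prop := ∀ x y, 0 ≤ x → 0 ≤ y → 0 < du21 u x y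

/-- (Strict) submodularity of a twice continuously differentiable utility: `u₂₁ < 0`. -/
def Submodular (u : ℝ → ℝ → ℝ) : Prop := ∀ x y, 0 ≤ x → 0 ≤ y → du21 u x y < 0

/-- `(xs, ys)` is the (interior) socially efficient consumption for the marginal cost `k`. -/
structure IsEfficient (u : ℝ → ℝ → ℝ) (k xs ys : ℝ) : Prop where
  pos_left : 0 < xs
  pos_right : 0 < ys
  foc_left : du1 u xs ys = k
  foc_right : du2 u xs ys = k

/-- `xo` is the first-period consumption that arises when consumption is observable, and at `xo`
the second seller still has a profitable trade to offer. -/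
structure IsObservableOutcome (u : ℝ → ℝ → ℝ) (k xo : ℝ) : Prop where
  pos : 0 < xo
  foc : du1 u xo 0 = k
  second_trade : k < du2 u xo 0

/-! ### The game -/

/-- A nonlinear price: a lower semicontinuous nonnegative function of the size of the bundle.
The consumer is free to buy nothing at no charge, which is recorded as `price 0 = 0`. -/
structure Tariff where
  price : ℝ≥0 → ℝ≥0
  lsc : LowerSemicontinuous price
  price_zero : price 0 = 0

/-- The second-period payoff of a consumer who has consumed `x`, faces the menu `q` and buys `y`
(the first-period payment is sunk). -/
def payoff2 (u : ℝ → ℝ → ℝ) (q : Tariff) (x y : ℝ≥0) : ℝ := u x y - q.price y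

/-- `y` is an optimal purchase from the menu `q` after the first-period consumption `x`. -/
def Best2 (u : ℝ → ℝ → ℝ) (q : Tariff) (x y : ℝ≥0) : Prop :=
  ∀ y', payoff2 u q x y' ≤ payoff2 u q x y

/-- The second-period indirect utility `U(x)` under the menu `q`. -/
def indirect (u : ℝ → ℝ → ℝ) (q : Tariff) (x : ℝ≥0) : ℝ := ⨆ y, payoff2 u q x y

/-- `x` is an optimal first-period purchase at the prices `p` of a consumer who expects the
menu `q` in the second period. -/
def Best1 (u : ℝ → ℝ → ℝ) (q p : Tariff) (x : ℝ≥0) : Prop :=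
  ∀ x', indirect u q x' - p.price x' ≤ indirect u q x - p.price x

/-- After every first-period consumption the consumer has an optimal purchase from `q`. -/
def Solvable2 (u : ℝ → ℝ → ℝ) (q : Tariff) : Prop := ∀ x, ∃ y, Best2 u q x y

/-- A consumer who expects the menu `q` has an optimal purchase at the prices `p`. -/
def Solvable1 (u : ℝ → ℝ → ℝ) (q p : Tariff) : Prop := ∃ x, Best1 u q p x

/-- A strategy profile. Seller 1 randomizes over price schedules by means of a random device `Ω`.
Seller 2 observes nothing and offers one menu. The consumer plays a behavior strategy: she
randomizes over `x` after seeing seller 1's prices, and over `y` at each history consisting of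
seller 1's prices, her purchase `x` and seller 2's menu. -/
structure Profile (Ω : Type*) [MeasurableSpace Ω] where
  offer1 : Ω → Tariff
  offer2 : Tariff
  buy1 : Tariff → ProbabilityMeasure ℝ≥0
  buy2 : Tariff → ℝ≥0 → Tariff → ProbabilityMeasure ℝ≥0
  measurable_price : Measurable fun a : Ω × ℝ≥0 => (offer1 a.1).price a.2
  measurable_buy1 : Measurable fun ω => (buy1 (offer1 ω) : Measure ℝ≥0)
  measurable_buy2 : ∀ q, Measurable fun a : Ω × ℝ≥0 => (buy2 (offer1 a.1) a.2 q : Measure ℝ≥0)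

/-- The expectation of `f`, as an extended real number: infinite expectations are allowed, and
the undefined case `∞ - ∞` counts as `-∞`. -/
def expect {α : Type*} [MeasurableSpace α] (μ : Measure α) (f : α → ℝ) : EReal :=
  ((∫⁻ a, ENNReal.ofReal (f a) ∂μ : ℝ≥0∞) : EReal) -
    ((∫⁻ a, ENNReal.ofReal (-f a) ∂μ : ℝ≥0∞) : EReal)

namespace Profile

variable {Ω : Type*} [MeasurableSpace Ω]

/-- First-period choices as a kernel. -/
def kernel1 (σ : Profile Ω) : Kernel Ω ℝ≥0 where
  toFun ω := σ.buy1 (σ.offer1 ω)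
  measurable' := σ.measurable_buy1

/-- Second-period choices when seller 2 offers `q`, as a kernel. -/
def kernel2 (σ : Profile Ω) (q : Tariff) : Kernel (Ω × ℝ≥0) ℝ≥0 where
  toFun a := σ.buy2 (σ.offer1 a.1) a.2 q
  measurable' := σ.measurable_buy2 q

instance (σ : Profile Ω) : IsMarkovKernel σ.kernel1 :=
  ⟨fun ω => inferInstanceAs (IsProbabilityMeasure (σ.buy1 (σ.offer1 ω) : Measure ℝ≥0))⟩

instance (σ : Profile Ω) (q : Tariff) : IsMarkovKernel (σ.kernel2 q) :=
  ⟨fun a => inferInstanceAs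
    (IsProbabilityMeasure (σ.buy2 (σ.offer1 a.1) a.2 q : Measure ℝ≥0))⟩

/-- The joint law of (seller 1's device, `x`, `y`) when seller 2 offers `q` and everybody else
follows the profile. -/
def law (σ : Profile Ω) (P : Measure Ω) (q : Tariff) : Measure ((Ω × ℝ≥0) × ℝ≥0) :=
  (P.compProd σ.kernel1).compProd (σ.kernel2 q)

/-- Realized profit of seller 1. -/
def gain1 (σ : Profile Ω) (k : ℝ) (a : (Ω × ℝ≥0) × ℝ≥0) : ℝ :=
  (σ.offer1 a.1.1).price a.1.2 - k * a.1.2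

/-- Realized profit of seller 2 from the menu `q`. -/
def gain2 (q : Tariff) (k : ℝ) (a : (Ω × ℝ≥0) × ℝ≥0) : ℝ := q.price a.2 - k * a.2

/-- Realized payoff of the consumer. -/
def gainC (σ : Profile Ω) (u : ℝ → ℝ → ℝ) (a : (Ω × ℝ≥0) × ℝ≥0) : ℝ :=
  u a.1.2 a.2 - (σ.offer1 a.1.1).price a.1.2 - σ.offer2.price a.2

/-- Expected profit of seller 1. -/
def profit1 (σ : Profile Ω) (P : Measure Ω) (k : ℝ) : ℝ := ∫ a, σ.gain1 k a ∂σ.law P σ.offer2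

/-- Expected profit of seller 2. -/
def profit2 (σ : Profile Ω) (P : Measure Ω) (k : ℝ) : ℝ :=
  ∫ a, gain2 σ.offer2 k a ∂σ.law P σ.offer2

/-- Expected payoff of the consumer. -/
def consumerPayoff (σ : Profile Ω) (P : Measure Ω) (u : ℝ → ℝ → ℝ) : ℝ :=
  ∫ a, σ.gainC u a ∂σ.law P σ.offer2

/-- The distribution of first-period consumption. -/
def firstDist (σ : Profile Ω) (P : Measure Ω) : Measure ℝ :=
  (σ.law P σ.offer2).map fun a => (a.1.2 : ℝ)

/-- The distribution of the chosen item (payment, quantity) of the second-period menu. -/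
def itemDist (σ : Profile Ω) (P : Measure Ω) : Measure (ℝ × ℝ) :=
  (σ.law P σ.offer2).map fun a => ((σ.offer2.price a.2 : ℝ), (a.2 : ℝ))

/-- Sequential equilibrium with private transactions. Neither the consumer's expectation of
seller 2's menu nor seller 2's belief responds to a deviation of seller 1. The consumer optimizes
at every history at which an optimal choice exists; prices without an optimal choice for the
consumer (for instance, everything for free) are not available to the sellers. -/
structure IsEquilibrium (σ : Profile Ω) (P : Measure Ω) (u : ℝ → ℝ → ℝ) (k : ℝ) : Prop where
  solvable1 : ∀ᵐ ω ∂P, Solvable1 u σ.offer2 (σ.offer1 ω)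
  solvable2 : Solvable2 u σ.offer2
  rational1 : ∀ p, Solvable1 u σ.offer2 p → ∀ᵐ x ∂(σ.buy1 p : Measure ℝ≥0), Best1 u σ.offer2 p x
  rational2 : ∀ p x q, (∃ y, Best2 u q x y) →
    ∀ᵐ y ∂(σ.buy2 p x q : Measure ℝ≥0), Best2 u q x y
  integrable1 : Integrable (σ.gain1 k) (σ.law P σ.offer2)
  integrable2 : Integrable (gain2 σ.offer2 k) (σ.law P σ.offer2)
  optimal1 : ∀ p, Solvable1 u σ.offer2 p →
    expect (σ.buy1 p : Measure ℝ≥0) (fun x => p.price x - k * x) ≤ (σ.profit1 P k : EReal)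
  optimal2 : ∀ q, Solvable2 u q →
    expect (σ.law P q) (gain2 q k) ≤ (σ.profit2 P k : EReal)

end Profile

/-! ### The equilibrium outcome -/

/-- The second-period consumption `ŷ(x)`: the solution `y ≥ 0` of `u₁(x, y) = k`. -/
def yhat (u : ℝ → ℝ → ℝ) (k x : ℝ) : ℝ := sInf {y : ℝ | 0 ≤ y ∧ du1 u x y = k}

/-- The joint payoff of the consumer and seller 1. -/
def jointPayoff (u : ℝ → ℝ → ℝ) (k xo : ℝ) : ℝ := u xo 0 - k * xo

/-- The price of the bundle `ŷ(x)`. -/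
def qhat (u : ℝ → ℝ → ℝ) (k xo x : ℝ) : ℝ :=
  u x (yhat u k x) - k * x - jointPayoff u k xo

/-- The distribution function of first-period consumption for a submodular utility. -/
def distSub (u : ℝ → ℝ → ℝ) (k xs xo z : ℝ) : ℝ :=
  if z ≤ xs then 0
  else if z ≤ xo then
    Real.exp (∫ t in z..xo, du21 u t (yhat u k t) / (du2 u t (yhat u k t) - k))
  else 1

/-- The distribution function of first-period consumption for a supermodular utility. -/
def distSuper (u : ℝ → ℝ → ℝ) (k xs xo z : ℝ) : ℝ :=
  if z < xo then 0
  else if z < xs then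
    1 - Real.exp (∫ t in xo..z, du21 u t (yhat u k t) / (k - du2 u t (yhat u k t)))
  else 1

/-- The part of the outcome that does not concern the division of the joint payoff of seller 1
and the consumer: first-period consumption has distribution function `F` and support `X`; the
consumer then buys `ŷ(x)`, and the chosen items of the second-period menu are `(q̂(x), ŷ(x))`,
`x ∈ X`; seller 2 earns the corresponding profit; and seller 1 and the consumer together obtain
the joint payoff. -/
structure HasAllocation {Ω : Type*} [MeasurableSpace Ω] (σ : Profile Ω) (P : Measure Ω)
    (u : ℝ → ℝ → ℝ) (k xo : ℝ) (F : ℝ → ℝ) (X : Set ℝ) : Prop where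
  cdf_eq : ∀ z, (σ.firstDist P).real (Iic z) = F z
  support_eq : (σ.firstDist P).support = X
  consumption : ∀ᵐ a ∂σ.law P σ.offer2, (a.2 : ℝ) = yhat u k a.1.2
  items : (σ.itemDist P).support = (fun x => (qhat u k xo x, yhat u k x)) '' X
  optimal_item : ∀ x y : ℝ≥0, (x : ℝ) ∈ X → (Best2 u σ.offer2 x y ↔ (y : ℝ) = yhat u k x)
  item_price : ∀ x y : ℝ≥0, (x : ℝ) ∈ X → (y : ℝ) = yhat u k x →
    (σ.offer2.price y : ℝ) = qhat u k xo x
  profit2_eq : σ.profit2 P k = ∫ x, (qhat u k xo x - k * yhat u k x) ∂σ.firstDist P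
  joint_eq : σ.profit1 P k + σ.consumerPayoff P u = jointPayoff u k xo

end PrivateTransactions

end

/-! Let `U(x)` be the consumer's value of entering period 2 with `x`. By pricing at `U - U(0)` with
a small discount at one bundle, seller 1 can sell any `x` for almost `U(x) - U(0)`, while the
consumer never pays more. Hence `U(x) - kx` equals a constant `V = profit1 + U(0)` almost surely and
never exceeds it (`indirect_sub_le_profit1`, `ae_indirect_eq`). Given the later purchase `y`, the
chosen `x` then maximizes `u(x, y) - kx`, so `(x, y)` lies on the curve `y = ŷ(x)` or `x` lies
beyond `xs` (`mem_or_beyond`).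

Seller 2 therefore screens a population of types, indexed by demand `t = ŷ(x)`, whose marginal
utility `marginal t s` increases in `t` whatever the sign `e` of `u₂₁`. The identity `U(x) - kx = V`
fixes the price paid, and the envelope theorem turns seller 2's gain on the curve into `∫₀ᵗ
(marginal s s - k) ds + (Σ - V)`; beyond `xs` the gain is strictly below this expression at the top
demand. The menu with marginal price `marginal s s` secures the integral up to an arbitrarily small
loss, and `V ≥ Σ` because the consumer may skip seller 2. So `V = Σ`, and consumption stays on the
curve (`joint_value_and_ae`).

Let `D(t)` be the mass of demands of at least `t`, and `w = marginal - k`. Selling the quantities in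
`(t₁, t₂]` at the marginal utility of a single type `c` replaces `∫ w(s,s) D(s)` over this interval
by `D(c) ∫ w(c,s)`, which must not pay (`isDemandProfile`). Letting the interval shrink to `c` from
either side gives a first-order condition whose solution is the exponential of the integrated hazard
rate (`demandProfile_eq`). Since `D` is a priori only monotone and `x̂ = ŷ⁻¹` need not be
differentiable, `D` is compared with the exponential through a perturbed maximum argument
(`eq_of_isLittleO`). The margin vanishes at the top fast enough to exclude an atom at `xs`
(`demandProfile_top`).

Strict decrease of `D` gives full support. Lower semicontinuity of the menu then carries prices and
optimal choices from almost every `x` to every `x` in the interval (`price_yhat_le`,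
`best2_iff_yhat`). -/

namespace PrivateTransactions

open Filter Topology

/-! ### Calculus on the closed quadrant -/

section Calculus

/-- The quadrant of nonnegative consumption pairs. -/
abbrev quadrant : Set (ℝ × ℝ) := Ici (0 : ℝ) ×ˢ Ici (0 : ℝ)

lemma mk_mem_quadrant {x y : ℝ} (hx : 0 ≤ x) (hy : 0 ≤ y) : (x, y) ∈ quadrant := ⟨hx, hy⟩

lemma uniqueDiffOn_quadrant : UniqueDiffOn ℝ quadrant :=
  (uniqueDiffOn_Ici 0).prod (uniqueDiffOn_Ici 0)

lemma hasDerivWithinAt_left {g : ℝ × ℝ → ℝ} (hg : DifferentiableOn ℝ g quadrant) {x y : ℝ}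
    (hx : 0 ≤ x) (hy : 0 ≤ y) :
    HasDerivWithinAt (fun s => g (s, y)) (fderivWithin ℝ g quadrant (x, y) (1, 0)) (Ici 0) x := by
  have h1 := (hg (x, y) (mk_mem_quadrant hx hy)).hasFDerivWithinAt
  have h2 : HasDerivWithinAt (fun s : ℝ => (s, y)) ((1 : ℝ), (0 : ℝ)) (Ici 0) x :=
    (hasDerivWithinAt_id x _).prodMk (hasDerivWithinAt_const x _ y)
  exact h1.comp_hasDerivWithinAt x h2 (fun s hs => mk_mem_quadrant hs hy)

lemma hasDerivWithinAt_right {g : ℝ × ℝ → ℝ} (hg : DifferentiableOn ℝ g quadrant) {x y : ℝ}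
    (hx : 0 ≤ x) (hy : 0 ≤ y) :
    HasDerivWithinAt (fun t => g (x, t)) (fderivWithin ℝ g quadrant (x, y) (0, 1)) (Ici 0) y := by
  have h1 := (hg (x, y) (mk_mem_quadrant hx hy)).hasFDerivWithinAt
  have h2 : HasDerivWithinAt (fun t : ℝ => (x, t)) ((0 : ℝ), (1 : ℝ)) (Ici 0) y :=
    (hasDerivWithinAt_const y _ x).prodMk (hasDerivWithinAt_id y _)
  exact h1.comp_hasDerivWithinAt y h2 (fun s hs => mk_mem_quadrant hx hs)

lemma contDiffOn_fderivWithin_apply {g : ℝ × ℝ → ℝ} {m n : WithTop ℕ∞}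
    (hg : ContDiffOn ℝ n g quadrant) (hmn : m + 1 ≤ n) (v : ℝ × ℝ) :
    ContDiffOn ℝ m (fun z => fderivWithin ℝ g quadrant z v) quadrant :=
  (hg.fderivWithin uniqueDiffOn_quadrant hmn).clm_apply contDiffOn_const

/-- A `C¹` function on the quadrant is Lipschitz in the first variable on compact squares. -/
lemma exists_lipschitz_left {g : ℝ × ℝ → ℝ} (hg : ContDiffOn ℝ 1 g quadrant) (M : ℝ) :
    ∃ C, 0 < C ∧ ∀ x ∈ Icc 0 M, ∀ x' ∈ Icc 0 M, ∀ y ∈ Icc 0 M,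
      |g (x, y) - g (x', y)| ≤ C * |x - x'| := by
  have hc : ContinuousOn (fun z => fderivWithin ℝ g quadrant z (1, 0)) (Icc 0 M ×ˢ Icc 0 M) :=
    (contDiffOn_fderivWithin_apply (m := 0) hg (by simp) _).continuousOn.mono
      (prod_mono Icc_subset_Ici_self Icc_subset_Ici_self)
  obtain ⟨C, hC⟩ := (isCompact_Icc.prod isCompact_Icc).exists_bound_of_continuousOn hc
  refine ⟨|C| + 1, by positivity, fun x hx x' hx' y hy => ?_⟩
  have := (convex_Icc (0 : ℝ) M).norm_image_sub_le_of_norm_hasDerivWithin_le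
    (f := fun s => g (s, y)) (f' := fun s => fderivWithin ℝ g quadrant (s, y) (1, 0))
    (C := |C| + 1)
    (fun s hs => (hasDerivWithinAt_left (hg.differentiableOn one_ne_zero) hs.1 hy.1).mono
      Icc_subset_Ici_self)
    (fun s hs => by
      have := hC (s, y) ⟨hs, hy⟩
      linarith [le_abs_self C]) hx' hx
  simpa using this

/-- A `C¹` function on the quadrant is Lipschitz in the second variable on compact squares. -/
lemma exists_lipschitz_right {g : ℝ × ℝ → ℝ} (hg : ContDiffOn ℝ 1 g quadrant) (M : ℝ) :
    ∃ C, 0 < C ∧ ∀ x ∈ Icc 0 M, ∀ y ∈ Icc 0 M, ∀ y' ∈ Icc 0 M,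
      |g (x, y) - g (x, y')| ≤ C * |y - y'| := by
  have hs : MapsTo (Prod.swap : ℝ × ℝ → ℝ × ℝ) quadrant quadrant := fun z hz => ⟨hz.2, hz.1⟩
  have h2 : ContDiffOn ℝ 1 (g ∘ Prod.swap) quadrant :=
    hg.comp (contDiff_snd.prodMk contDiff_fst).contDiffOn hs
  obtain ⟨C, hC, h⟩ := exists_lipschitz_left h2 M
  exact ⟨C, hC, fun x hx y hy y' hy' => by simpa using h y hy y' hy' x hx⟩

/-- If the derivative of `h` on `[0, ∞)` is at least `c` on `[a, b]`, so are the slopes. -/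
lemma mul_sub_le_of_hasDerivWithinAt {h h' : ℝ → ℝ} {a b c : ℝ} (ha : 0 ≤ a) (hab : a ≤ b)
    (hd : ∀ s ∈ Icc a b, HasDerivWithinAt h (h' s) (Ici 0) s) (hc : ∀ s ∈ Icc a b, c ≤ h' s) :
    c * (b - a) ≤ h b - h a := by
  have hcont : ContinuousOn h (Icc a b) := fun s hs =>
    (hd s hs).continuousWithinAt.mono (fun r hr => ha.trans hr.1)
  have hder : ∀ s ∈ Ioo a b, HasDerivAt h (h' s) s := fun s hs =>
    (hd s (Ioo_subset_Icc_self hs)).hasDerivAt (Ici_mem_nhds (ha.trans_lt hs.1))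
  refine (convex_Icc a b).mul_sub_le_image_sub_of_le_deriv hcont ?_ ?_ a
    (left_mem_Icc.2 hab) b (right_mem_Icc.2 hab) hab
  · rw [interior_Icc]
    exact fun s hs => (hder s hs).differentiableAt.differentiableWithinAt
  · rw [interior_Icc]
    intro s hs
    rw [(hder s hs).deriv]
    exact hc s (Ioo_subset_Icc_self hs)

/-- A continuous function that is positive on the quadrant is bounded away from `0` on compact
squares. -/
lemma exists_pos_lower_bound {g : ℝ × ℝ → ℝ} (hg : ContinuousOn g quadrant)
    (hpos : ∀ z ∈ quadrant, 0 < g z) {M : ℝ} (hM : 0 ≤ M) :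
    ∃ c, 0 < c ∧ ∀ x ∈ Icc 0 M, ∀ y ∈ Icc 0 M, c ≤ g (x, y) := by
  obtain ⟨z, hz, hmin⟩ := (isCompact_Icc.prod isCompact_Icc).exists_isMinOn
    (s := Icc (0 : ℝ) M ×ˢ Icc (0 : ℝ) M) ⟨(0, 0), ⟨le_rfl, hM⟩, ⟨le_rfl, hM⟩⟩
    (hg.mono (prod_mono Icc_subset_Ici_self Icc_subset_Ici_self))
  exact ⟨g z, hpos z ⟨hz.1.1, hz.2.1⟩, fun x hx y hy => hmin (show (x, y) ∈ _ from ⟨hx, hy⟩)⟩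

end Calculus

/-! ### Gradient, mixed derivative and concavity of the utility -/

namespace IsUtility

variable {u : ℝ → ℝ → ℝ}

/-- The gradient of the utility, applied to a direction. -/
noncomputable abbrev grad (u : ℝ → ℝ → ℝ) (v z : ℝ × ℝ) : ℝ :=
  fderivWithin ℝ (fun z : ℝ × ℝ => u z.1 z.2) quadrant z v

lemma differentiableOn (hu : IsUtility u) :
    DifferentiableOn ℝ (fun z : ℝ × ℝ => u z.1 z.2) quadrant :=
  hu.contDiff.differentiableOn two_ne_zero

lemma du1_eq (hu : IsUtility u) {x y : ℝ} (hx : 0 ≤ x) (hy : 0 ≤ y) :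
    du1 u x y = grad u (1, 0) (x, y) :=
  (hasDerivWithinAt_left hu.differentiableOn hx hy).derivWithin (uniqueDiffOn_Ici 0 x hx)

lemma du2_eq (hu : IsUtility u) {x y : ℝ} (hx : 0 ≤ x) (hy : 0 ≤ y) :
    du2 u x y = grad u (0, 1) (x, y) :=
  (hasDerivWithinAt_right hu.differentiableOn hx hy).derivWithin (uniqueDiffOn_Ici 0 y hy)

lemma hasDerivWithinAt_du1 (hu : IsUtility u) {x y : ℝ} (hx : 0 ≤ x) (hy : 0 ≤ y) :
    HasDerivWithinAt (fun s => u s y) (du1 u x y) (Ici 0) x := by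
  rw [hu.du1_eq hx hy]
  exact hasDerivWithinAt_left hu.differentiableOn hx hy

lemma hasDerivWithinAt_du2 (hu : IsUtility u) {x y : ℝ} (hx : 0 ≤ x) (hy : 0 ≤ y) :
    HasDerivWithinAt (fun t => u x t) (du2 u x y) (Ici 0) y := by
  rw [hu.du2_eq hx hy]
  exact hasDerivWithinAt_right hu.differentiableOn hx hy

lemma contDiffOn_grad (hu : IsUtility u) (v : ℝ × ℝ) : ContDiffOn ℝ 1 (grad u v) quadrant :=
  contDiffOn_fderivWithin_apply hu.contDiff (by norm_num) v

lemma contDiffOn_du1 (hu : IsUtility u) :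
    ContDiffOn ℝ 1 (fun z : ℝ × ℝ => du1 u z.1 z.2) quadrant :=
  (hu.contDiffOn_grad (1, 0)).congr fun _ hz => hu.du1_eq hz.1 hz.2

lemma contDiffOn_du2 (hu : IsUtility u) :
    ContDiffOn ℝ 1 (fun z : ℝ × ℝ => du2 u z.1 z.2) quadrant :=
  (hu.contDiffOn_grad (0, 1)).congr fun _ hz => hu.du2_eq hz.1 hz.2

lemma continuousOn_uncurry (hu : IsUtility u) :
    ContinuousOn (fun z : ℝ × ℝ => u z.1 z.2) quadrant := hu.contDiff.continuousOn

lemma hasDerivWithinAt_du21 (hu : IsUtility u) {x y : ℝ} (hx : 0 ≤ x) (hy : 0 ≤ y) :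
    HasDerivWithinAt (fun s => du2 u s y) (du21 u x y) (Ici 0) x :=
  (hasDerivWithinAt_left (hu.contDiffOn_du2.differentiableOn one_ne_zero) hx
    hy).differentiableWithinAt.hasDerivWithinAt

lemma du21_eq (hu : IsUtility u) {x y : ℝ} (hx : 0 ≤ x) (hy : 0 ≤ y) :
    du21 u x y = fderivWithin ℝ (fun z : ℝ × ℝ => du2 u z.1 z.2) quadrant (x, y) (1, 0) :=
  (hasDerivWithinAt_left (hu.contDiffOn_du2.differentiableOn one_ne_zero) hx
    hy).derivWithin (uniqueDiffOn_Ici 0 x hx)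

lemma continuousOn_du21 (hu : IsUtility u) :
    ContinuousOn (fun z : ℝ × ℝ => du21 u z.1 z.2) quadrant :=
  (contDiffOn_fderivWithin_apply (m := 0) hu.contDiffOn_du2 (by simp) (1, 0)).continuousOn.congr
    fun _ hz => hu.du21_eq hz.1 hz.2

/-- Brings iterated partial derivatives into the form to which the symmetry of the second derivative
applies. -/
lemma fderivWithin_grad (hu : IsUtility u) {z : ℝ × ℝ} (hz : z ∈ quadrant) (v w : ℝ × ℝ) :
    fderivWithin ℝ (grad u v) quadrant z w =
      fderivWithin ℝ (fderivWithin ℝ (fun z : ℝ × ℝ => u z.1 z.2) quadrant) quadrant z w v := by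
  have h := ((hu.contDiff.fderivWithin uniqueDiffOn_quadrant (m := 1)
    (by norm_num)).differentiableOn one_ne_zero z hz).hasFDerivWithinAt
  have h2 := h.clm_apply (hasFDerivWithinAt_const v z quadrant)
  rw [h2.fderivWithin (uniqueDiffOn_quadrant z hz)]
  simp

/-- The mixed partial derivatives agree. -/
lemma hasDerivWithinAt_du12 (hu : IsUtility u) {x y : ℝ} (hx : 0 ≤ x) (hy : 0 ≤ y) :
    HasDerivWithinAt (fun t => du1 u x t) (du21 u x y) (Ici 0) y := by
  have hz := mk_mem_quadrant hx hy
  have hsymm : IsSymmSndFDerivWithinAt ℝ (fun z : ℝ × ℝ => u z.1 z.2) quadrant (x, y) := by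
    refine (hu.contDiff _ hz).isSymmSndFDerivWithinAt (by simp) uniqueDiffOn_quadrant ?_ hz
    rw [interior_prod_eq, closure_prod_eq]
    simpa using hz
  have h := hasDerivWithinAt_right (hu.contDiffOn_du1.differentiableOn one_ne_zero) hx hy
  convert h using 1
  rw [hu.du21_eq hx hy, fderivWithin_congr (f₁ := fun z : ℝ × ℝ => du2 u z.1 z.2)
      (f := grad u (0, 1)) (fun z hz => hu.du2_eq hz.1 hz.2) (hu.du2_eq hx hy),
    fderivWithin_congr (f₁ := fun z : ℝ × ℝ => du1 u z.1 z.2)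
      (f := grad u (1, 0)) (fun z hz => hu.du1_eq hz.1 hz.2) (hu.du1_eq hx hy)]
  exact (hu.fderivWithin_grad hz (0, 1) (1, 0)).trans
    ((hsymm _ _).trans (hu.fderivWithin_grad hz (1, 0) (0, 1)).symm)

/-- A strictly concave function lies strictly below its tangent planes. -/
lemma lt_tangent (hu : IsUtility u) {x y x' y' : ℝ} (hx : 0 ≤ x) (hy : 0 ≤ y) (hx' : 0 ≤ x')
    (hy' : 0 ≤ y') (hne : (x, y) ≠ (x', y')) :
    u x' y' < u x y + du1 u x y * (x' - x) + du2 u x y * (y' - y) := by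
  have weak : ∀ x' y', 0 ≤ x' → 0 ≤ y' →
      u x' y' ≤ u x y + du1 u x y * (x' - x) + du2 u x y * (y' - y) := by
    intro x' y' hx' hy'
    set a : ℝ × ℝ := (x, y)
    set b : ℝ × ℝ := (x', y')
    have ha : a ∈ quadrant := mk_mem_quadrant hx hy
    have hb : b ∈ quadrant := mk_mem_quadrant hx' hy'
    have hline : HasDerivWithinAt (fun s : ℝ => a + s • (b - a)) (b - a) (Icc 0 1) 0 := by
      simpa using (((hasDerivAt_id (0 : ℝ)).smul_const (b - a)).const_add a).hasDerivWithinAt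
    have hmem : ∀ s ∈ Icc (0 : ℝ) 1, a + s • (b - a) ∈ quadrant := fun s hs =>
      hu.strictConcave.1.add_smul_sub_mem ha hb hs
    have hd : HasDerivWithinAt (fun s : ℝ => u (a + s • (b - a)).1 (a + s • (b - a)).2)
        (grad u (b - a) a) (Icc 0 1) 0 := by
      have h1 := (hu.differentiableOn a ha).hasFDerivWithinAt
      have h1' : HasFDerivWithinAt (fun z : ℝ × ℝ => u z.1 z.2)
          (fderivWithin ℝ (fun z : ℝ × ℝ => u z.1 z.2) quadrant a) quadrant
          (a + (0 : ℝ) • (b - a)) := by simpa using h1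
      exact h1'.comp_hasDerivWithinAt 0 hline hmem
    have hgrad : grad u (b - a) a = du1 u x y * (x' - x) + du2 u x y * (y' - y) := by
      rw [hu.du1_eq hx hy, hu.du2_eq hx hy]
      have : b - a = (x' - x) • ((1 : ℝ), (0 : ℝ)) + (y' - y) • ((0 : ℝ), (1 : ℝ)) := by
        simp [a, b]
      rw [grad, this, map_add, map_smul, map_smul]
      simp only [smul_eq_mul]
      ring
    rw [hasDerivWithinAt_iff_tendsto_slope] at hd
    have hne : (𝓝[Icc (0 : ℝ) 1 \ {0}] 0).NeBot := by
      have : Icc (0 : ℝ) 1 \ {0} = Ioc 0 1 := by ext; simp [lt_iff_le_and_ne, eq_comm]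
      rw [this]
      exact mem_closure_iff_nhdsWithin_neBot.1 (by rw [closure_Ioc zero_ne_one]; simp)
    -- By concavity every difference quotient along the segment is at least the full increment, and
    -- the directional derivative is their limit.
    have := ge_of_tendsto hd (b := u x' y' - u x y) (by
      filter_upwards [self_mem_nhdsWithin] with s hs
      have hs0 : 0 < s := lt_of_le_of_ne hs.1.1 (Ne.symm hs.2)
      have hc := hu.strictConcave.concaveOn.2 ha hb (sub_nonneg.2 hs.1.2) hs.1.1 (by ring)
      have e : (1 - s) • a + s • b = a + s • (b - a) := by
        module
      rw [e] at hc
      rw [slope_def_field, le_div_iff₀ (by simpa using hs0)]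
      simp only [zero_smul, add_zero, smul_eq_mul, a, b] at hc ⊢
      linarith)
    linarith [hgrad]
  -- Strictness: the tangent plane dominates at the midpoint, where strict concavity puts `u`
  -- strictly above the mean of the endpoint values.
  have hm := weak ((x + x') / 2) ((y + y') / 2) (by positivity) (by positivity)
  have hc := hu.strictConcave.2 (mk_mem_quadrant hx hy) (mk_mem_quadrant hx' hy') hne
    (by norm_num : (0 : ℝ) < 1 / 2) (by norm_num : (0 : ℝ) < 1 / 2) (by norm_num)
  have e : ((1 / 2 : ℝ) • (x, y) + (1 / 2 : ℝ) • (x', y')) = ((x + x') / 2, (y + y') / 2) := by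
    ext <;> simp <;> ring
  rw [e] at hc
  simp only [smul_eq_mul] at hc
  nlinarith

/-- Strict monotonicity of the gradient. -/
lemma grad_strictAnti (hu : IsUtility u) {x y x' y' : ℝ} (hx : 0 ≤ x) (hy : 0 ≤ y)
    (hx' : 0 ≤ x') (hy' : 0 ≤ y') (hne : (x, y) ≠ (x', y')) :
    (du1 u x' y' - du1 u x y) * (x' - x) + (du2 u x' y' - du2 u x y) * (y' - y) < 0 := by
  have h1 := hu.lt_tangent hx hy hx' hy' hne
  have h2 := hu.lt_tangent hx' hy' hx hy hne.symm
  nlinarith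

lemma du2_lt_du2 (hu : IsUtility u) {x y y' : ℝ} (hx : 0 ≤ x) (hy : 0 ≤ y) (hyy : y < y') :
    du2 u x y' < du2 u x y := by
  have := hu.grad_strictAnti hx hy hx (hy.trans hyy.le) (by simp [hyy.ne])
  nlinarith

/-- The tangent line overestimates the increase of `u` over a unit step, and that increase is
positive. -/
lemma du1_pos (hu : IsUtility u) {x y : ℝ} (hx : 0 ≤ x) (hy : 0 ≤ y) : 0 < du1 u x y := by
  have h := hu.lt_tangent hx hy (by linarith : 0 ≤ x + 1) hy (by simp)
  have := hu.strictMono_left y hy (show x ∈ Ici 0 from hx) (show x + 1 ∈ Ici 0 by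
    simp only [mem_Ici]; linarith) (by linarith)
  simp only at this
  linarith

lemma du2_pos (hu : IsUtility u) {x y : ℝ} (hx : 0 ≤ x) (hy : 0 ≤ y) : 0 < du2 u x y := by
  have h := hu.lt_tangent hx hy hx (by linarith : 0 ≤ y + 1) (by simp)
  have := hu.strictMono_right x hx (show y ∈ Ici 0 from hy) (show y + 1 ∈ Ici 0 by
    simp only [mem_Ici]; linarith) (by linarith)
  simp only at this
  linarith

/-! ### Monotone marginal utilities under a mixed derivative of constant sign -/

section Sign

variable {e : ℝ}

/-- Compactness makes the sign of the mixed derivative quantitative. This bound yields the Lipschitz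
constant of `ŷ`; its analogue in the first variable excludes an atom at the top. -/
lemma exists_lower_bound_du12 (hu : IsUtility u)
    (he : ∀ x y, 0 ≤ x → 0 ≤ y → 0 < e * du21 u x y) {M : ℝ} (hM : 0 ≤ M) :
    ∃ c, 0 < c ∧ ∀ x ∈ Icc 0 M, ∀ y ∈ Icc 0 M, ∀ y' ∈ Icc 0 M, y ≤ y' →
      c * (y' - y) ≤ e * du1 u x y' - e * du1 u x y := by
  obtain ⟨c, hc, h⟩ := exists_pos_lower_bound (g := fun z : ℝ × ℝ => e * du21 u z.1 z.2)
    (continuousOn_const.mul hu.continuousOn_du21) (fun z hz => he _ _ hz.1 hz.2) hM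
  exact ⟨c, hc, fun x hx y hy y' hy' hyy => mul_sub_le_of_hasDerivWithinAt
    (h := fun t => e * du1 u x t) hy.1 hyy
    (fun s hs => (hu.hasDerivWithinAt_du12 hx.1 (hy.1.trans hs.1)).const_mul e)
    (fun s hs => h x hx s ⟨hy.1.trans hs.1, hs.2.trans hy'.2⟩)⟩

lemma exists_lower_bound_du21 (hu : IsUtility u)
    (he : ∀ x y, 0 ≤ x → 0 ≤ y → 0 < e * du21 u x y) {M : ℝ} (hM : 0 ≤ M) :
    ∃ c, 0 < c ∧ ∀ x ∈ Icc 0 M, ∀ x' ∈ Icc 0 M, ∀ y ∈ Icc 0 M, x ≤ x' →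
      c * (x' - x) ≤ e * du2 u x' y - e * du2 u x y := by
  obtain ⟨c, hc, h⟩ := exists_pos_lower_bound (g := fun z : ℝ × ℝ => e * du21 u z.1 z.2)
    (continuousOn_const.mul hu.continuousOn_du21) (fun z hz => he _ _ hz.1 hz.2) hM
  exact ⟨c, hc, fun x hx x' hx' y hy hxx => mul_sub_le_of_hasDerivWithinAt
    (h := fun s => e * du2 u s y) hx.1 hxx
    (fun s hs => (hu.hasDerivWithinAt_du21 (hx.1.trans hs.1) hy.1).const_mul e)
    (fun s hs => h s ⟨hx.1.trans hs.1, hs.2.trans hx'.2⟩ y hy)⟩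

lemma strictMonoOn_du1 (hu : IsUtility u)
    (he : ∀ x y, 0 ≤ x → 0 ≤ y → 0 < e * du21 u x y) {x : ℝ} (hx : 0 ≤ x) :
    StrictMonoOn (fun y => e * du1 u x y) (Ici 0) := by
  intro y hy y' hy' hyy
  have hM : (0 : ℝ) ≤ max x y' := le_max_of_le_left hx
  obtain ⟨c, hc, h⟩ := hu.exists_lower_bound_du12 he hM
  have := h x ⟨hx, le_max_left _ _⟩ y ⟨hy, hyy.le.trans (le_max_right _ _)⟩ y'
    ⟨hy', le_max_right _ _⟩ hyy.le
  have := mul_pos hc (sub_pos.2 hyy)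
  simp only
  linarith

lemma strictMonoOn_du2 (hu : IsUtility u)
    (he : ∀ x y, 0 ≤ x → 0 ≤ y → 0 < e * du21 u x y) {y : ℝ} (hy : 0 ≤ y) :
    StrictMonoOn (fun x => e * du2 u x y) (Ici 0) := by
  intro x hx x' hx' hxx
  have hM : (0 : ℝ) ≤ max y x' := le_max_of_le_left hy
  obtain ⟨c, hc, h⟩ := hu.exists_lower_bound_du21 he hM
  have := h x ⟨hx, hxx.le.trans (le_max_right _ _)⟩ x' ⟨hx', le_max_right _ _⟩ y
    ⟨hy, le_max_left _ _⟩ hxx.le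
  have := mul_pos hc (sub_pos.2 hxx)
  simp only
  linarith

end Sign

end IsUtility

end PrivateTransactions

/-! ### The curve `ŷ`, its inverse, and the types it defines -/

namespace PrivateTransactions

open Filter Topology

/-- The inverse of `ŷ` on the interval between `xo` and `xs`, extended to `ℝ` by constants. -/
noncomputable def xhat (u : ℝ → ℝ → ℝ) (k xs ys xo t : ℝ) : ℝ :=
  Function.invFunOn (yhat u k) (uIcc xo xs) (max 0 (min ys t))

/-- The demand `ŷ(x)`, extended to `ℝ` by constants. -/
noncomputable def demand (u : ℝ → ℝ → ℝ) (k xs xo x : ℝ) : ℝ :=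
  yhat u k (max (min xo xs) (min (max xo xs) x))

/-- The marginal utility of the second good of a consumer whose demand is `t`. -/
noncomputable def marginal (u : ℝ → ℝ → ℝ) (k xs ys xo t s : ℝ) : ℝ :=
  du2 u (xhat u k xs ys xo t) (max s 0)

/-- The primitives of the theorem, for a mixed partial derivative of constant sign `e`. -/
structure Setting (u : ℝ → ℝ → ℝ) (k xs ys xo e : ℝ) : Prop where
  utility : IsUtility u
  efficient : IsEfficient u k xs ys
  observable : IsObservableOutcome u k xo
  sign : e = 1 ∨ e = -1
  mixed_pos : ∀ x y, 0 ≤ x → 0 ≤ y → 0 < e * du21 u x y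

namespace Setting

variable {u : ℝ → ℝ → ℝ} {k xs ys xo e : ℝ}

lemma k_pos (S : Setting u k xs ys xo e) : 0 < k := by
  rw [← S.observable.foc]
  exact S.utility.du1_pos S.observable.pos.le le_rfl

/-- Lowering the second good from `ys` to `0` moves `e * u₁` at `xs` below `e * k`, while `u₁(·, 0)`
is decreasing and equals `k` at `xo`. -/
lemma order (S : Setting u k xs ys xo e) : 0 < e * (xs - xo) := by
  have h1 := S.utility.strictMonoOn_du1 S.mixed_pos S.efficient.pos_left.le
    (self_mem_Ici (a := (0 : ℝ))) (show ys ∈ Ici 0 from S.efficient.pos_right.le)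
    S.efficient.pos_right
  simp only [S.efficient.foc_left] at h1
  have hne : xs ≠ xo := by
    rintro rfl
    rw [S.observable.foc] at h1
    exact lt_irrefl _ h1
  have h2 := S.utility.grad_strictAnti S.observable.pos.le le_rfl S.efficient.pos_left.le
    (le_refl (0 : ℝ)) (by simpa using hne.symm)
  rw [S.observable.foc] at h2
  rcases S.sign with rfl | rfl <;> nlinarith

lemma mem_uIcc_iff (S : Setting u k xs ys xo e) {x : ℝ} :
    x ∈ uIcc xo xs ↔ 0 ≤ e * (x - xo) ∧ 0 ≤ e * (xs - x) := by
  have h := S.order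
  rcases S.sign with rfl | rfl
  · rw [uIcc_of_le (by linarith)]
    constructor <;> rintro ⟨h1, h2⟩ <;> constructor <;> linarith
  · rw [uIcc_of_ge (by linarith)]
    constructor <;> rintro ⟨h1, h2⟩ <;> constructor <;> linarith

lemma pos_of_mem (S : Setting u k xs ys xo e) {x : ℝ} (hx : x ∈ uIcc xo xs) : 0 < x :=
  (lt_min S.observable.pos S.efficient.pos_left).trans_le hx.1

lemma sign_du1_anti (S : Setting u k xs ys xo e) {x x' y : ℝ} (hx : 0 ≤ x) (hx' : 0 ≤ x')
    (hy : 0 ≤ y) (h : 0 ≤ e * (x' - x)) : e * du1 u x' y ≤ e * du1 u x y := by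
  rcases eq_or_ne x x' with rfl | hne
  · exact le_rfl
  have h2 := S.utility.grad_strictAnti hx hy hx' hy (by simpa using hne)
  rcases S.sign with rfl | rfl <;> nlinarith [mul_self_pos.2 (sub_ne_zero.2 hne)]

lemma continuousOn_du1_right (S : Setting u k xs ys xo e) {x : ℝ} (hx : 0 ≤ x) :
    ContinuousOn (fun y => du1 u x y) (Ici 0) :=
  S.utility.contDiffOn_du1.continuousOn.comp (f := fun y => (x, y)) (by fun_prop)
    fun _ hy => ⟨hx, hy⟩

/-- The function `e * u₁(x, ·)` is increasing. Since `u₁` falls in `x`, comparison with `(xo, 0)`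
puts it at or below `e * k` at `0`, and comparison with `(xs, ys)` at or above `e * k` at `ys`. The
infimum defining `yhat` is thus over a singleton. -/
lemma existsUnique_yhat (S : Setting u k xs ys xo e) {x : ℝ} (hx : x ∈ uIcc xo xs) :
    (yhat u k x ∈ Icc 0 ys ∧ du1 u x (yhat u k x) = k) ∧
      ∀ y, 0 ≤ y → du1 u x y = k → y = yhat u k x := by
  have hx0 := (S.pos_of_mem hx).le
  have hy0 := S.efficient.pos_right.le
  obtain ⟨h1, h2⟩ := S.mem_uIcc_iff.1 hx
  have e0 : e ≠ 0 := by rcases S.sign with rfl | rfl <;> norm_num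
  have l1 := S.sign_du1_anti S.observable.pos.le hx0 le_rfl h1
  have l2 := S.sign_du1_anti hx0 S.efficient.pos_left.le hy0 h2
  rw [S.observable.foc] at l1
  rw [S.efficient.foc_left] at l2
  have hmono := S.utility.strictMonoOn_du1 S.mixed_pos hx0
  obtain ⟨y, hy, hyk⟩ := intermediate_value_Icc hy0
    ((continuousOn_const.mul (S.continuousOn_du1_right hx0)).mono
      (Icc_subset_Ici_self : Icc 0 ys ⊆ Ici 0)) ⟨l1, l2⟩
  have hyk' : du1 u x y = k := mul_left_cancel₀ e0 hyk
  have huniq : ∀ y', 0 ≤ y' → du1 u x y' = k → y' = y := fun y' hy' h' =>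
    hmono.injOn hy' hy.1 (by simp only [h', hyk'])
  have heq : yhat u k x = y := by
    have : {y : ℝ | 0 ≤ y ∧ du1 u x y = k} = {y} := by
      ext y'
      simp only [mem_ofPred_eq, mem_singleton_iff]
      exact ⟨fun h => huniq y' h.1 h.2, fun h => h ▸ ⟨hy.1, hyk'⟩⟩
    rw [yhat, this, csInf_singleton]
  rw [heq]
  exact ⟨⟨hy, hyk'⟩, huniq⟩

lemma yhat_mem (S : Setting u k xs ys xo e) {x : ℝ} (hx : x ∈ uIcc xo xs) :
    yhat u k x ∈ Icc 0 ys := (S.existsUnique_yhat hx).1.1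

lemma du1_yhat (S : Setting u k xs ys xo e) {x : ℝ} (hx : x ∈ uIcc xo xs) :
    du1 u x (yhat u k x) = k := (S.existsUnique_yhat hx).1.2

lemma eq_yhat (S : Setting u k xs ys xo e) {x y : ℝ} (hx : x ∈ uIcc xo xs) (hy : 0 ≤ y)
    (h : du1 u x y = k) : y = yhat u k x := (S.existsUnique_yhat hx).2 y hy h

lemma yhat_xo (S : Setting u k xs ys xo e) : yhat u k xo = 0 :=
  (S.eq_yhat left_mem_uIcc le_rfl S.observable.foc).symm

lemma yhat_xs (S : Setting u k xs ys xo e) : yhat u k xs = ys :=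
  (S.eq_yhat right_mem_uIcc S.efficient.pos_right.le S.efficient.foc_left).symm

/-- Moving from `x` to `x'` at fixed `y = ŷ(x)` pushes `e * u₁` below `e * k`, and only a larger `y`
restores it. -/
lemma yhat_lt_yhat (S : Setting u k xs ys xo e) {x x' : ℝ} (hx : x ∈ uIcc xo xs)
    (hx' : x' ∈ uIcc xo xs) (h : 0 < e * (x' - x)) : yhat u k x < yhat u k x' := by
  by_contra! hle
  have h0 := (S.pos_of_mem hx).le
  have h0' := (S.pos_of_mem hx').le
  have h1 := (S.utility.strictMonoOn_du1 S.mixed_pos h0').monotoneOn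
    (S.yhat_mem hx').1 (S.yhat_mem hx).1 hle
  simp only [S.du1_yhat hx'] at h1
  have hne : x ≠ x' := by rintro rfl; simp at h
  have h2 := S.utility.grad_strictAnti h0 (S.yhat_mem hx).1 h0' (S.yhat_mem hx).1
    (by simpa using hne)
  rw [S.du1_yhat hx] at h2
  rcases S.sign with rfl | rfl <;> nlinarith

lemma yhat_injOn (S : Setting u k xs ys xo e) : InjOn (yhat u k) (uIcc xo xs) := by
  intro x hx x' hx' h
  by_contra hne
  rcases lt_or_gt_of_ne (mul_ne_zero (a := e) (by rcases S.sign with rfl | rfl <;> norm_num)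
    (sub_ne_zero.2 hne)) with h1 | h1
  · exact (S.yhat_lt_yhat hx hx' (by linarith)).ne h
  · exact (S.yhat_lt_yhat hx' hx h1).ne h.symm

/-- Along the curve `u₁` stays at `k`, so its change in `y`, at least `c |Δy|`, is offset by its
change in `x`, at most `C |Δx|`. The inverse need not be Lipschitz, since strict concavity lets
`u₁₁` vanish at points. -/
lemma exists_lipschitz_yhat (S : Setting u k xs ys xo e) :
    ∃ C, 0 < C ∧ ∀ x ∈ uIcc xo xs, ∀ x' ∈ uIcc xo xs,
      |yhat u k x - yhat u k x'| ≤ C * |x - x'| := by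
  set M := max (max xo xs) ys
  have hM : 0 ≤ M := le_max_of_le_right S.efficient.pos_right.le
  obtain ⟨c, hc, h1⟩ := S.utility.exists_lower_bound_du12 S.mixed_pos hM
  obtain ⟨C, hC, h2⟩ := exists_lipschitz_left S.utility.contDiffOn_du1 M
  have hI : ∀ x ∈ uIcc xo xs, x ∈ Icc 0 M := fun x hx =>
    ⟨(S.pos_of_mem hx).le, hx.2.trans (le_max_left _ _)⟩
  have hY : ∀ x ∈ uIcc xo xs, yhat u k x ∈ Icc 0 M := fun x hx =>
    ⟨(S.yhat_mem hx).1, (S.yhat_mem hx).2.trans (le_max_right _ _)⟩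
  have key : ∀ x ∈ uIcc xo xs, ∀ x' ∈ uIcc xo xs, yhat u k x ≤ yhat u k x' →
      c * (yhat u k x' - yhat u k x) ≤ C * |x - x'| := by
    intro x hx x' hx' hle
    have a1 := h1 x (hI x hx) _ (hY x hx) _ (hY x' hx') hle
    have a2 := h2 x (hI x hx) x' (hI x' hx') _ (hY x' hx')
    simp only [S.du1_yhat hx, S.du1_yhat hx'] at a1 a2
    refine a1.trans (le_trans ?_ a2)
    rcases S.sign with rfl | rfl
    · linarith [le_abs_self (du1 u x (yhat u k x') - k)]
    · linarith [neg_le_abs (du1 u x (yhat u k x') - k)]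
  refine ⟨C / c, div_pos hC hc, fun x hx x' hx' => ?_⟩
  rw [div_mul_eq_mul_div, le_div_iff₀ hc]
  rcases le_total (yhat u k x) (yhat u k x') with h | h
  · rw [abs_of_nonpos (by linarith)]
    linarith [key x hx x' hx' h]
  · rw [abs_of_nonneg (by linarith), abs_sub_comm]
    linarith [key x' hx' x hx h]

lemma continuousOn_yhat (S : Setting u k xs ys xo e) :
    ContinuousOn (yhat u k) (uIcc xo xs) := by
  obtain ⟨C, hC, h⟩ := S.exists_lipschitz_yhat
  refine (LipschitzOnWith.of_dist_le_mul (K := ⟨C, hC.le⟩) fun x hx x' hx' => ?_).continuousOn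
  rw [Real.dist_eq, Real.dist_eq]
  exact h x hx x' hx'

lemma surjOn_yhat (S : Setting u k xs ys xo e) : SurjOn (yhat u k) (uIcc xo xs) (Icc 0 ys) := by
  have := intermediate_value_uIcc S.continuousOn_yhat
  rwa [S.yhat_xo, S.yhat_xs, uIcc_of_le S.efficient.pos_right.le] at this

section xhat

lemma clamp_mem (S : Setting u k xs ys xo e) (t : ℝ) : max 0 (min ys t) ∈ Icc 0 ys :=
  ⟨le_max_left _ _, max_le S.efficient.pos_right.le (min_le_left _ _)⟩

lemma xhat_mem (S : Setting u k xs ys xo e) (t : ℝ) : xhat u k xs ys xo t ∈ uIcc xo xs :=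
  Function.invFunOn_mem (S.surjOn_yhat (S.clamp_mem t))

lemma xhat_pos (S : Setting u k xs ys xo e) (t : ℝ) : 0 < xhat u k xs ys xo t :=
  S.pos_of_mem (S.xhat_mem t)

lemma yhat_xhat' (S : Setting u k xs ys xo e) (t : ℝ) :
    yhat u k (xhat u k xs ys xo t) = max 0 (min ys t) :=
  Function.invFunOn_eq (S.surjOn_yhat (S.clamp_mem t))

lemma yhat_xhat (S : Setting u k xs ys xo e) {t : ℝ} (ht : t ∈ Icc 0 ys) :
    yhat u k (xhat u k xs ys xo t) = t := by
  rw [S.yhat_xhat', min_eq_right ht.2, max_eq_right ht.1]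

lemma xhat_yhat (S : Setting u k xs ys xo e) {x : ℝ} (hx : x ∈ uIcc xo xs) :
    xhat u k xs ys xo (yhat u k x) = x :=
  S.yhat_injOn (S.xhat_mem _) hx (S.yhat_xhat (S.yhat_mem hx))

lemma xhat_zero (S : Setting u k xs ys xo e) : xhat u k xs ys xo 0 = xo := by
  rw [← S.yhat_xo, S.xhat_yhat left_mem_uIcc]

lemma xhat_ys (S : Setting u k xs ys xo e) : xhat u k xs ys xo ys = xs := by
  conv_lhs => rw [← S.yhat_xs]
  have := S.xhat_yhat (right_mem_uIcc (a := xo) (b := xs))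
  rwa [S.yhat_xs] at this ⊢

lemma du1_xhat (S : Setting u k xs ys xo e) {t : ℝ} (ht : t ∈ Icc 0 ys) :
    du1 u (xhat u k xs ys xo t) t = k := by
  have := S.du1_yhat (S.xhat_mem t)
  rwa [S.yhat_xhat ht] at this

/-- Preimages of closed sets under `x̂` are images under `ŷ` of compact sets. -/
lemma continuousOn_xhat (S : Setting u k xs ys xo e) :
    ContinuousOn (xhat u k xs ys xo) (Icc 0 ys) := by
  rw [continuousOn_iff_isClosed]
  intro C hC
  refine ⟨yhat u k '' (uIcc xo xs ∩ C), ?_, ?_⟩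
  · exact ((isCompact_uIcc.inter_right hC).image_of_continuousOn
      (S.continuousOn_yhat.mono inter_subset_left)).isClosed
  · ext t
    simp only [mem_inter_iff, mem_preimage, mem_image, and_congr_left_iff]
    refine fun ht => ⟨fun h => ⟨_, ⟨S.xhat_mem t, h⟩, S.yhat_xhat ht⟩, ?_⟩
    rintro ⟨x, ⟨hx, hxC⟩, rfl⟩
    rwa [S.xhat_yhat hx]

lemma continuous_xhat (S : Setting u k xs ys xo e) : Continuous (xhat u k xs ys xo) := by
  have h : Continuous fun t => xhat u k xs ys xo (max 0 (min ys t)) :=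
    S.continuousOn_xhat.comp_continuous (by fun_prop) S.clamp_mem
  refine h.congr fun t => ?_
  obtain ⟨h0, h1⟩ := S.clamp_mem t
  simp only [xhat, min_eq_right h1, max_eq_right h0]

lemma xhat_lt_xhat (S : Setting u k xs ys xo e) {t t' : ℝ} (ht : t ∈ Icc 0 ys)
    (ht' : t' ∈ Icc 0 ys) (h : t < t') :
    0 < e * (xhat u k xs ys xo t' - xhat u k xs ys xo t) := by
  by_contra! hle
  rcases hle.lt_or_eq with hlt | heq
  · have := S.yhat_lt_yhat (S.xhat_mem t') (S.xhat_mem t) (by linarith)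
    rw [S.yhat_xhat ht, S.yhat_xhat ht'] at this
    linarith
  · have : xhat u k xs ys xo t' = xhat u k xs ys xo t := by
      rcases S.sign with rfl | rfl <;> linarith
    have := congrArg (yhat u k) this
    rw [S.yhat_xhat ht, S.yhat_xhat ht'] at this
    exact h.ne' this

/-- `x̂(t)` is the unique maximizer of the joint surplus of consumer and seller 1. -/
lemma surplus_lt (S : Setting u k xs ys xo e) {t x : ℝ} (ht : t ∈ Icc 0 ys) (hx : 0 ≤ x)
    (hne : x ≠ xhat u k xs ys xo t) :
    u x t - k * x < u (xhat u k xs ys xo t) t - k * xhat u k xs ys xo t := by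
  have := S.utility.lt_tangent (S.xhat_pos t).le ht.1 hx ht.1 (by simpa using hne.symm)
  rw [S.du1_xhat ht] at this
  linarith

lemma surplus_le (S : Setting u k xs ys xo e) {t x : ℝ} (ht : t ∈ Icc 0 ys) (hx : 0 ≤ x) :
    u x t - k * x ≤ u (xhat u k xs ys xo t) t - k * xhat u k xs ys xo t := by
  rcases eq_or_ne x (xhat u k xs ys xo t) with rfl | h
  · exact le_rfl
  · exact (S.surplus_lt ht hx h).le

/-- The tangent plane at the efficient pair has both slopes `k`. The strict inequality is what later
rules out consumption beyond `xs`. -/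
lemma total_surplus_lt (S : Setting u k xs ys xo e) {x y : ℝ} (hx : 0 ≤ x) (hy : 0 ≤ y)
    (hne : x ≠ xs) : u x y - k * x - k * y < u xs ys - k * xs - k * ys := by
  have := S.utility.lt_tangent S.efficient.pos_left.le S.efficient.pos_right.le hx hy
    (fun h => hne (congrArg Prod.fst h).symm)
  rw [S.efficient.foc_left, S.efficient.foc_right] at this
  linarith

end xhat

/-! ### Marginal utilities of types and the envelope formula -/

section Marginal

lemma continuous_marginal (S : Setting u k xs ys xo e) :
    Continuous fun z : ℝ × ℝ => marginal u k xs ys xo z.1 z.2 :=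
  S.utility.contDiffOn_du2.continuousOn.comp_continuous
    (f := fun z : ℝ × ℝ => (xhat u k xs ys xo z.1, max z.2 0))
    ((S.continuous_xhat.comp continuous_fst).prodMk (by fun_prop))
    fun z => mk_mem_quadrant (S.xhat_pos _).le (le_max_right _ _)

lemma marginal_pos (S : Setting u k xs ys xo e) (t s : ℝ) : 0 < marginal u k xs ys xo t s :=
  S.utility.du2_pos (S.xhat_pos t).le (le_max_right _ _)

/-- Single crossing for both signs: a larger demand moves `x̂` in the direction `e`, in which `u₂`
grows. -/
lemma marginal_lt_left (S : Setting u k xs ys xo e) {t t' : ℝ} (s : ℝ) (ht : t ∈ Icc 0 ys)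
    (ht' : t' ∈ Icc 0 ys) (h : t < t') :
    marginal u k xs ys xo t s < marginal u k xs ys xo t' s := by
  have h1 := S.xhat_lt_xhat ht ht' h
  have hm := S.utility.strictMonoOn_du2 S.mixed_pos (le_max_right s 0)
  have m1 : xhat u k xs ys xo t ∈ Ici 0 := (S.xhat_pos t).le
  have m2 : xhat u k xs ys xo t' ∈ Ici 0 := (S.xhat_pos t').le
  unfold marginal
  rcases S.sign with rfl | rfl
  · have := hm m1 m2 (by linarith); simp only at this; linarith
  · have := hm m2 m1 (by linarith); simp only at this; linarith

lemma marginal_le_left (S : Setting u k xs ys xo e) {t t' : ℝ} (s : ℝ) (ht : t ∈ Icc 0 ys)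
    (ht' : t' ∈ Icc 0 ys) (h : t ≤ t') :
    marginal u k xs ys xo t s ≤ marginal u k xs ys xo t' s := by
  rcases h.eq_or_lt with rfl | h
  · exact le_rfl
  · exact (S.marginal_lt_left s ht ht' h).le

lemma marginal_lt_right (S : Setting u k xs ys xo e) (t : ℝ) {s s' : ℝ} (hs : 0 ≤ s)
    (h : s < s') : marginal u k xs ys xo t s' < marginal u k xs ys xo t s := by
  unfold marginal
  rw [max_eq_left hs, max_eq_left (hs.trans h.le)]
  exact S.utility.du2_lt_du2 (S.xhat_pos t).le hs h

lemma marginal_le_right (S : Setting u k xs ys xo e) (t : ℝ) {s s' : ℝ} (hs : 0 ≤ s)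
    (h : s ≤ s') : marginal u k xs ys xo t s' ≤ marginal u k xs ys xo t s := by
  rcases h.eq_or_lt with rfl | h
  · exact le_rfl
  · exact (S.marginal_lt_right t hs h).le

lemma marginal_ys (S : Setting u k xs ys xo e) : marginal u k xs ys xo ys ys = k := by
  rw [marginal, S.xhat_ys, max_eq_left S.efficient.pos_right.le, S.efficient.foc_right]

/-- Strict monotonicity of the gradient between `(x̂(t), t)` and the efficient pair; `u₁` equals `k`
at both, so only the term in `u₂` remains. -/
lemma lt_marginal_diag (S : Setting u k xs ys xo e) {t : ℝ} (h0 : 0 ≤ t) (h : t < ys) :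
    k < marginal u k xs ys xo t t := by
  have := S.utility.grad_strictAnti (S.xhat_pos t).le h0 S.efficient.pos_left.le
    S.efficient.pos_right.le (fun hh => h.ne (congrArg Prod.snd hh))
  rw [S.efficient.foc_left, S.efficient.foc_right, S.du1_xhat ⟨h0, h.le⟩] at this
  rw [marginal, max_eq_left h0]
  nlinarith

lemma le_marginal_diag (S : Setting u k xs ys xo e) {t : ℝ} (ht : t ∈ Icc 0 ys) :
    k ≤ marginal u k xs ys xo t t := by
  rcases ht.2.eq_or_lt with rfl | h
  · exact S.marginal_ys.ge
  · exact (S.lt_marginal_diag ht.1 h).le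

lemma integral_du2 (S : Setting u k xs ys xo e) {x a b : ℝ} (hx : 0 ≤ x) (ha : 0 ≤ a)
    (hb : 0 ≤ b) : ∫ s in a..b, du2 u x s = u x b - u x a := by
  have hsub : uIcc a b ⊆ Ici 0 := fun s hs => (le_min ha hb).trans hs.1
  have hcd : ContinuousOn (fun s => du2 u x s) (uIcc a b) :=
    (S.utility.contDiffOn_du2.continuousOn.comp (f := fun y => (x, y)) (by fun_prop)
      fun _ hy => ⟨hx, hy⟩).mono hsub
  refine intervalIntegral.integral_eq_sub_of_hasDeriv_right
    (f := fun s => u x s)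
    (fun s hs => (S.utility.hasDerivWithinAt_du2 hx (hsub hs)).continuousWithinAt.mono hsub)
    (fun s hs => ?_) hcd.intervalIntegrable
  exact (S.utility.hasDerivWithinAt_du2 hx (hsub (Ioo_subset_Icc_self hs))).mono
    (Ioi_subset_Ici (mem_Ici.1 (hsub (Ioo_subset_Icc_self hs))))

lemma intervalIntegrable_du2 (S : Setting u k xs ys xo e) {x a b : ℝ} (hx : 0 ≤ x) (ha : 0 ≤ a)
    (hb : 0 ≤ b) : IntervalIntegrable (fun s => du2 u x s) volume a b :=
  ((S.utility.contDiffOn_du2.continuousOn.comp (f := fun y => (x, y)) (by fun_prop)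
    fun _ hy => ⟨hx, hy⟩).mono fun _ hs => (le_min ha hb).trans hs.1).intervalIntegrable

lemma integral_marginal (S : Setting u k xs ys xo e) {t a b : ℝ} (ha : 0 ≤ a) (hb : 0 ≤ b) :
    ∫ s in a..b, marginal u k xs ys xo t s =
      u (xhat u k xs ys xo t) b - u (xhat u k xs ys xo t) a := by
  rw [← S.integral_du2 (S.xhat_pos t).le ha hb]
  refine intervalIntegral.integral_congr fun s hs => ?_
  simp only [marginal, max_eq_left ((le_min ha hb).trans hs.1)]

/-- The envelope theorem for the joint surplus of consumer and seller 1. -/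
lemma hasDerivAt_surplus (S : Setting u k xs ys xo e) {t : ℝ} (ht : t ∈ Ioo 0 ys) :
    HasDerivAt (fun t => u (xhat u k xs ys xo t) t - k * xhat u k xs ys xo t)
      (marginal u k xs ys xo t t) t := by
  rw [hasDerivAt_iff_isLittleO, Asymptotics.isLittleO_iff]
  intro η hη
  have hcont := S.continuous_marginal.tendsto (t, t)
  obtain ⟨r, hr, hball⟩ := Metric.mem_nhds_iff.1
    (hcont (Metric.closedBall_mem_nhds (marginal u k xs ys xo t t) hη))
  have hnear : ∀ a b, |a - t| < r → |b - t| < r →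
      |marginal u k xs ys xo a b - marginal u k xs ys xo t t| ≤ η := by
    intro a b ha hb
    have := @hball (a, b) (by
      rw [Metric.mem_ball, Prod.dist_eq, max_lt_iff, Real.dist_eq, Real.dist_eq]
      exact ⟨ha, hb⟩)
    simpa [Real.dist_eq] using this
  filter_upwards [Metric.ball_mem_nhds t hr, Icc_mem_nhds ht.1 ht.2] with t' ht'r ht'
  rw [Metric.mem_ball, Real.dist_eq] at ht'r
  have htI : t ∈ Icc 0 ys := Ioo_subset_Icc_self ht
  -- Optimality at `t'` and at `t` sandwiches the change of the surplus between the changes of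
  -- `u(x̂(t), ·)` and of `u(x̂(t'), ·)`. Continuity of `x̂` then suffices, without any derivative.
  have l1 := S.surplus_le ht' (S.xhat_pos t).le
  have l2 := S.surplus_le htI (S.xhat_pos t').le
  have bound : ∀ a, |a - t| < r → |(u (xhat u k xs ys xo a) t' - u (xhat u k xs ys xo a) t)
      - (t' - t) * marginal u k xs ys xo t t| ≤ η * |t' - t| := by
    intro a ha
    rw [← S.integral_marginal htI.1 ht'.1, ← smul_eq_mul (t' - t),
      ← intervalIntegral.integral_const, ← intervalIntegral.integral_sub]
    · rw [← Real.norm_eq_abs]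
      refine intervalIntegral.norm_integral_le_of_norm_le_const fun s hs => hnear a s ha ?_
      refine lt_of_le_of_lt ?_ ht'r
      rcases le_total t t' with h | h
      · rw [uIoc_of_le h] at hs
        rw [abs_of_nonneg (by linarith [hs.1]), abs_of_nonneg (by linarith)]
        linarith [hs.2]
      · rw [uIoc_of_ge h] at hs
        rw [abs_of_nonpos (by linarith [hs.2]), abs_of_nonpos (by linarith)]
        linarith [hs.1]
    · exact (S.continuous_marginal.comp (by fun_prop :
        Continuous fun s : ℝ => (a, s))).intervalIntegrable _ _
    · exact intervalIntegrable_const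
  have b1 := abs_le.1 (bound t (by simpa using hr))
  have b2 := abs_le.1 (bound t' ht'r)
  rw [Real.norm_eq_abs, Real.norm_eq_abs, smul_eq_mul, abs_le]
  constructor
  · linarith [b1.1]
  · linarith [b2.2]

/-- The envelope formula integrated from `x̂(0) = xo`, where the surplus is `Σ`. For `t = ŷ(x)` the
right side is `q(x) - k ŷ(x)`. -/
lemma integral_marginal_diag (S : Setting u k xs ys xo e) {t : ℝ} (ht : t ∈ Icc 0 ys) :
    ∫ s in 0..t, (marginal u k xs ys xo s s - k) =
      u (xhat u k xs ys xo t) t - k * xhat u k xs ys xo t - k * t - jointPayoff u k xo := by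
  have hdiag : Continuous fun s => marginal u k xs ys xo s s :=
    S.continuous_marginal.comp (by fun_prop : Continuous fun s : ℝ => (s, s))
  have hcont : ContinuousOn (fun t => u (xhat u k xs ys xo t) t - k * xhat u k xs ys xo t)
      (Icc 0 t) :=
    ContinuousOn.sub (S.utility.continuousOn_uncurry.comp
      (f := fun t => (xhat u k xs ys xo t, t))
      ((S.continuous_xhat.prodMk continuous_id).continuousOn)
      fun s hs => ⟨(S.xhat_pos s).le, hs.1⟩) (S.continuous_xhat.const_smul k).continuousOn
  rw [intervalIntegral.integral_sub (hdiag.intervalIntegrable _ _) intervalIntegrable_const,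
    intervalIntegral.integral_eq_sub_of_hasDerivAt_of_le ht.1 hcont
      (fun s hs => S.hasDerivAt_surplus ⟨hs.1, hs.2.trans_le ht.2⟩)
      (hdiag.intervalIntegrable _ _)]
  simp only [S.xhat_zero, jointPayoff, intervalIntegral.integral_const, smul_eq_mul]
  ring

end Marginal

/-! ### Demand of arbitrary consumers and first-period optimality -/

section Demand

lemma clamp_mem_uIcc (x : ℝ) : max (min xo xs) (min (max xo xs) x) ∈ uIcc xo xs :=
  ⟨le_max_left _ _, max_le min_le_max (min_le_left _ _)⟩

lemma demand_mem (S : Setting u k xs ys xo e) (x : ℝ) : demand u k xs xo x ∈ Icc 0 ys :=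
  S.yhat_mem (clamp_mem_uIcc x)

lemma continuous_demand (S : Setting u k xs ys xo e) : Continuous (demand u k xs xo) :=
  S.continuousOn_yhat.comp_continuous (by fun_prop) clamp_mem_uIcc

lemma demand_of_mem {x : ℝ} (hx : x ∈ uIcc xo xs) : demand u k xs xo x = yhat u k x := by
  have h1 : min (max xo xs) x = x := min_eq_right hx.2
  have h2 : max (min xo xs) x = x := max_eq_right hx.1
  rw [demand, h1, h2]

lemma demand_beyond (S : Setting u k xs ys xo e) {x : ℝ} (hx : 0 ≤ e * (x - xs)) :
    demand u k xs xo x = ys := by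
  have h := S.order
  rw [demand, ← S.yhat_xs]
  congr 1
  rcases S.sign with rfl | rfl
  · rw [max_eq_right (by linarith : xo ≤ xs), min_eq_left (by linarith : xs ≤ x), max_eq_right]
    exact min_le_right _ _
  · rw [min_eq_right (by linarith : xs ≤ xo), min_eq_right (le_max_of_le_right (by linarith)),
      max_eq_left (by linarith)]

lemma xhat_demand (S : Setting u k xs ys xo e) {x : ℝ} (hx : x ∈ uIcc xo xs) :
    xhat u k xs ys xo (demand u k xs xo x) = x := by
  rw [demand_of_mem hx, S.xhat_yhat hx]

/-- Equality holds between `xo` and `xs`; beyond `xs` the mixed derivative only raises `u₂`.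
Deviations of seller 2 are evaluated before consumption beyond `xs` is excluded, so an inequality is
needed there. -/
lemma marginal_demand_le (S : Setting u k xs ys xo e) {x : ℝ} (hx0 : 0 ≤ x)
    (hx : 0 ≤ e * (x - xo)) {s : ℝ} (hs : 0 ≤ s) :
    marginal u k xs ys xo (demand u k xs xo x) s ≤ du2 u x s := by
  rcases le_total 0 (e * (xs - x)) with h | h
  · rw [marginal, S.xhat_demand (S.mem_uIcc_iff.2 ⟨hx, h⟩), max_eq_left hs]
  · rw [marginal, S.demand_beyond (by linarith), S.xhat_ys, max_eq_left hs]
    have hm := (S.utility.strictMonoOn_du2 S.mixed_pos hs).monotoneOn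
    have m1 : xs ∈ Ici 0 := S.efficient.pos_left.le
    rcases S.sign with rfl | rfl
    · have := hm m1 hx0 (by linarith); simp only at this; linarith
    · have := hm hx0 m1 (by linarith); simp only at this; linarith

/-- The first-order condition for the choice from seller 1. -/
lemma du1_eq_of_isMax (S : Setting u k xs ys xo e) {x y : ℝ} (hx : 0 < x) (hy : 0 ≤ y)
    (hmax : ∀ x', 0 ≤ x' → u x' y - k * x' ≤ u x y - k * x) : du1 u x y = k := by
  have hd := (S.utility.hasDerivWithinAt_du1 hx.le hy).hasDerivAt (Ici_mem_nhds hx)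
  have hd2 := hd.sub ((hasDerivAt_id x).const_mul k)
  have hloc : IsLocalMax ((fun s => u s y) - fun s => k * id s) x := by
    filter_upwards [Ici_mem_nhds hx] with x' hx'
    simpa using hmax x' hx'
  have := hloc.hasDerivAt_eq_zero hd2
  linarith

/-- If `x` maximizes the joint surplus of consumer and seller 1 given `y`, then either `(x, y)`
lies on the curve `y = ŷ(x)`, or `x` lies beyond `xs` and `y` above `ys`. -/
lemma mem_or_beyond (S : Setting u k xs ys xo e) {x y : ℝ} (hx : 0 ≤ x) (hy : 0 ≤ y)
    (hmax : ∀ x', 0 ≤ x' → u x' y - k * x' ≤ u x y - k * x) :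
    (x ∈ uIcc xo xs ∧ y = yhat u k x) ∨ 0 < e * (x - xs) := by
  rcases le_or_gt y ys with h | h
  · left
    have hxe : x = xhat u k xs ys xo y := by
      by_contra hne
      have := S.surplus_lt ⟨hy, h⟩ hx hne
      linarith [hmax _ (S.xhat_pos y).le]
    rw [hxe]
    exact ⟨S.xhat_mem y, (S.yhat_xhat ⟨hy, h⟩).symm⟩
  · right
    by_contra! hle
    have h1 := S.utility.strictMonoOn_du1 S.mixed_pos S.efficient.pos_left.le
      (show ys ∈ Ici 0 from S.efficient.pos_right.le) (show y ∈ Ici 0 from hy) h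
    simp only [S.efficient.foc_left] at h1
    by_cases hpos : 0 < x
    · have h2 := S.sign_du1_anti hx S.efficient.pos_left.le hy (by linarith)
      rw [S.du1_eq_of_isMax hpos hy hmax] at h2
      linarith
    -- At the corner the first-order condition is unavailable. If `e = 1`, the tangent at `(xs, y)`
    -- has slope in `x` above `k`, so `xs` beats `0`; if `e = -1`, the point `0` already lies beyond
    -- `xs`.
    · have hx0 : x = 0 := le_antisymm (not_lt.1 hpos) hx
      subst hx0
      rcases S.sign with rfl | rfl
      · have h3 := S.utility.lt_tangent S.efficient.pos_left.le hy hx hy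
          (by simp [S.efficient.pos_left.ne'])
        have := hmax xs S.efficient.pos_left.le
        nlinarith [S.efficient.pos_left]
      · linarith [S.efficient.pos_left]

end Demand

end Setting

end PrivateTransactions

/-! ### Demand profiles: consequences of the bunching inequality -/

namespace PrivateTransactions

open Filter Topology

section DemandProfile

/-- The optimality of the second seller's menu in terms of the demand profile `D`: no interval
`(t₁, t₂)` of quantities should be sold to the types `t ≥ c` only. The margin earned on the
quantity `s` is `w t s` if `t` is the marginal type. -/
structure IsDemandProfile (w : ℝ → ℝ → ℝ) (T : ℝ) (D : ℝ → ℝ) : Prop where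
  pos : 0 < T
  continuous_margin : Continuous fun z : ℝ × ℝ => w z.1 z.2
  margin_diag_pos : ∀ t, 0 ≤ t → t < T → 0 < w t t
  margin_top : 0 ≤ w T T
  antitone : Antitone D
  nonneg : ∀ t, 0 ≤ D t
  le_one : ∀ t, D t ≤ 1
  bunching : ∀ t₁ c t₂, 0 ≤ t₁ → t₁ < t₂ → t₁ ≤ c → c ≤ t₂ → t₂ ≤ T → 0 ≤ w c t₂ →
    D c * ∫ s in t₁..t₂, w c s ≤ ∫ s in t₁..t₂, w s s * D s

namespace IsDemandProfile

variable {w : ℝ → ℝ → ℝ} {T : ℝ} {D : ℝ → ℝ}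

lemma continuous_right (h : IsDemandProfile w T D) (c : ℝ) : Continuous fun s => w c s :=
  h.continuous_margin.comp (by fun_prop : Continuous fun s : ℝ => (c, s))

lemma continuous_diag (h : IsDemandProfile w T D) : Continuous fun s => w s s :=
  h.continuous_margin.comp (by fun_prop : Continuous fun s : ℝ => (s, s))

lemma intervalIntegrable_diag_mul (h : IsDemandProfile w T D) (a b : ℝ) :
    IntervalIntegrable (fun s => w s s * D s) volume a b :=
  h.antitone.intervalIntegrable.continuousOn_mul h.continuous_diag.continuousOn

/-- If the integrand were larger under bunching throughout the interval, so would be the integral.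
-/
lemma exists_mem_Ioo (h : IsDemandProfile w T D) {t₁ c t₂ : ℝ} (h0 : 0 ≤ t₁) (h12 : t₁ < t₂)
    (h1c : t₁ ≤ c) (hc2 : c ≤ t₂) (h2T : t₂ ≤ T) (hw : 0 ≤ w c t₂) :
    ∃ s ∈ Ioo t₁ t₂, w c s * D c ≤ w s s * D s := by
  by_contra! hlt
  have hint : IntervalIntegrable (fun s => w c s * D c) volume t₁ t₂ :=
    ((h.continuous_right c).mul continuous_const).intervalIntegrable _ _
  have hpos := intervalIntegral.intervalIntegral_pos_of_pos_on
    (hint.sub (h.intervalIntegrable_diag_mul t₁ t₂)) (fun s hs => sub_pos.2 (hlt s hs)) h12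
  rw [intervalIntegral.integral_sub hint (h.intervalIntegrable_diag_mul _ _),
    intervalIntegral.integral_mul_const] at hpos
  have := h.bunching t₁ c t₂ h0 h12 h1c hc2 h2T hw
  linarith

/-- Bunching just above `c`, with `c` the lowest buyer; the required sign of `w c t₂` comes from
continuity at the diagonal. -/
lemma frequently_right (h : IsDemandProfile w T D) {c : ℝ} (h0 : 0 ≤ c) (hc : c < T) :
    ∃ᶠ s in 𝓝[>] c, w c s * D c ≤ w s s * D s := by
  rw [Filter.Frequently]
  intro hev
  have hev2 : ∀ᶠ s in 𝓝[>] c, 0 < w c s :=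
    nhdsWithin_le_nhds ((h.continuous_right c).continuousAt.eventually
      (lt_mem_nhds (h.margin_diag_pos c h0 hc)))
  obtain ⟨a, ha, hsub⟩ := (mem_nhdsGT_iff_exists_Ioo_subset' hc).1
    (inter_mem hev (inter_mem hev2 (Ioo_mem_nhdsGT hc)))
  obtain ⟨b, hb⟩ := exists_between (mem_Ioi.1 ha)
  have hb' := hsub hb
  obtain ⟨s, hs, hle⟩ := h.exists_mem_Ioo h0 hb.1 le_rfl hb.1.le hb'.2.2.2.le
    (le_of_lt hb'.2.1)
  exact (hsub ⟨hs.1, hs.2.trans hb.2⟩).1 hle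

/-- Bunching just below `c`. Here the sign condition is on `w c c`, so `c = T` is allowed. -/
lemma frequently_left (h : IsDemandProfile w T D) {c : ℝ} (h0 : 0 < c) (hc : c ≤ T) :
    ∃ᶠ s in 𝓝[<] c, w c s * D c ≤ w s s * D s := by
  rw [Filter.Frequently]
  intro hev
  obtain ⟨a, ha, hsub⟩ := (mem_nhdsLT_iff_exists_Ioo_subset' h0).1
    (inter_mem hev (Ioo_mem_nhdsLT h0))
  obtain ⟨b, hb⟩ := exists_between (mem_Iio.1 ha)
  have hw : 0 ≤ w c c := by
    rcases hc.eq_or_lt with rfl | hlt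
    · exact h.margin_top
    · exact (h.margin_diag_pos c h0.le hlt).le
  obtain ⟨s, hs, hle⟩ := h.exists_mem_Ioo (hsub hb).2.1.le hb.2 hb.2.le le_rfl hc hw
  exact (hsub ⟨hb.1.trans hs.1, hs.2⟩).1 hle

/-- If `D` dropped sharply after `c`, selling the following quantities to all types above `c` would
gain a fixed margin on the lost mass, while charging `w c s` instead of `w s s` costs little on a
short interval. -/
lemma continuousOn (h : IsDemandProfile w T D) : ContinuousOn D (Ico 0 T) := by
  intro p hp
  rw [Metric.continuousWithinAt_iff]
  intro η hη
  set κ := w p p / 2 with hκdef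
  have hκ : 0 < κ := half_pos (h.margin_diag_pos p hp.1 hp.2)
  -- The bound `δ ≤ κ` keeps the margins near `p` above `κ`; the factor `8` leaves room in the final
  -- estimate `(D c - D m) * κ ≤ 4 * δ`.
  set δ := min κ (η * κ / 8) with hδdef
  have hδ : 0 < δ := lt_min hκ (by positivity)
  obtain ⟨r, hr, hball⟩ := Metric.continuousAt_iff.1
    (h.continuous_margin.continuousAt (x := (p, p))) δ hδ
  have hnear : ∀ a b, |a - p| < r → |b - p| < r → |w a b - w p p| < δ := by
    intro a b ha hb
    have := @hball (a, b) (by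
      rw [Prod.dist_eq, max_lt_iff, Real.dist_eq, Real.dist_eq]
      exact ⟨ha, hb⟩)
    simpa [Real.dist_eq] using this
  set r' := min (r / 3) ((T - p) / 3)
  have hr' : 0 < r' := lt_min (by positivity) (by linarith [hp.2])
  have hr1 : r' ≤ r / 3 := min_le_left _ _
  have hr2 : r' ≤ (T - p) / 3 := min_le_right _ _
  have key : ∀ c m, 0 ≤ c → c < m → |c - p| < r' → |m - p| < r' → D c - D m < η := by
    intro c m hc0 hcm hc hm
    rw [abs_lt] at hc hm
    -- The gain arises on `(m, t)` and the error on `(c, t)`; doubling makes their lengths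
    -- comparable. The thirds in `r'` keep `t` near `p` and below `T`.
    set t := 2 * m - c with ht
    have hmt : m < t := by linarith
    have close : ∀ s ∈ Icc c t, |s - p| < r := fun s hs => by
      rw [abs_lt]; constructor <;> linarith [hs.1, hs.2]
    have hwc : ∀ s ∈ Icc c t, κ ≤ w c s ∧ κ ≤ w s s ∧ w s s - w c s ≤ 2 * δ := by
      intro s hs
      have e1 := abs_lt.1 (hnear c s (close c ⟨le_rfl, by linarith⟩) (close s hs))
      have e2 := abs_lt.1 (hnear s s (close s hs) (close s hs))
      have : δ ≤ κ := min_le_left _ _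
      refine ⟨?_, ?_, ?_⟩ <;> linarith
    have hb := h.bunching c c t hc0 (by linarith) le_rfl (by linarith) (by linarith)
      (hκ.le.trans (hwc t ⟨by linarith, le_rfl⟩).1)
    have i1 : ∀ a b, IntervalIntegrable (fun s => w s s) volume a b := fun a b =>
      h.continuous_diag.intervalIntegrable a b
    rw [← intervalIntegral.integral_add_adjacent_intervals
      (h.intervalIntegrable_diag_mul c m) (h.intervalIntegrable_diag_mul m t)] at hb
    have b1 : ∫ s in c..m, w s s * D s ≤ ∫ s in c..m, w s s * D c :=
      intervalIntegral.integral_mono_on hcm.le (h.intervalIntegrable_diag_mul c m)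
        ((i1 c m).mul_const _) fun s hs => mul_le_mul_of_nonneg_left (h.antitone hs.1)
          (hκ.le.trans (hwc s ⟨hs.1, by linarith [hs.2]⟩).2.1)
    have b2 : ∫ s in m..t, w s s * D s ≤ ∫ s in m..t, w s s * D m :=
      intervalIntegral.integral_mono_on hmt.le (h.intervalIntegrable_diag_mul m t)
        ((i1 m t).mul_const _) fun s hs => mul_le_mul_of_nonneg_left (h.antitone hs.1)
          (hκ.le.trans (hwc s ⟨by linarith [hs.1], hs.2⟩).2.1)
    rw [intervalIntegral.integral_mul_const] at b1 b2
    have b3 : κ * (t - m) ≤ ∫ s in m..t, w s s := by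
      have := intervalIntegral.integral_mono_on hmt.le (μ := volume)
        (intervalIntegrable_const (c := κ)) (i1 m t) fun s hs =>
          (hwc s ⟨by linarith [hs.1], hs.2⟩).2.1
      simpa [mul_comm] using this
    have b4 : (∫ s in c..t, w s s) - ∫ s in c..t, w c s ≤ 2 * δ * (t - c) := by
      rw [← intervalIntegral.integral_sub (i1 c t)
        ((h.continuous_right c).intervalIntegrable c t)]
      have := intervalIntegral.integral_mono_on (by linarith : c ≤ t) (μ := volume)
        ((i1 c t).sub ((h.continuous_right c).intervalIntegrable c t))
        (intervalIntegrable_const (c := 2 * δ)) fun s hs => (hwc s hs).2.2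
      rw [intervalIntegral.integral_const, smul_eq_mul] at this
      linarith
    rw [← intervalIntegral.integral_add_adjacent_intervals (i1 c m) (i1 m t)] at b4
    have hDc := h.nonneg c
    have hDc1 := h.le_one c
    have hDD : 0 ≤ D c - D m := sub_nonneg.2 (h.antitone hcm.le)
    have b5 : (D c - D m) * (κ * (t - m)) ≤ 2 * δ * (t - c) := by
      have e1 := mul_le_mul_of_nonneg_left b3 hDD
      have e2 := mul_le_mul_of_nonneg_left b4 hDc
      have e3 : D c * (2 * δ * (t - c)) ≤ 1 * (2 * δ * (t - c)) :=
        mul_le_mul_of_nonneg_right hDc1 (mul_nonneg (by positivity) (by linarith))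
      nlinarith
    have e4 : t - m = m - c := by ring
    have e5 : t - c = 2 * (m - c) := by ring
    rw [e4, e5] at b5
    have b6 : (D c - D m) * κ ≤ 4 * δ := by
      have hmc : 0 < m - c := by linarith
      refine le_of_mul_le_mul_right ?_ hmc
      linarith
    have hδ2 : δ ≤ η * κ / 8 := min_le_right _ _
    have : (D c - D m) * κ < η * κ := by nlinarith
    exact lt_of_mul_lt_mul_right this hκ.le
  refine ⟨r', hr', fun {s} hs hsp => ?_⟩
  rw [Real.dist_eq] at hsp ⊢
  rcases lt_trichotomy s p with hlt | rfl | hlt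
  · have h1 := key s p hs.1 hlt hsp (by simpa using hr')
    rw [abs_of_nonneg (sub_nonneg.2 (h.antitone hlt.le))]
    exact h1
  · simpa using hη
  · have h1 := key p s hp.1 hlt (by simpa using hr') hsp
    rw [abs_sub_comm, abs_of_nonneg (sub_nonneg.2 (h.antitone hlt.le))]
    exact h1

/-- A candidate `E` that satisfies the first-order condition with respect to the scale `z` agrees
with the demand profile. -/
lemma eq_of_isLittleO (h : IsDemandProfile w T D) {E z : ℝ → ℝ} (hE : Continuous E)
    (hEpos : ∀ t, 0 < E t) (hz : Continuous z) (hzmono : StrictMonoOn z (Icc 0 T))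
    (hfoc : ∀ c, 0 ≤ c → c < T →
      (fun s => w s s * E s - w c s * E c) =o[𝓝 c] fun s => z s - z c)
    (h0 : D 0 = E 0) {t : ℝ} (ht0 : 0 ≤ t) (htT : t < T) : D t = E t := by
  set R : ℝ → ℝ := fun t => D t / E t with hR
  have hDR : ∀ t, D t = E t * R t := fun t => by
    rw [hR]; field_simp [(hEpos t).ne']
  have hRnn : ∀ t, 0 ≤ R t := fun t => div_nonneg (h.nonneg t) (hEpos t).le
  have hRcont : ContinuousOn R (Ico 0 T) :=
    h.continuousOn.div hE.continuousOn fun s _ => (hEpos s).ne'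
  -- Where the bunching comparison holds, the ratio `R = D / E` falls by less than `ε` on the scale
  -- `z`. Only this lower bound on `R s` is available, from points on either side of `c`.
  have hlocal : ∀ c ε, 0 ≤ c → c < T → 0 < ε → ∀ᶠ s in 𝓝 c, s ∈ Icc 0 T → s ≠ c →
      w c s * D c ≤ w s s * D s → R c - ε * |z s - z c| < R s := by
    intro c ε hc0 hcT hε
    set κ := w c c * E c / 2
    have hwE : 0 < w c c * E c := mul_pos (h.margin_diag_pos c hc0 hcT) (hEpos c)
    have hκ : 0 < κ := half_pos hwE
    have hη : 0 < ε * κ / (R c + 1) := div_pos (mul_pos hε hκ) (by linarith [hRnn c])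
    have ev1 : ∀ᶠ s in 𝓝 c, κ < w s s * E s :=
      (h.continuous_diag.mul hE).continuousAt.eventually (lt_mem_nhds (half_lt_self hwE))
    filter_upwards [ev1, (hfoc c hc0 hcT).def hη] with s hs1 hs2 hsI hsc hle
    by_contra! hRs
    have hΔ : 0 < |z s - z c| :=
      abs_pos.2 (sub_ne_zero.2 fun hh => hsc (hzmono.injOn hsI ⟨hc0, hcT.le⟩ hh))
    rw [Real.norm_eq_abs, Real.norm_eq_abs] at hs2
    have hs3 := (le_abs_self _).trans hs2
    rw [hDR c, hDR s] at hle
    have e1 : w s s * E s * R s ≤ w s s * E s * (R c - ε * |z s - z c|) :=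
      mul_le_mul_of_nonneg_left hRs (hκ.le.trans hs1.le)
    have e2 : R c * (w s s * E s - w c s * E c) ≤
        R c * (ε * κ / (R c + 1) * |z s - z c|) := mul_le_mul_of_nonneg_left hs3 (hRnn c)
    have e3 : κ * (ε * |z s - z c|) ≤ w s s * E s * (ε * |z s - z c|) :=
      mul_le_mul_of_nonneg_right hs1.le (by positivity)
    have e4 : R c * (ε * κ / (R c + 1) * |z s - z c|) < κ * (ε * |z s - z c|) := by
      have hp : 0 < R c + 1 := by linarith [hRnn c]
      have : R c * (ε * κ / (R c + 1)) < κ * ε := by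
        rw [← mul_div_assoc, div_lt_iff₀ hp]
        nlinarith [mul_pos hε hκ]
      nlinarith
    nlinarith
  have hconst : R t = R 0 := by
    rcases ht0.eq_or_lt with rfl | hpos
    · rfl
    have hzt : 0 < z t - z 0 :=
      sub_pos.2 (hzmono ⟨le_rfl, h.pos.le⟩ ⟨ht0, htT.le⟩ hpos)
    have hsub : Icc 0 t ⊆ Ico 0 T := fun s hs => ⟨hs.1, hs.2.trans_lt htT⟩
    have hzle : ∀ a ∈ Icc 0 t, ∀ b ∈ Icc 0 t, a ≤ b → z a ≤ z b := fun a ha b hb hab =>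
      hzmono.monotoneOn ⟨ha.1, (hsub ha).2.le⟩ ⟨hb.1, (hsub hb).2.le⟩ hab
    apply le_antisymm
    · by_contra! hlt
      -- Half the average slope, so that the maximum `c` of `R - ε z` is not at `0`. Points `s < c`
      -- with `R s > R c - ε (z c - z s)` then contradict maximality.
      set ε := (R t - R 0) / (2 * (z t - z 0))
      have hε : 0 < ε := div_pos (by linarith) (by linarith)
      have hεz : ε * (z t - z 0) = (R t - R 0) / 2 := by
        simp only [ε]; field_simp
      obtain ⟨c, hc, hmax⟩ := isCompact_Icc.exists_isMaxOn (nonempty_Icc.2 ht0)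
        ((hRcont.mono hsub).sub ((continuous_const.mul hz).continuousOn (s := Icc 0 t))
          (f := R) (g := fun s => ε * z s))
      have hc0 : 0 < c := by
        refine lt_of_le_of_ne hc.1 ?_
        rintro rfl
        have := hmax (right_mem_Icc.2 ht0)
        simp only [mem_ofPred_eq, Pi.sub_apply] at this
        linarith
      have hcT := (hsub hc).2
      have hev := (hlocal c ε hc.1 hcT hε).filter_mono
        (nhdsWithin_le_nhds (s := Iio c))
      obtain ⟨s, hle, hs, hsI⟩ := ((h.frequently_left hc0 hcT.le).and_eventually
        (hev.and (Ioo_mem_nhdsLT hc0))).exists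
      have hst : s ∈ Icc 0 t := ⟨hsI.1.le, hsI.2.le.trans hc.2⟩
      have h1 := hs ⟨hsI.1.le, (hsI.2.trans hcT).le⟩ hsI.2.ne hle
      have h2 := hmax hst
      simp only [mem_ofPred_eq, Pi.sub_apply] at h2
      rw [abs_of_nonpos (by linarith [hzle s hst c hc hsI.2.le])] at h1
      linarith
    · by_contra! hlt
      -- Mirror image: `R + ε z` has its maximum before `t`, and points to the right of it give the
      -- contradiction.
      set ε := (R 0 - R t) / (2 * (z t - z 0))
      have hε : 0 < ε := div_pos (by linarith) (by linarith)
      have hεz : ε * (z t - z 0) = (R 0 - R t) / 2 := by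
        simp only [ε]; field_simp
      obtain ⟨c, hc, hmax⟩ := isCompact_Icc.exists_isMaxOn (nonempty_Icc.2 ht0)
        ((hRcont.mono hsub).add ((continuous_const.mul hz).continuousOn (s := Icc 0 t))
          (f := R) (g := fun s => ε * z s))
      have hct : c < t := by
        refine lt_of_le_of_ne hc.2 ?_
        rintro rfl
        have := hmax (left_mem_Icc.2 ht0)
        simp only [mem_ofPred_eq, Pi.add_apply] at this
        linarith
      have hcT := (hsub hc).2
      have hev := (hlocal c ε hc.1 hcT hε).filter_mono
        (nhdsWithin_le_nhds (s := Ioi c))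
      obtain ⟨s, hle, hs, hsI⟩ := ((h.frequently_right hc.1 hcT).and_eventually
        (hev.and (Ioo_mem_nhdsGT hct))).exists
      have hst : s ∈ Icc 0 t := ⟨hc.1.trans hsI.1.le, hsI.2.le⟩
      have h1 := hs ⟨hst.1, (hsub hst).2.le⟩ hsI.1.ne' hle
      have h2 := hmax hst
      simp only [mem_ofPred_eq, Pi.add_apply] at h2
      rw [abs_of_nonneg (by linarith [hzle c hc s hst hsI.1.le])] at h1
      linarith
  rw [hDR t, hconst]
  simp only [hR, h0, div_self (hEpos 0).ne', mul_one]

/-- There is no mass at the top if the margin on the marginal quantity is, up to a factor less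
than `1`, smaller than the margin on the top type. -/
lemma eq_zero_top (h : IsDemandProfile w T D) {κ : ℝ} (hκ : 0 < κ)
    (hw : ∀ s ∈ Ioo 0 T, 0 < w T s ∧ w s s ≤ (1 - κ) * w T s)
    (hleft : Tendsto D (𝓝[<] T) (𝓝 (D T))) : D T = 0 := by
  have hfreq : ∃ᶠ s in 𝓝[<] T, D T ≤ (1 - κ) * D s := by
    refine ((h.frequently_left h.pos le_rfl).and_eventually (Ioo_mem_nhdsLT h.pos)).mono ?_
    rintro s ⟨hle, hs⟩
    obtain ⟨hpos, hle2⟩ := hw s hs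
    refine le_of_mul_le_mul_left (hle.trans ?_) hpos
    calc w s s * D s ≤ (1 - κ) * w T s * D s := mul_le_mul_of_nonneg_right hle2 (h.nonneg s)
      _ = w T s * ((1 - κ) * D s) := by ring
  -- In the limit `D T ≤ (1 - κ) * D T`.
  have := ge_of_tendsto_of_frequently (hleft.const_mul (1 - κ)) hfreq
  nlinarith [h.nonneg T]

end IsDemandProfile

end DemandProfile

end PrivateTransactions

/-! ### The hazard rate and the absence of an atom at the top -/

namespace PrivateTransactions

open Filter Topology

/-- Used to stay away from `ys`, where the denominator of the hazard rate vanishes. -/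
lemma IsDemandProfile.restrict {w : ℝ → ℝ → ℝ} {T T' : ℝ} {D : ℝ → ℝ}
    (h : IsDemandProfile w T D) (h0 : 0 < T') (hT : T' < T) : IsDemandProfile w T' D where
  pos := h0
  continuous_margin := h.continuous_margin
  margin_diag_pos t ht htT := h.margin_diag_pos t ht (htT.trans hT)
  margin_top := (h.margin_diag_pos T' h0.le hT).le
  antitone := h.antitone
  nonneg := h.nonneg
  le_one := h.le_one
  bunching t₁ c t₂ h1 h2 h3 h4 h5 := h.bunching t₁ c t₂ h1 h2 h3 h4 (h5.trans hT.le)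

namespace Setting

variable {u : ℝ → ℝ → ℝ} {k xs ys xo e : ℝ}

/-- The hazard rate of first-period consumption. -/
noncomputable abbrev hazard (u : ℝ → ℝ → ℝ) (k x : ℝ) : ℝ :=
  du21 u x (yhat u k x) / (du2 u x (yhat u k x) - k)

lemma du2_yhat (S : Setting u k xs ys xo e) {x : ℝ} (hx : x ∈ uIcc xo xs) :
    du2 u x (yhat u k x) = marginal u k xs ys xo (yhat u k x) (yhat u k x) := by
  rw [marginal, S.xhat_yhat hx, max_eq_left (S.yhat_mem hx).1]

lemma yhat_le_of_mem (S : Setting u k xs ys xo e) {t x : ℝ} (ht : t ∈ Icc 0 ys)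
    (hx : x ∈ uIcc xo (xhat u k xs ys xo t)) : x ∈ uIcc xo xs ∧ yhat u k x ≤ t := by
  have hxI : x ∈ uIcc xo xs := uIcc_subset_uIcc left_mem_uIcc (S.xhat_mem t) hx
  refine ⟨hxI, ?_⟩
  by_contra! hlt
  have h1 := S.xhat_lt_xhat ht (S.yhat_mem hxI) hlt
  rw [S.xhat_yhat hxI] at h1
  have h2 := (S.mem_uIcc_iff.1 (S.xhat_mem t)).1
  have hx' := hx
  rcases S.sign with rfl | rfl
  · rw [uIcc_of_le (by linarith)] at hx'
    linarith [hx'.2]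
  · rw [uIcc_of_ge (by linarith)] at hx'
    linarith [hx'.1]

lemma continuousOn_hazard (S : Setting u k xs ys xo e) {t : ℝ} (h0 : 0 ≤ t) (ht : t < ys) :
    ContinuousOn (hazard u k) (uIcc xo (xhat u k xs ys xo t)) := by
  have hmem : ∀ x ∈ uIcc xo (xhat u k xs ys xo t), x ∈ uIcc xo xs ∧ yhat u k x ≤ t :=
    fun x hx => S.yhat_le_of_mem ⟨h0, ht.le⟩ hx
  have hpair : ContinuousOn (fun x => (x, yhat u k x)) (uIcc xo (xhat u k xs ys xo t)) :=
    continuousOn_id.prodMk (S.continuousOn_yhat.mono fun x hx => (hmem x hx).1)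
  have hmaps : MapsTo (fun x => (x, yhat u k x)) (uIcc xo (xhat u k xs ys xo t)) quadrant :=
    fun x hx => ⟨(S.pos_of_mem (hmem x hx).1).le, (S.yhat_mem (hmem x hx).1).1⟩
  refine (S.utility.continuousOn_du21.comp hpair hmaps).div
    ((S.utility.contDiffOn_du2.continuousOn.comp hpair hmaps).sub continuousOn_const)
    fun x hx => ?_
  obtain ⟨hxI, hxt⟩ := hmem x hx
  have := S.lt_marginal_diag (S.yhat_mem hxI).1 (hxt.trans_lt ht)
  rw [← S.du2_yhat hxI] at this
  exact (sub_pos.2 this).ne'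

/-- Linearization of `u₂(·, s)` at `x̂(c)`, uniform in `s` near `c` by continuity of `u₂₁`.
Increments are measured in `x̂`, which need not be differentiable in `t`. -/
lemma isLittleO_marginal (S : Setting u k xs ys xo e) {c : ℝ} (hc : c ∈ Icc 0 ys) :
    (fun s => marginal u k xs ys xo s s - marginal u k xs ys xo c s -
      du21 u (xhat u k xs ys xo c) c * (xhat u k xs ys xo s - xhat u k xs ys xo c)) =o[𝓝 c]
      fun s => xhat u k xs ys xo s - xhat u k xs ys xo c := by
  rw [Asymptotics.isLittleO_iff]
  intro η hη
  obtain ⟨r, hr, hball⟩ := Metric.continuousWithinAt_iff.1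
    (S.utility.continuousOn_du21 _ (mk_mem_quadrant (S.xhat_pos c).le hc.1)) η hη
  have hX : ∀ᶠ s in 𝓝 c, |xhat u k xs ys xo s - xhat u k xs ys xo c| < r :=
    S.continuous_xhat.continuousAt.eventually (Metric.ball_mem_nhds _ hr)
  have hm : ∀ᶠ s in 𝓝 c, |max s 0 - c| < r := by
    have : Continuous fun s : ℝ => max s 0 := by fun_prop
    have h := this.continuousAt.eventually (Metric.ball_mem_nhds (max c 0) hr)
    rw [max_eq_left hc.1] at h
    exact h
  filter_upwards [hX, hm] with s hs1 hs2
  set x := xhat u k xs ys xo c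
  set x' := xhat u k xs ys xo s
  have hpos : ∀ y ∈ uIcc x x', 0 ≤ y := fun y hy =>
    (lt_min (S.xhat_pos c) (S.xhat_pos s)).le.trans hy.1
  have := (convex_uIcc x x').norm_image_sub_le_of_norm_hasDerivWithin_le
    (f := fun y => du2 u y (max s 0) - du21 u x c * y)
    (f' := fun y => du21 u y (max s 0) - du21 u x c * 1) (C := η)
    (fun y hy => ((S.utility.hasDerivWithinAt_du21 (hpos y hy) (le_max_right s 0)).mono hpos).sub
      ((hasDerivWithinAt_id y _).const_mul _))
    (fun y hy => by
      have := @hball (y, max s 0) ⟨hpos y hy, le_max_right s 0⟩ (by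
        rw [Prod.dist_eq, max_lt_iff, Real.dist_eq, Real.dist_eq]
        exact ⟨(abs_sub_left_of_mem_uIcc hy).trans_lt hs1, hs2⟩)
      rw [Real.dist_eq] at this
      rw [mul_one]
      exact this.le) left_mem_uIcc right_mem_uIcc
  refine le_trans (le_of_eq ?_) this
  congr 1
  change du2 u x' (max s 0) - du2 u x (max s 0) - _ = _
  ring

/-- Product rule: to first order in the increment of `x̂`, the change of the margin contributes `u₂₁
E` and the change of `E` contributes `-lam (u₂ - k) E`. They cancel by the choice of `lam`. -/
lemma margin_foc (S : Setting u k xs ys xo e) {E : ℝ → ℝ} {lam c : ℝ} (hc : c ∈ Icc 0 ys)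
    (hlam : du21 u (xhat u k xs ys xo c) c = lam * (marginal u k xs ys xo c c - k))
    (hE : (fun s => E s - E c + lam * E c * (xhat u k xs ys xo s - xhat u k xs ys xo c)) =o[𝓝 c]
      fun s => xhat u k xs ys xo s - xhat u k xs ys xo c) :
    (fun s => (marginal u k xs ys xo s s - k) * E s - (marginal u k xs ys xo c s - k) * E c)
      =o[𝓝 c] fun s => xhat u k xs ys xo s - xhat u k xs ys xo c := by
  have hdiag : Continuous fun s => marginal u k xs ys xo s s - k :=
    (S.continuous_marginal.comp (by fun_prop : Continuous fun s : ℝ => (s, s))).sub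
      continuous_const
  have h1 := (S.isLittleO_marginal hc).const_mul_left (E c)
  have h2 := (hdiag.continuousAt (x := c)).isBigO_one (F := ℝ) |>.mul_isLittleO hE
  have h3 : (fun s => ((marginal u k xs ys xo c c - k) - (marginal u k xs ys xo s s - k)) *
      (lam * E c * (xhat u k xs ys xo s - xhat u k xs ys xo c))) =o[𝓝 c]
      fun s => 1 * (xhat u k xs ys xo s - xhat u k xs ys xo c) := by
    refine Asymptotics.IsLittleO.mul_isBigO ?_
      ((Asymptotics.isBigO_refl _ _).const_mul_left _)
    rw [Asymptotics.isLittleO_one_iff]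
    simpa using (continuous_const.sub hdiag).tendsto' (f := fun s =>
      (marginal u k xs ys xo c c - k) - (marginal u k xs ys xo s s - k)) c 0 (by simp)
  simp only [one_mul] at h2 h3
  refine ((h1.add h2).add h3).congr_left fun s => ?_
  rw [hlam]
  ring

/-- The demand profile of an optimal menu is determined by the hazard rate. -/
theorem demandProfile_eq (S : Setting u k xs ys xo e) {D : ℝ → ℝ}
    (h : IsDemandProfile (fun t s => marginal u k xs ys xo t s - k) ys D) (h0 : D 0 = 1) {t : ℝ}
    (ht0 : 0 ≤ t) (ht : t < ys) :
    D t = Real.exp (-∫ x in xo..xhat u k xs ys xo t, hazard u k x) := by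
  obtain ⟨T, htT, hT⟩ := exists_between ht
  have hT0 : 0 < T := ht0.trans_lt htT
  have hTI : T ∈ Icc 0 ys := ⟨hT0.le, hT.le⟩
  set b := xhat u k xs ys xo T
  -- Clamping extends the hazard rate continuously to `ℝ`, so its primitive is differentiable
  -- everywhere.
  set lam : ℝ → ℝ := fun x => hazard u k (max (min xo b) (min (max xo b) x)) with hlamdef
  have hlam : Continuous lam :=
    (S.continuousOn_hazard hT0.le hT).comp_continuous (by fun_prop) clamp_mem_uIcc
  have hlam_eq : ∀ x ∈ uIcc xo b, lam x = hazard u k x := fun x hx => by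
    have h1 : min (max xo b) x = x := min_eq_right hx.2
    have h2 : max (min xo b) x = x := max_eq_right hx.1
    simp only [hlamdef, h1, h2]
  have hmem : ∀ c ∈ Icc 0 T, xhat u k xs ys xo c ∈ uIcc xo b := by
    intro c hc
    have hcI : c ∈ Icc 0 ys := ⟨hc.1, hc.2.trans hT.le⟩
    have h1 := (S.mem_uIcc_iff.1 (S.xhat_mem c)).1
    have h2 : 0 ≤ e * (b - xhat u k xs ys xo c) := by
      rcases hc.2.eq_or_lt with rfl | hlt
      · simp [b]
      · exact (S.xhat_lt_xhat hcI hTI hlt).le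
    rw [mem_uIcc]
    rcases S.sign with rfl | rfl
    · left; constructor <;> linarith
    · right; constructor <;> linarith
  have hder : ∀ x, HasDerivAt (fun x => Real.exp (-∫ y in xo..x, lam y))
      (Real.exp (-∫ y in xo..x, lam y) * -lam x) x := fun x =>
    ((hlam.integral_hasStrictDerivAt xo x).hasDerivAt.neg).exp
  set E : ℝ → ℝ := fun t => Real.exp (-∫ y in xo..xhat u k xs ys xo t, lam y) with hEdef
  have hcont : Continuous fun x => Real.exp (-∫ y in xo..x, lam y) :=
    continuous_iff_continuousAt.2 fun x => (hder x).continuousAt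
  have e0 : e ≠ 0 := by rcases S.sign with rfl | rfl <;> norm_num
  have key := (h.restrict hT0 hT).eq_of_isLittleO (E := E)
    -- The factor `e` makes the scale increasing for both signs.
    (z := fun s => e * xhat u k xs ys xo s) (hcont.comp S.continuous_xhat)
    (fun _ => Real.exp_pos _) (continuous_const.mul S.continuous_xhat)
    (fun a ha a' ha' haa => by
      have := S.xhat_lt_xhat ⟨ha.1, ha.2.trans hT.le⟩ ⟨ha'.1, ha'.2.trans hT.le⟩ haa
      simp only
      linarith)
    (fun c hc0 hcT => by
      have hcI : c ∈ Icc 0 ys := ⟨hc0, hcT.le.trans hT.le⟩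
      simp only [← mul_sub]
      rw [Asymptotics.isLittleO_const_mul_right_iff e0]
      refine S.margin_foc (lam := lam (xhat u k xs ys xo c)) hcI ?_ ?_
      · rw [hlam_eq _ (hmem c ⟨hc0, hcT.le⟩), hazard, S.yhat_xhat hcI, marginal,
          max_eq_left hc0, div_mul_cancel₀]
        have := S.lt_marginal_diag hc0 (hcT.trans hT)
        rw [marginal, max_eq_left hc0] at this
        exact (sub_pos.2 this).ne'
      · have h1 := (hasDerivAt_iff_isLittleO.1 (hder (xhat u k xs ys xo c))).comp_tendsto
          S.continuous_xhat.continuousAt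
        refine h1.congr_left fun s => ?_
        simp only [Function.comp_apply, hEdef, smul_eq_mul]
        ring)
    (by simp [h0, hEdef, S.xhat_zero]) ht0 htT
  rw [key]
  simp only [hEdef]
  congr 2
  exact intervalIntegral.integral_congr fun x hx =>
    hlam_eq x (uIcc_subset_uIcc left_mem_uIcc (hmem t ⟨ht0, htT.le⟩) hx)

/-- The top type's margin on `s` is at most `C' (ys - s) ≤ C' C |xs - x̂(s)|`, while it exceeds the
margin of type `s` by at least `c |xs - x̂(s)|`. The relative loss from serving type `s` is
therefore at least `c / (C C')`. -/
theorem demandProfile_top (S : Setting u k xs ys xo e) {D : ℝ → ℝ}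
    (h : IsDemandProfile (fun t s => marginal u k xs ys xo t s - k) ys D)
    (hleft : Tendsto D (𝓝[<] ys) (𝓝 (D ys))) : D ys = 0 := by
  set M := max (max xo xs) ys
  have hM : 0 ≤ M := le_max_of_le_right S.efficient.pos_right.le
  have hI : ∀ x ∈ uIcc xo xs, x ∈ Icc 0 M := fun x hx =>
    ⟨(S.pos_of_mem hx).le, hx.2.trans (le_max_left _ _)⟩
  have hY : ∀ y ∈ Icc 0 ys, y ∈ Icc 0 M := fun y hy => ⟨hy.1, hy.2.trans (le_max_right _ _)⟩
  obtain ⟨c, hc, h1⟩ := S.utility.exists_lower_bound_du21 S.mixed_pos hM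
  obtain ⟨C, hC, h2⟩ := S.exists_lipschitz_yhat
  obtain ⟨C', hC', h3⟩ := exists_lipschitz_right S.utility.contDiffOn_du2 M
  refine h.eq_zero_top (κ := c / (C * C')) (by positivity) (fun s hs => ?_) hleft
  have hsI : s ∈ Icc 0 ys := Ioo_subset_Icc_self hs
  have hysI : ys ∈ Icc 0 ys := ⟨S.efficient.pos_right.le, le_rfl⟩
  have hgap : c * |xs - xhat u k xs ys xo s| ≤
      marginal u k xs ys xo ys s - marginal u k xs ys xo s s := by
    have hX := S.xhat_lt_xhat hsI hysI hs.2
    rw [S.xhat_ys] at hX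
    rw [marginal, marginal, S.xhat_ys, max_eq_left hs.1.le]
    rcases S.sign with rfl | rfl
    · have := h1 _ (hI _ (S.xhat_mem s)) _ (hI _ right_mem_uIcc) s (hY s hsI) (by linarith)
      rw [abs_of_nonneg (by linarith)]
      linarith
    · have := h1 _ (hI _ right_mem_uIcc) _ (hI _ (S.xhat_mem s)) s (hY s hsI) (by linarith)
      rw [abs_of_nonpos (by linarith)]
      linarith
  have hlip : ys - s ≤ C * |xs - xhat u k xs ys xo s| := by
    have := h2 xs right_mem_uIcc _ (S.xhat_mem s)
    rw [S.yhat_xs, S.yhat_xhat hsI] at this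
    exact (le_abs_self _).trans this
  have hw : marginal u k xs ys xo ys s - k ≤ C' * (ys - s) := by
    have := h3 xs (hI xs right_mem_uIcc) s (hY s hsI) ys (hY ys hysI)
    simp only [S.efficient.foc_right] at this
    rw [marginal, S.xhat_ys, max_eq_left hs.1.le]
    rw [abs_of_nonpos (by linarith [hs.2] : s - ys ≤ 0)] at this
    linarith [le_abs_self (du2 u xs s - k)]
  constructor
  · have := S.marginal_lt_right ys hs.1.le hs.2
    rw [S.marginal_ys] at this
    linarith
  · have e1 : c / (C * C') * (marginal u k xs ys xo ys s - k) ≤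
        c * |xs - xhat u k xs ys xo s| := by
      rw [div_mul_eq_mul_div, div_le_iff₀ (by positivity)]
      have : marginal u k xs ys xo ys s - k ≤ C' * (C * |xs - xhat u k xs ys xo s|) :=
        hw.trans (mul_le_mul_of_nonneg_left hlip hC'.le)
      nlinarith
    linarith

end Setting

end PrivateTransactions

/-! ### Seller 1's problem and the consumer's indirect utility -/

namespace PrivateTransactions

open Filter Topology

/-- An integrable lower bound of the profit bounds the expected profit. -/
lemma integral_le_expect {α : Type*} [MeasurableSpace α] {μ : Measure α} {f g : α → ℝ}
    (hg : Integrable g μ) (h : g ≤ᵐ[μ] f) : ((∫ a, g a ∂μ : ℝ) : EReal) ≤ expect μ f := by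
  have hp : ∫⁻ a, ENNReal.ofReal (g a) ∂μ ≠ ∞ :=
    (lintegral_ofReal_le_lintegral_enorm _).trans_lt hg.2 |>.ne
  have hn : ∫⁻ a, ENNReal.ofReal (-g a) ∂μ ≠ ∞ :=
    (lintegral_ofReal_le_lintegral_enorm _).trans_lt hg.neg.2 |>.ne
  rw [integral_eq_lintegral_pos_part_sub_lintegral_neg_part hg, EReal.coe_sub,
    EReal.coe_ennreal_toReal hp, EReal.coe_ennreal_toReal hn]
  refine EReal.sub_le_sub ?_ ?_
  · rw [EReal.coe_ennreal_le_coe_ennreal_iff]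
    exact lintegral_mono_ae (h.mono fun a ha => ENNReal.ofReal_le_ofReal ha)
  · rw [EReal.coe_ennreal_le_coe_ennreal_iff]
    exact lintegral_mono_ae (h.mono fun a ha => ENNReal.ofReal_le_ofReal (neg_le_neg ha))

/-- The tariff given by a lower semicontinuous real function. -/
noncomputable def Tariff.ofReal (f : ℝ≥0 → ℝ) (hf : LowerSemicontinuous f) (h0 : f 0 = 0) :
    Tariff where
  price x := (f x).toNNReal
  lsc := continuous_real_toNNReal.comp_lowerSemicontinuous hf
    fun _ _ h => Real.toNNReal_mono h
  price_zero := by simp [h0]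

lemma Tariff.ofReal_price {f : ℝ≥0 → ℝ} (hf : LowerSemicontinuous f) (h0 : f 0 = 0) {x : ℝ≥0}
    (hx : 0 ≤ f x) : ((Tariff.ofReal f hf h0).price x : ℝ) = f x :=
  Real.coe_toNNReal _ hx

lemma Tariff.measurable_coe_price (q : Tariff) : Measurable fun y => (q.price y : ℝ) :=
  q.lsc.measurable.coe_nnreal_real

section Indirect

variable {u : ℝ → ℝ → ℝ} {q : Tariff}

lemma IsUtility.continuous_nnreal (hu : IsUtility u) :
    Continuous fun z : ℝ≥0 × ℝ≥0 => u z.1 z.2 :=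
  hu.continuousOn_uncurry.comp_continuous
    (f := fun z : ℝ≥0 × ℝ≥0 => ((z.1 : ℝ), (z.2 : ℝ))) (by fun_prop) fun z =>
    mk_mem_quadrant z.1.2 z.2.2

lemma Best2.indirect_eq {x y : ℝ≥0} (h : Best2 u q x y) : indirect u q x = payoff2 u q x y :=
  le_antisymm (ciSup_le h) (le_ciSup (f := fun y => payoff2 u q x y)
    ⟨payoff2 u q x y, by rintro _ ⟨y', rfl⟩; exact h y'⟩ y)

lemma Solvable2.bddAbove (hq : Solvable2 u q) (x : ℝ≥0) :
    BddAbove (range fun y => payoff2 u q x y) := by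
  obtain ⟨y, hy⟩ := hq x
  exact ⟨payoff2 u q x y, by rintro _ ⟨y', rfl⟩; exact hy y'⟩

lemma Solvable2.payoff2_le (hq : Solvable2 u q) (x y : ℝ≥0) :
    payoff2 u q x y ≤ indirect u q x :=
  le_ciSup (f := fun y => payoff2 u q x y) (hq.bddAbove x) y

lemma Solvable2.best2_iff (hq : Solvable2 u q) {x y : ℝ≥0} :
    Best2 u q x y ↔ indirect u q x ≤ payoff2 u q x y :=
  ⟨fun h => h.indirect_eq.le, fun h y' => (hq.payoff2_le x y').trans h⟩

/-- A supremum of continuous functions. This makes `U - U(0)` an admissible price schedule for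
seller 1. -/
lemma Solvable2.lowerSemicontinuous_indirect (hq : Solvable2 u q) (hu : IsUtility u) :
    LowerSemicontinuous (indirect u q) :=
  lowerSemicontinuous_ciSup hq.bddAbove fun y =>
    ((hu.continuous_nnreal.comp (by fun_prop : Continuous fun x : ℝ≥0 => (x, y))).sub
      continuous_const).lowerSemicontinuous

lemma Solvable2.indirect_zero_lt (hq : Solvable2 u q) (hu : IsUtility u) {x : ℝ≥0}
    (hx : 0 < x) : indirect u q 0 < indirect u q x := by
  obtain ⟨y, hy⟩ := hq 0
  rw [hy.indirect_eq]
  refine lt_of_lt_of_le ?_ (hq.payoff2_le x y)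
  have := hu.strictMono_left y y.2 (show ((0 : ℝ≥0) : ℝ) ∈ Ici 0 from NNReal.coe_nonneg 0)
    (show (x : ℝ) ∈ Ici 0 from x.2) (by exact_mod_cast hx)
  simp only at this
  simp only [payoff2]
  linarith

lemma Solvable2.indirect_zero_le (hq : Solvable2 u q) (hu : IsUtility u) (x : ℝ≥0) :
    indirect u q 0 ≤ indirect u q x := by
  rcases eq_zero_or_pos x with rfl | hx
  · exact le_rfl
  · exact (hq.indirect_zero_lt hu hx).le

lemma Solvable2.measurable_indirect (hq : Solvable2 u q) (hu : IsUtility u) :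
    Measurable (indirect u q) := (hq.lowerSemicontinuous_indirect hu).measurable

lemma measurable_payoff2 (hu : IsUtility u) :
    Measurable fun z : ℝ≥0 × ℝ≥0 => payoff2 u q z.1 z.2 :=
  hu.continuous_nnreal.measurable.sub (q.measurable_coe_price.comp measurable_snd)

end Indirect

namespace Profile

variable {Ω : Type*} [MeasurableSpace Ω] {P : Measure Ω} {σ : Profile Ω} {u : ℝ → ℝ → ℝ} {k : ℝ}

instance [IsProbabilityMeasure P] (q : Tariff) : IsProbabilityMeasure (σ.law P q) := by
  unfold law; infer_instance

lemma ae_law_of_ae {q : Tariff} {p : (Ω × ℝ≥0) × ℝ≥0 → Prop} (hp : MeasurableSet {a | p a})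
    (h : ∀ ω x, ∀ᵐ y ∂(σ.buy2 (σ.offer1 ω) x q : Measure ℝ≥0), p ((ω, x), y)) :
    ∀ᵐ a ∂σ.law P q, p a :=
  Measure.ae_compProd_of_ae_ae hp (ae_of_all _ fun a => h a.1 a.2)

lemma ae_law_of_ae_fst {q : Tariff} {p : Ω × ℝ≥0 → Prop} (hp : MeasurableSet {a | p a})
    (h : ∀ᵐ a ∂P.compProd σ.kernel1, p a) : ∀ᵐ a ∂σ.law P q, p a.1 :=
  Measure.ae_compProd_of_ae_fst (σ.kernel2 q) hp h

/-- The menu is seen only after the first purchase, so a deviation of seller 2 leaves the population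
of types unchanged. -/
lemma map_law (q : Tariff) :
    (σ.law P q).map (fun a => (a.1.2 : ℝ)) = σ.firstDist P := by
  have h : ∀ q, (σ.law P q).map (fun a => (a.1.2 : ℝ)) =
      (P.compProd σ.kernel1).map fun a => (a.2 : ℝ) := fun q => by
    conv_rhs => rw [← Measure.fst_compProd (P.compProd σ.kernel1) (σ.kernel2 q), Measure.fst,
      Measure.map_map (by fun_prop) measurable_fst]
    rfl
  rw [firstDist, h, h]

instance [IsProbabilityMeasure P] : IsProbabilityMeasure (σ.firstDist P) :=
  Measure.isProbabilityMeasure_map (by fun_prop)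

lemma ae_firstDist {p : ℝ → Prop} (h : ∀ᵐ a ∂σ.law P σ.offer2, p a.1.2)
    (hp : MeasurableSet {x | p x}) : ∀ᵐ x ∂σ.firstDist P, p x := by
  rw [firstDist, ae_map_iff (by fun_prop) hp]
  exact h

lemma ae_law_of_firstDist (q : Tariff) {p : ℝ → Prop} (h : ∀ᵐ x ∂σ.firstDist P, p x) :
    ∀ᵐ a ∂σ.law P q, p a.1.2 := by
  rw [← σ.map_law q] at h
  exact ae_of_ae_map (by fun_prop) h

namespace IsEquilibrium

lemma ae_best2 (hσ : σ.IsEquilibrium P u k) (hu : IsUtility u) {q : Tariff}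
    (hq : Solvable2 u q) : ∀ᵐ a ∂σ.law P q, Best2 u q a.1.2 a.2 := by
  refine ae_law_of_ae ?_ fun ω x => hσ.rational2 _ x q (hq x)
  simp only [hq.best2_iff]
  exact measurableSet_le ((hq.measurable_indirect hu).comp (by fun_prop))
    ((measurable_payoff2 hu).comp (by fun_prop :
      Measurable fun a : (Ω × ℝ≥0) × ℝ≥0 => (a.1.2, a.2)))

/-- The consumer may take nothing from seller 1 for free and keep `U(0)`. -/
lemma ae_price_le (hσ : σ.IsEquilibrium P u k) (hu : IsUtility u) :
    ∀ᵐ a ∂σ.law P σ.offer2, ((σ.offer1 a.1.1).price a.1.2 : ℝ) ≤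
      indirect u σ.offer2 a.1.2 - indirect u σ.offer2 0 := by
  refine ae_law_of_ae_fst (p := fun a => ((σ.offer1 a.1).price a.2 : ℝ) ≤
      indirect u σ.offer2 a.2 - indirect u σ.offer2 0) ?_ ?_
  · exact measurableSet_le σ.measurable_price.coe_nnreal_real
      (((hσ.solvable2.measurable_indirect hu).comp measurable_snd).sub_const _)
  · refine Measure.ae_compProd_of_ae_ae ?_ ?_
    · exact measurableSet_le σ.measurable_price.coe_nnreal_real
        (((hσ.solvable2.measurable_indirect hu).comp measurable_snd).sub_const _)
    · filter_upwards [hσ.solvable1] with ω hω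
      filter_upwards [hσ.rational1 _ hω] with x hx
      have := hx 0
      simp only [(σ.offer1 ω).price_zero, NNReal.coe_zero, sub_zero] at this
      linarith

/-- Seller 1 can sell any `x` at a price just below the consumer's willingness to pay. -/
lemma indirect_sub_le_profit1 (hσ : σ.IsEquilibrium P u k) (hu : IsUtility u) (x : ℝ≥0) :
    indirect u σ.offer2 x - k * x ≤ σ.profit1 P k + indirect u σ.offer2 0 := by
  set U := indirect u σ.offer2
  have hlsc := hσ.solvable2.lowerSemicontinuous_indirect hu
  have hpos : ∀ x : ℝ≥0, 0 < x → U x - k * x ≤ σ.profit1 P k + U 0 := by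
    intro x hx
    have hUx : U 0 < U x := hσ.solvable2.indirect_zero_lt hu hx
    refine le_of_forall_pos_sub_le fun ε' hε' => ?_
    set ε := min ε' (U x - U 0)
    have hε : 0 < ε := lt_min hε' (sub_pos.2 hUx)
    have hεε : ε ≤ ε' := min_le_left _ _
    have hεU : ε ≤ U x - U 0 := min_le_right _ _
    classical
    -- The schedule `U - U(0)` leaves the consumer indifferent everywhere, and the discount makes
    -- `x` her only optimum. Lowering one value preserves lower semicontinuity; the cap on `ε` keeps
    -- the price nonnegative.
    set f : ℝ≥0 → ℝ := fun x' => U x' - U 0 - if x' = x then ε else 0 with hf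
    have hflsc : LowerSemicontinuous f := by
      intro x' y hy
      by_cases hx' : x' = x
      · subst hx'
        have : U 0 + ε + y < U x' := by simp only [hf, if_pos] at hy; linarith
        filter_upwards [hlsc x' _ this] with x'' h
        simp only [hf]
        split_ifs
        · linarith
        · linarith
      · have : U 0 + y < U x' := by simp only [hf, if_neg hx'] at hy; linarith
        filter_upwards [hlsc x' _ this, isOpen_ne.mem_nhds hx'] with x'' h h'
        simp only [hf, if_neg h']
        linarith
    have hf0 : f 0 = 0 := by simp [hf, hx.ne]
    have hfnn : ∀ x', 0 ≤ f x' := by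
      intro x'
      simp only [hf]
      split_ifs with h
      · rw [h]; linarith
      · have := hσ.solvable2.indirect_zero_le hu x'
        simp only [sub_zero]
        linarith
    set p := Tariff.ofReal f hflsc hf0
    have hp : ∀ x', (p.price x' : ℝ) = f x' := fun x' => Tariff.ofReal_price hflsc hf0 (hfnn x')
    have hbest : Best1 u σ.offer2 p x := by
      intro x'
      rw [hp, hp]
      simp only [hf, if_pos]
      split_ifs with h
      · rw [h]
      · simp only [U] at *; linarith
    have huniq : ∀ x', Best1 u σ.offer2 p x' → x' = x := by
      intro x' h
      by_contra hne
      have := h x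
      rw [hp, hp] at this
      simp only [hf, if_pos, if_neg hne] at this
      simp only [U] at *; linarith
    have hopt := hσ.optimal1 p ⟨x, hbest⟩
    have hae := hσ.rational1 p ⟨x, hbest⟩
    have hint := integral_le_expect (μ := (σ.buy1 p : Measure ℝ≥0))
      (f := fun x => p.price x - k * x) (integrable_const (U x - U 0 - ε - k * x)) (by
        filter_upwards [hae] with x' hx'
        rw [huniq x' hx', hp]
        simp only [hf, if_pos]
        exact le_rfl)
    have := hint.trans hopt
    rw [EReal.coe_le_coe_iff] at this
    simp only [integral_const, probReal_univ, one_smul] at this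
    linarith
  rcases eq_zero_or_pos x with rfl | hx
  -- No discount is possible at `0`; nonnegativity of the profit follows by selling ever smaller
  -- bundles.
  · have hprofit : -σ.profit1 P k ≤ 0 := by
      have htend : Tendsto (fun n : ℕ => k * (1 / ((n : ℝ) + 1))) atTop (𝓝 (k * 0)) :=
        tendsto_one_div_add_atTop_nhds_zero_nat.const_mul k
      rw [mul_zero] at htend
      refine ge_of_tendsto' htend fun n => ?_
      have hn : (0 : ℝ≥0) < 1 / ((n : ℝ≥0) + 1) := by positivity
      have h1 := hpos _ hn
      have h2 := hσ.solvable2.indirect_zero_le hu (1 / ((n : ℝ≥0) + 1))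
      push_cast at h1
      simp only [U] at *
      linarith
    simp only [NNReal.coe_zero, mul_zero, sub_zero]
    linarith
  · exact hpos x hx

/-- On the equilibrium path, first-period consumption maximizes the joint surplus of the consumer
and seller 1 given second-period consumption. -/
lemma isMax_of_eq (hσ : σ.IsEquilibrium P u k) (hu : IsUtility u) {x y : ℝ≥0}
    (hxy : Best2 u σ.offer2 x y) (hx : indirect u σ.offer2 x - k * x =
      σ.profit1 P k + indirect u σ.offer2 0) (x' : ℝ) (hx' : 0 ≤ x') :
    u x' y - k * x' ≤ u x y - k * x := by
  lift x' to ℝ≥0 using hx'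
  have h1 := hσ.indirect_sub_le_profit1 hu x'
  have h2 := hσ.solvable2.payoff2_le x' y
  rw [hxy.indirect_eq] at hx
  simp only [payoff2] at h2 hx
  linarith

variable [IsProbabilityMeasure P]

/-- Realized profit is at most `U(x) - U(0) - kx`, hence at most its own mean, and so equals it
almost surely. -/
lemma ae_gain1_eq (hσ : σ.IsEquilibrium P u k) (hu : IsUtility u) :
    ∀ᵐ a ∂σ.law P σ.offer2, σ.gain1 k a = σ.profit1 P k := by
  have hle : ∀ᵐ a ∂σ.law P σ.offer2, 0 ≤ σ.profit1 P k - σ.gain1 k a := by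
    filter_upwards [hσ.ae_price_le hu] with a ha
    have := hσ.indirect_sub_le_profit1 hu a.1.2
    simp only [gain1]
    linarith
  have hint : Integrable (fun a => σ.profit1 P k - σ.gain1 k a) (σ.law P σ.offer2) :=
    (integrable_const _).sub hσ.integrable1
  have hzero : ∫ a, (σ.profit1 P k - σ.gain1 k a) ∂σ.law P σ.offer2 = 0 := by
    rw [integral_sub (integrable_const _) hσ.integrable1]
    simp [profit1]
  filter_upwards [(integral_eq_zero_iff_of_nonneg_ae hle hint).1 hzero] with a ha
  simp only [Pi.zero_apply] at ha
  linarith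

lemma ae_indirect_eq (hσ : σ.IsEquilibrium P u k) (hu : IsUtility u) :
    ∀ᵐ a ∂σ.law P σ.offer2, indirect u σ.offer2 a.1.2 - k * a.1.2 =
      σ.profit1 P k + indirect u σ.offer2 0 := by
  filter_upwards [hσ.ae_price_le hu, hσ.ae_gain1_eq hu] with a h1 h2
  have := hσ.indirect_sub_le_profit1 hu a.1.2
  simp only [gain1] at h2
  linarith

lemma consumerPayoff_eq (hσ : σ.IsEquilibrium P u k) (hu : IsUtility u) :
    σ.consumerPayoff P u = indirect u σ.offer2 0 := by
  have h : ∀ᵐ a ∂σ.law P σ.offer2, σ.gainC u a = indirect u σ.offer2 0 := by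
    filter_upwards [hσ.ae_gain1_eq hu, hσ.ae_indirect_eq hu, hσ.ae_best2 hu hσ.solvable2]
      with a h1 h2 h3
    rw [h3.indirect_eq] at h2
    simp only [gain1, payoff2] at h1 h2
    simp only [gainC]
    linarith
  rw [consumerPayoff, integral_congr_ae h]
  simp

end IsEquilibrium

end Profile

end PrivateTransactions

/-! ### Bunching menus of seller 2 -/

namespace PrivateTransactions

open Filter Topology

/-- The layer cake formula for real integrals over bounded random variables. -/
lemma integral_primitive_comp {α : Type*} [MeasurableSpace α] {μ : Measure α}
    [IsProbabilityMeasure μ] {f : α → ℝ} {G : ℝ → ℝ} {T : ℝ} (hf : Measurable f)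
    (hf0 : ∀ a, 0 ≤ f a) (hfT : ∀ a, f a ≤ T) (hT : 0 ≤ T)
    (hG : ∀ a b, IntervalIntegrable G volume a b) (hG0 : ∀ s, 0 ≤ s → 0 ≤ G s) :
    Integrable (fun a => ∫ s in 0..f a, G s) μ ∧
      ∫ a, (∫ s in 0..f a, G s) ∂μ = ∫ s in 0..T, G s * μ.real {a | s ≤ f a} := by
  have hmeas : Measurable fun a => ∫ s in 0..f a, G s :=
    (intervalIntegral.continuous_primitive hG 0).measurable.comp hf
  have hnn : ∀ a, 0 ≤ ∫ s in 0..f a, G s := fun a =>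
    intervalIntegral.integral_nonneg (hf0 a) fun s hs => hG0 s hs.1
  have hle : ∀ a, ∫ s in 0..f a, G s ≤ ∫ s in 0..T, G s := fun a => by
    rw [← intervalIntegral.integral_add_adjacent_intervals (hG 0 (f a)) (hG (f a) T)]
    linarith [intervalIntegral.integral_nonneg (μ := volume) (hfT a) fun s hs =>
      hG0 s ((hf0 a).trans hs.1)]
  have hint : Integrable (fun a => ∫ s in 0..f a, G s) μ :=
    Integrable.of_bound hmeas.aestronglyMeasurable (∫ s in 0..T, G s) (ae_of_all _ fun a => by
      rw [Real.norm_of_nonneg (hnn a)]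
      exact hle a)
  refine ⟨hint, ?_⟩
  have hanti : Antitone fun s => μ.real {a | s ≤ f a} := fun s s' hss =>
    measureReal_mono fun a ha => hss.trans ha
  rw [integral_eq_lintegral_of_nonneg_ae (ae_of_all _ hnn) hmeas.aestronglyMeasurable,
    lintegral_comp_eq_lintegral_meas_le_mul μ (ae_of_all _ hf0) hf.aemeasurable
      (fun t _ => hG 0 t) (by
        filter_upwards [ae_restrict_mem measurableSet_Ioi] with s hs
        exact hG0 s (le_of_lt hs)),
    intervalIntegral.integral_of_le hT, integral_eq_lintegral_of_nonneg_ae]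
  · congr 1
    rw [← Ioc_union_Ioi_eq_Ioi hT, lintegral_union measurableSet_Ioi
      (Set.disjoint_left.2 fun s hs hs' => (not_lt.2 hs.2) hs')]
    have hz : ∫⁻ t in Ioi T, μ {a | t ≤ f a} * ENNReal.ofReal (G t) = 0 := by
      refine (setLIntegral_congr_fun measurableSet_Ioi (g := fun _ => 0) fun t ht => ?_).trans
        (by simp)
      have : {a | t ≤ f a} = ∅ := by
        ext a
        simpa using (hfT a).trans_lt ht
      simp [this]
    rw [hz, add_zero]
    refine setLIntegral_congr_fun measurableSet_Ioc fun t ht => ?_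
    rw [ENNReal.ofReal_mul (hG0 t ht.1.le), mul_comm, measureReal_def,
      ENNReal.ofReal_toReal (measure_ne_top _ _)]
  · filter_upwards [ae_restrict_mem measurableSet_Ioc] with s hs
    exact mul_nonneg (hG0 s hs.1.le) measureReal_nonneg
  · exact ((hG 0 T).1.aestronglyMeasurable).mul hanti.measurable.aestronglyMeasurable

/-- A tariff that grows quadratically leaves every consumer with an optimal choice. -/
lemma solvable2_of_quadratic {u : ℝ → ℝ → ℝ} (hu : IsUtility u) {q : Tariff} {M A : ℝ}
    (hM : 0 ≤ M) (hA : 0 ≤ A) (h : ∀ y : ℝ≥0, M ≤ y → ((y : ℝ) - M) ^ 2 - A ≤ q.price y) :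
    Solvable2 u q := by
  intro x
  set m := du2 u x 0
  have hm : 0 < m := hu.du2_pos x.coe_nonneg (le_refl (0 : ℝ))
  have htan : ∀ y : ℝ≥0, u x y ≤ u x 0 + m * y := fun y => by
    rcases eq_or_ne y 0 with rfl | hy
    · simp
    · have := hu.lt_tangent x.coe_nonneg le_rfl x.coe_nonneg y.coe_nonneg 
        (by simpa using fun h => hy (NNReal.coe_eq_zero.1 h.symm))
      simp only [sub_self, mul_zero, add_zero, sub_zero] at this
      exact this.le
  -- Beyond `R` the quadratic price exceeds the tangent bound `m * y` on the utility gain, so the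
  -- search reduces to a compact interval.
  set R : ℝ≥0 := (M + (m + m * M + A + 1)).toNNReal
  have hR : (R : ℝ) = M + (m + m * M + A + 1) := Real.coe_toNNReal _ (by positivity)
  have hlsc : LowerSemicontinuous fun y : ℝ≥0 => (q.price y : ℝ) + -u x y :=
    (NNReal.continuous_coe.comp_lowerSemicontinuous q.lsc NNReal.coe_mono).add
      (hu.continuous_nnreal.comp (by fun_prop :
        Continuous fun y : ℝ≥0 => (x, y))).neg.lowerSemicontinuous
  obtain ⟨y, -, hmin⟩ := (hlsc.lowerSemicontinuousOn (Icc 0 R)).exists_isMinOn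
    (nonempty_Icc.2 zero_le) isCompact_Icc
  refine ⟨y, fun y' => ?_⟩
  have key : ∀ y' ≤ R, payoff2 u q x y' ≤ payoff2 u q x y := by
    intro y' hy'
    have := hmin (show y' ∈ Icc 0 R from ⟨zero_le, hy'⟩)
    simp only [mem_ofPred_eq] at this
    simp only [payoff2]
    linarith
  rcases le_or_gt y' R with hy' | hy'
  · exact key y' hy'
  · refine le_trans ?_ (key 0 zero_le)
    have hy2 : M + (m + m * M + A + 1) < y' := by rw [← hR]; exact_mod_cast hy'
    have hpos : 0 ≤ m * M + A := by positivity
    have h1 := h y' (by linarith)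
    have h2 := htan y'
    simp only [payoff2, q.price_zero, NNReal.coe_zero, sub_zero]
    nlinarith

/-- A menu with marginal price `g`, on which all bundles of size at least `b` are discounted
by `ε`. -/
noncomputable def menuPrice (g : ℝ → ℝ) (b ε : ℝ) (y : ℝ≥0) : ℝ :=
  (∫ s in 0..(y : ℝ), g s) - if b ≤ y then ε else 0

/-- The only jump is downward, and `b` itself already gets the discount. -/
lemma lowerSemicontinuous_menuPrice {g : ℝ → ℝ} (hg : ∀ a b, IntervalIntegrable g volume a b)
    (b : ℝ) {ε : ℝ} (hε : 0 ≤ ε) : LowerSemicontinuous (menuPrice g b ε) := by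
  have hcont : Continuous fun y : ℝ≥0 => ∫ s in 0..(y : ℝ), g s :=
    (intervalIntegral.continuous_primitive hg 0).comp NNReal.continuous_coe
  intro y r hr
  unfold menuPrice at hr ⊢
  split_ifs at hr with h
  · filter_upwards [hcont.continuousAt.eventually
      (lt_mem_nhds (show r + ε < ∫ s in 0..(y : ℝ), g s by linarith))] with y' hy'
    split_ifs <;> linarith
  · have hopen : ∀ᶠ y' : ℝ≥0 in 𝓝 y, (y' : ℝ) < b :=
      NNReal.continuous_coe.continuousAt.eventually (gt_mem_nhds (not_le.1 h))
    filter_upwards [hcont.continuousAt.eventually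
      (lt_mem_nhds (show r < ∫ s in 0..(y : ℝ), g s by linarith)), hopen] with y' hy' hy''
    rw [if_neg (not_le.2 hy'')]
    linarith

namespace Setting

variable {u : ℝ → ℝ → ℝ} {k xs ys xo e : ℝ}

/-- The marginal type that buys the quantity `s` from a menu on which the types `t ≥ c` are the
ones to buy the quantities in `(t₁, t₂]`. -/
noncomputable def cutoff (t₁ c t₂ s : ℝ) : ℝ := if s ≤ t₁ then s else if s ≤ t₂ then c else s

/-- The quantity that the type `t` buys from this menu. -/
noncomputable def target (t₁ c t₂ t : ℝ) : ℝ := if t < c then min t t₁ else max t t₂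

lemma monotone_cutoff {t₁ c t₂ : ℝ} (h1 : t₁ ≤ c) (h2 : c ≤ t₂) : Monotone (cutoff t₁ c t₂) := by
  intro s s' hss
  unfold cutoff
  split_ifs <;> linarith

lemma monotone_target {t₁ c t₂ : ℝ} (h1 : t₁ ≤ c) (h2 : c ≤ t₂) : Monotone (target t₁ c t₂) := by
  intro s s' hss
  unfold target
  split_ifs
  · exact min_le_min_right _ hss
  · exact (min_le_right _ _).trans (h1.trans (h2.trans (le_max_right _ _)))
  · linarith
  · exact max_le_max_right _ hss

/-- A Galois connection: the mass of targets of at least `s` is the demand profile at `cutoff s`. -/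
lemma le_target_iff {t₁ c t₂ : ℝ} (h1 : t₁ ≤ c) (h2 : c ≤ t₂) (s t : ℝ) :
    s ≤ target t₁ c t₂ t ↔ cutoff t₁ c t₂ s ≤ t := by
  unfold target cutoff
  split_ifs
  · rw [le_min_iff]; constructor <;> intro <;> (try constructor) <;> grind
  · rw [le_min_iff]; constructor <;> intro <;> grind
  · rw [le_min_iff]; constructor <;> intro <;> grind
  · rw [le_max_iff]; constructor <;> intro <;> grind
  · rw [le_max_iff]; constructor <;> intro <;> grind
  · rw [le_max_iff]; constructor <;> intro <;> grind

lemma target_mem {t₁ c t₂ t T : ℝ} (h0 : 0 ≤ t₁) (h2T : t₂ ≤ T) (ht : t ∈ Icc 0 T) :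
    target t₁ c t₂ t ∈ Icc 0 T := by
  unfold target
  split_ifs
  · exact ⟨le_min ht.1 h0, (min_le_left _ _).trans ht.2⟩
  · exact ⟨le_max_of_le_left ht.1, max_le ht.2 h2T⟩

lemma xhat_of_ge (S : Setting u k xs ys xo e) {t : ℝ} (ht : ys ≤ t) :
    xhat u k xs ys xo t = xs := by
  have h := S.xhat_ys
  rw [xhat, min_self] at h
  rw [xhat, min_eq_left ht, h]

lemma marginal_clamp (S : Setting u k xs ys xo e) (t s : ℝ) :
    marginal u k xs ys xo (max 0 (min ys t)) s = marginal u k xs ys xo t s := by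
  obtain ⟨h0, h1⟩ := S.clamp_mem t
  simp only [marginal, xhat, min_eq_right h1, max_eq_right h0]

lemma marginal_le_top (S : Setting u k xs ys xo e) (t s : ℝ) :
    marginal u k xs ys xo t s ≤ marginal u k xs ys xo ys 0 := by
  rw [← S.marginal_clamp t]
  refine (S.marginal_le_left s (S.clamp_mem t) ⟨S.efficient.pos_right.le, le_rfl⟩
    (S.clamp_mem t).2).trans ?_
  have : marginal u k xs ys xo ys s = marginal u k xs ys xo ys (max s 0) := by
    simp only [marginal, max_eq_left (le_max_right s 0)]
  rw [this]
  exact S.marginal_le_right ys le_rfl (le_max_right s 0)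

/-- The marginal price of the menu described by `cutoff`. -/
noncomputable def marginalPrice (u : ℝ → ℝ → ℝ) (k xs ys xo t₁ c t₂ s : ℝ) : ℝ :=
  marginal u k xs ys xo (cutoff t₁ c t₂ s) s +
    (k - marginal u k xs ys xo ys (max s ys) + 2 * max (s - ys) 0)

/-- The correction in `marginalPrice` acts only beyond `ys`. For `t₂ ≤ ys` the marginal price there
is `k + 2 (s - ys)`: no unit is sold at a loss, and quadratic growth guarantees an optimal purchase.
-/
lemma marginalPrice_of_le (S : Setting u k xs ys xo e) {t₁ c t₂ s : ℝ} (hs : s ≤ ys) :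
    marginalPrice u k xs ys xo t₁ c t₂ s = marginal u k xs ys xo (cutoff t₁ c t₂ s) s := by
  rw [marginalPrice, max_eq_right hs, S.marginal_ys, max_eq_right (by linarith)]
  ring

lemma marginal_max_le (S : Setting u k xs ys xo e) (s : ℝ) :
    marginal u k xs ys xo ys (max s ys) ≤ k := by
  have := S.marginal_le_right ys S.efficient.pos_right.le (le_max_right s ys)
  rwa [S.marginal_ys] at this

lemma marginalPrice_nonneg (S : Setting u k xs ys xo e) (t₁ c t₂ s : ℝ) :
    0 ≤ marginalPrice u k xs ys xo t₁ c t₂ s := by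
  have h1 := S.marginal_pos (cutoff t₁ c t₂ s) s
  have h2 := S.marginal_max_le s
  have h3 : 0 ≤ max (s - ys) 0 := le_max_right _ _
  unfold marginalPrice
  linarith

lemma intervalIntegrable_marginalPrice (S : Setting u k xs ys xo e) {t₁ c t₂ : ℝ} (h1 : t₁ ≤ c)
    (h2 : c ≤ t₂) (a b : ℝ) :
    IntervalIntegrable (marginalPrice u k xs ys xo t₁ c t₂) volume a b := by
  refine IntervalIntegrable.add ?_ (Continuous.intervalIntegrable ?_ a b)
  · rw [intervalIntegrable_iff]
    refine Measure.integrableOn_of_bounded (M := marginal u k xs ys xo ys 0) (by simp)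
      (S.continuous_marginal.measurable.comp
        ((monotone_cutoff h1 h2).measurable.prodMk measurable_id)).aestronglyMeasurable
      (ae_of_all _ fun s => ?_)
    rw [Real.norm_of_nonneg (S.marginal_pos _ _).le]
    exact S.marginal_le_top _ _
  · have := S.continuous_marginal.comp (by fun_prop : Continuous fun s : ℝ => (ys, max s ys))
    exact (continuous_const.sub this).add (by fun_prop)

lemma le_marginalPrice (S : Setting u k xs ys xo e) {t₁ c t₂ s : ℝ} (h1 : t₁ ≤ c)
    (h2 : c ≤ t₂) (hk : k ≤ marginal u k xs ys xo c t₂) (h2T : t₂ ≤ ys) (hs : 0 ≤ s) :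
    k ≤ marginalPrice u k xs ys xo t₁ c t₂ s := by
  rcases le_or_gt s ys with h | h
  · rw [S.marginalPrice_of_le h, cutoff]
    split_ifs with h3 h4
    · exact S.le_marginal_diag ⟨hs, h⟩
    · exact hk.trans (S.marginal_le_right c hs h4)
    · exact S.le_marginal_diag ⟨hs, h⟩
  · have hc : cutoff t₁ c t₂ s = s := by
      unfold cutoff
      split_ifs <;> linarith
    rw [marginalPrice, hc, max_eq_left h.le, max_eq_left (by linarith), marginal, marginal,
      S.xhat_ys, S.xhat_of_ge h.le]
    linarith

variable {t₁ c t₂ ε : ℝ}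

/-- The menu on which the types `t ≥ c` are the ones to buy the quantities in `(t₁, t₂]`, with a
discount `ε` on the quantities from `t₂` on to break ties. -/
noncomputable def bunchingMenu (S : Setting u k xs ys xo e) (h1 : t₁ ≤ c) (h2 : c ≤ t₂)
    (ht₂ : 0 < t₂) (hε : 0 ≤ ε) : Tariff :=
  Tariff.ofReal (menuPrice (marginalPrice u k xs ys xo t₁ c t₂) t₂ ε)
    (lowerSemicontinuous_menuPrice (S.intervalIntegrable_marginalPrice h1 h2) t₂ hε)
    (by simp [menuPrice, not_le.2 ht₂])

lemma bunchingMenu_price (S : Setting u k xs ys xo e) (h1 : t₁ ≤ c) (h2 : c ≤ t₂)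
    (ht₂ : 0 < t₂) (hε : 0 ≤ ε) (hεle : ε ≤ ∫ s in 0..t₂, marginalPrice u k xs ys xo t₁ c t₂ s)
    (y : ℝ≥0) : ((S.bunchingMenu h1 h2 ht₂ hε).price y : ℝ) =
      menuPrice (marginalPrice u k xs ys xo t₁ c t₂) t₂ ε y := by
  refine Tariff.ofReal_price _ _ ?_
  have hint := S.intervalIntegrable_marginalPrice h1 h2
  unfold menuPrice
  split_ifs with h
  · rw [← intervalIntegral.integral_add_adjacent_intervals (hint 0 t₂) (hint t₂ y)]
    linarith [intervalIntegral.integral_nonneg (μ := volume) h fun s _ =>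
      S.marginalPrice_nonneg t₁ c t₂ s]
  · linarith [intervalIntegral.integral_nonneg (μ := volume) y.coe_nonneg fun s _ =>
      S.marginalPrice_nonneg t₁ c t₂ s]

lemma solvable2_bunchingMenu (S : Setting u k xs ys xo e) (h1 : t₁ ≤ c) (h2 : c ≤ t₂)
    (ht₂ : 0 < t₂) (hε : 0 ≤ ε)
    (hεle : ε ≤ ∫ s in 0..t₂, marginalPrice u k xs ys xo t₁ c t₂ s) :
    Solvable2 u (S.bunchingMenu h1 h2 ht₂ hε) := by
  refine solvable2_of_quadratic S.utility S.efficient.pos_right.le hε fun y hy => ?_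
  rw [S.bunchingMenu_price h1 h2 ht₂ hε hεle]
  have hint := S.intervalIntegrable_marginalPrice h1 h2
  have hquad : ∫ s in ys..y, 2 * (s - ys) ≤
      ∫ s in ys..y, marginalPrice u k xs ys xo t₁ c t₂ s := by
    refine intervalIntegral.integral_mono_on hy
      ((by fun_prop : Continuous fun s : ℝ => 2 * (s - ys)).intervalIntegrable _ _)
      (hint _ _) fun s hs => ?_
    have e1 := S.marginal_pos (cutoff t₁ c t₂ s) s
    have e2 := S.marginal_max_le s
    rw [marginalPrice, max_eq_left (by linarith [hs.1] : 0 ≤ s - ys)]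
    linarith
  have hval : ∫ s in ys..y, 2 * (s - ys) = ((y : ℝ) - ys) ^ 2 := by
    rw [intervalIntegral.integral_const_mul,
      intervalIntegral.integral_comp_sub_right (fun s => s), integral_id]
    ring
  have hfirst := intervalIntegral.integral_nonneg (μ := volume) S.efficient.pos_right.le
    fun s _ => S.marginalPrice_nonneg t₁ c t₂ s
  unfold menuPrice
  rw [← intervalIntegral.integral_add_adjacent_intervals (hint 0 ys) (hint ys y)]
  split_ifs <;> linarith

/-- A consumer whose marginal utility is at least that of the type `t` buys at least
`target t`. -/
lemma target_le_of_best2 (S : Setting u k xs ys xo e) (h0 : 0 ≤ t₁) (h1 : t₁ ≤ c) (h2 : c ≤ t₂)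
    (h2T : t₂ ≤ ys) (ht₂ : 0 < t₂) (hε : 0 < ε)
    (hεle : ε ≤ ∫ s in 0..t₂, marginalPrice u k xs ys xo t₁ c t₂ s) {x y : ℝ≥0} {t : ℝ}
    (ht : t ∈ Icc 0 ys) (hx : ∀ s, 0 ≤ s → marginal u k xs ys xo t s ≤ du2 u x s)
    (hy : Best2 u (S.bunchingMenu h1 h2 ht₂ hε.le) x y) : target t₁ c t₂ t ≤ y := by
  by_contra! hlt
  have htgt := target_mem (c := c) h0 h2T ht
  set a := target t₁ c t₂ t with ha
  have hbest := hy a.toNNReal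
  simp only [payoff2, S.bunchingMenu_price h1 h2 ht₂ hε.le hεle, menuPrice,
    Real.coe_toNNReal a htgt.1] at hbest
  have hint := S.intervalIntegrable_marginalPrice h1 h2
  rw [← intervalIntegral.integral_add_adjacent_intervals (hint 0 y) (hint y a)] at hbest
  have hdiff := S.integral_du2 x.coe_nonneg y.coe_nonneg htgt.1
  have hle : ∀ s ∈ Icc (y : ℝ) a, marginalPrice u k xs ys xo t₁ c t₂ s ≤ du2 u x s := by
    intro s hs
    have hs0 : 0 ≤ s := y.coe_nonneg.trans hs.1
    rw [S.marginalPrice_of_le (hs.2.trans htgt.2)]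
    refine le_trans (S.marginal_le_left s ?_ ht ((le_target_iff h1 h2 s t).1 hs.2)) (hx s hs0)
    refine ⟨?_, ((le_target_iff h1 h2 s t).1 hs.2).trans ht.2⟩
    unfold cutoff
    split_ifs <;> linarith
  have hmono : ∫ s in y..a, marginalPrice u k xs ys xo t₁ c t₂ s ≤ ∫ s in y..a, du2 u x s :=
    intervalIntegral.integral_mono_on hlt.le (hint _ _)
      (S.intervalIntegrable_du2 x.coe_nonneg y.coe_nonneg htgt.1) hle
  -- Raising the purchase from `y` to `a` never hurts. It helps strictly through the discount if
  -- `t₂` is crossed, and otherwise because the marginal price on the way is the marginal utility of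
  -- types strictly below `t`.
  by_cases hcase : (y : ℝ) < t₂ ∧ t₂ ≤ a
  · rw [if_pos hcase.2, if_neg (not_le.2 hcase.1)] at hbest
    linarith
  · have hstrict : ∀ s ∈ Ioo (y : ℝ) a, cutoff t₁ c t₂ s = s ∧ s < t := by
      intro s hs
      have hs2 := hs.2
      have hs1 := hs.1
      simp only [ha, target] at hs2 hcase
      unfold cutoff
      split_ifs at hs2 hcase with h3
      · rw [lt_min_iff] at hs2
        rw [if_pos hs2.2.le]
        exact ⟨rfl, hs2.1⟩
      · have hy2 : t₂ ≤ y := by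
          by_contra! hh
          exact hcase ⟨hh, le_max_right _ _⟩
        rcases lt_max_iff.1 hs2 with h4 | h4
        · rw [if_neg (by linarith), if_neg (by linarith)]
          exact ⟨rfl, h4⟩
        · linarith
    have hpos := intervalIntegral.intervalIntegral_pos_of_pos_on
      ((S.intervalIntegrable_du2 x.coe_nonneg y.coe_nonneg htgt.1).sub (hint y a)) (fun s hs => by
        obtain ⟨e1, e2⟩ := hstrict s hs
        have hs0 : 0 ≤ s := y.coe_nonneg.trans hs.1.le
        rw [S.marginalPrice_of_le (hs.2.le.trans htgt.2), e1, sub_pos]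
        exact (S.marginal_lt_left s ⟨hs0, e2.le.trans ht.2⟩ ht e2).trans_le (hx s hs0)) hlt
    rw [intervalIntegral.integral_sub (S.intervalIntegrable_du2 x.coe_nonneg y.coe_nonneg htgt.1) (hint y a)]
      at hpos
    have hif : (if t₂ ≤ (y : ℝ) then ε else 0) = if t₂ ≤ a then ε else 0 := by
      by_cases hh : t₂ ≤ (y : ℝ)
      · rw [if_pos hh, if_pos (hh.trans hlt.le)]
      · rw [if_neg hh, if_neg fun h => hcase ⟨not_le.1 hh, h⟩]
    rw [hif] at hbest
    linarith

/-- Purchases beyond the target carry nonnegative margins, and the discount costs at most `ε`. -/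
lemma profit_bunchingMenu (S : Setting u k xs ys xo e) (h0 : 0 ≤ t₁) (h1 : t₁ ≤ c) (h2 : c ≤ t₂)
    (h2T : t₂ ≤ ys) (hk : k ≤ marginal u k xs ys xo c t₂) (ht₂ : 0 < t₂) (hε : 0 < ε)
    (hεle : ε ≤ ∫ s in 0..t₂, marginalPrice u k xs ys xo t₁ c t₂ s) {x y : ℝ≥0} {t : ℝ}
    (ht : t ∈ Icc 0 ys) (hx : ∀ s, 0 ≤ s → marginal u k xs ys xo t s ≤ du2 u x s)
    (hy : Best2 u (S.bunchingMenu h1 h2 ht₂ hε.le) x y) :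
    (∫ s in 0..target t₁ c t₂ t, (marginalPrice u k xs ys xo t₁ c t₂ s - k)) - ε ≤
      (S.bunchingMenu h1 h2 ht₂ hε.le).price y - k * y := by
  have hle := S.target_le_of_best2 h0 h1 h2 h2T ht₂ hε hεle ht hx hy
  have htgt := target_mem (c := c) h0 h2T ht
  have hint : ∀ a b, IntervalIntegrable (fun s => marginalPrice u k xs ys xo t₁ c t₂ s - k)
      volume a b := fun a b =>
    (S.intervalIntegrable_marginalPrice h1 h2 a b).sub intervalIntegrable_const
  have hsplit := intervalIntegral.integral_add_adjacent_intervals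
    (hint 0 (target t₁ c t₂ t)) (hint (target t₁ c t₂ t) y)
  have hnn := intervalIntegral.integral_nonneg (μ := volume) hle fun s hs =>
    sub_nonneg.2 (S.le_marginalPrice h1 h2 hk h2T (htgt.1.trans hs.1))
  have htot : ∫ s in 0..(y : ℝ), (marginalPrice u k xs ys xo t₁ c t₂ s - k) =
      (∫ s in 0..(y : ℝ), marginalPrice u k xs ys xo t₁ c t₂ s) - k * y := by
    rw [intervalIntegral.integral_sub (S.intervalIntegrable_marginalPrice h1 h2 _ _)
      intervalIntegrable_const, intervalIntegral.integral_const, smul_eq_mul, sub_zero, mul_comm]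
  rw [S.bunchingMenu_price h1 h2 ht₂ hε.le hεle, menuPrice]
  split_ifs <;> linarith

end Setting

end PrivateTransactions

/-! ### Seller 2's optimality and the joint value -/

namespace PrivateTransactions

open Filter Topology

namespace Setting

open Profile

variable {u : ℝ → ℝ → ℝ} {k xs ys xo e : ℝ} {Ω : Type*} [MeasurableSpace Ω] {P : Measure Ω}
  {σ : Profile Ω}

lemma price_eq_of_best2 {x y : ℝ≥0} {c : ℝ} (hy : Best2 u σ.offer2 x y)
    (hx : indirect u σ.offer2 x - k * x = c) : (σ.offer2.price y : ℝ) = u x y - k * x - c := by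
  rw [hy.indirect_eq] at hx
  simp only [payoff2] at hx
  linarith

/-- Seller 1 can sell `xo`, after which the consumer may buy nothing from seller 2. -/
lemma jointPayoff_le (S : Setting u k xs ys xo e) (hσ : σ.IsEquilibrium P u k) :
    jointPayoff u k xo ≤ σ.profit1 P k + indirect u σ.offer2 0 := by
  have h1 := hσ.indirect_sub_le_profit1 S.utility xo.toNNReal
  have h2 := hσ.solvable2.payoff2_le xo.toNNReal 0
  simp only [payoff2, σ.offer2.price_zero, NNReal.coe_zero, sub_zero,
    Real.coe_toNNReal _ S.observable.pos.le] at h1 h2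
  rw [jointPayoff]
  linarith

/-- Seller 2 gets the total surplus minus what the consumer and seller 1 keep. On the curve this is
the envelope formula; beyond `xs` the total surplus is strictly less than efficient. -/
lemma gain2_le (S : Setting u k xs ys xo e) (hσ : σ.IsEquilibrium P u k) {x y : ℝ≥0}
    (hy : Best2 u σ.offer2 x y)
    (hx : indirect u σ.offer2 x - k * x = σ.profit1 P k + indirect u σ.offer2 0) :
    ((x : ℝ) ∈ uIcc xo xs ∧ (y : ℝ) = yhat u k x ∧
      (σ.offer2.price y : ℝ) - k * y =
        (∫ s in 0..demand u k xs xo x, (marginal u k xs ys xo s s - k)) + (jointPayoff u k xo -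
          (σ.profit1 P k + indirect u σ.offer2 0))) ∨
      (σ.offer2.price y : ℝ) - k * y <
        (∫ s in 0..demand u k xs xo x, (marginal u k xs ys xo s s - k)) + (jointPayoff u k xo -
          (σ.profit1 P k + indirect u σ.offer2 0)) := by
  rw [S.integral_marginal_diag (S.demand_mem _), price_eq_of_best2 hy hx]
  rcases S.mem_or_beyond x.coe_nonneg y.coe_nonneg (hσ.isMax_of_eq S.utility hy hx) with h | h
  · left
    refine ⟨h.1, h.2, ?_⟩
    rw [S.xhat_demand h.1, demand_of_mem h.1, ← h.2]
    ring
  · right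
    rw [S.demand_beyond h.le, S.xhat_ys]
    have := S.total_surplus_lt x.coe_nonneg y.coe_nonneg
      (fun hh => by rw [hh, sub_self, mul_zero] at h; exact lt_irrefl _ h)
    linarith

variable [IsProbabilityMeasure P]

/-- The mass of the consumers whose demand is at least `t`. -/
noncomputable def demandProfile (u : ℝ → ℝ → ℝ) (k xs xo : ℝ) (μ : Measure ℝ) (t : ℝ) : ℝ :=
  μ.real {x | t ≤ demand u k xs xo x}

lemma antitone_demandProfile (μ : Measure ℝ) [IsProbabilityMeasure μ] :
    Antitone (demandProfile u k xs xo μ) := fun _ _ h =>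
  measureReal_mono fun _ ha => h.trans ha

lemma demandProfile_zero (S : Setting u k xs ys xo e) (μ : Measure ℝ) [IsProbabilityMeasure μ] :
    demandProfile u k xs xo μ 0 = 1 := by
  have : {x | 0 ≤ demand u k xs xo x} = univ := eq_univ_of_forall fun x => (S.demand_mem x).1
  rw [demandProfile, this, probReal_univ]

lemma ae_mem_or_beyond (S : Setting u k xs ys xo e) (hσ : σ.IsEquilibrium P u k) :
    ∀ᵐ a ∂σ.law P σ.offer2, ((a.1.2 : ℝ) ∈ uIcc xo xs ∧ (a.2 : ℝ) = yhat u k a.1.2) ∨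
      0 < e * ((a.1.2 : ℝ) - xs) := by
  filter_upwards [hσ.ae_indirect_eq S.utility, hσ.ae_best2 S.utility hσ.solvable2] with a h1 h2
  exact S.mem_or_beyond a.1.2.coe_nonneg a.2.coe_nonneg (hσ.isMax_of_eq S.utility h2 h1)

lemma ae_firstDist_order (S : Setting u k xs ys xo e) (hσ : σ.IsEquilibrium P u k) :
    ∀ᵐ x ∂σ.firstDist P, 0 ≤ e * (x - xo) := by
  refine ae_firstDist ?_ (measurableSet_le measurable_const (by fun_prop))
  filter_upwards [S.ae_mem_or_beyond hσ] with a ha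
  rcases ha with h | h
  · exact (S.mem_uIcc_iff.1 h.1).1
  · have := S.order
    linarith

/-- Seller 2 cannot gain by the deviation to a bunching menu. -/
lemma integral_bunching_le_profit2 (S : Setting u k xs ys xo e) (hσ : σ.IsEquilibrium P u k)
    {t₁ c t₂ : ℝ} (h0 : 0 ≤ t₁) (h1 : t₁ ≤ c) (h2 : c ≤ t₂) (h2T : t₂ ≤ ys) (ht₂ : 0 < t₂)
    (hk : k ≤ marginal u k xs ys xo c t₂) :
    ∫ s in 0..ys, (marginalPrice u k xs ys xo t₁ c t₂ s - k) *
      demandProfile u k xs xo (σ.firstDist P) (cutoff t₁ c t₂ s) ≤ σ.profit2 P k := by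
  have hint := S.intervalIntegrable_marginalPrice h1 h2
  have hpos : 0 < ∫ s in 0..t₂, marginalPrice u k xs ys xo t₁ c t₂ s := by
    have := intervalIntegral.integral_mono_on ht₂.le (μ := volume)
      (intervalIntegrable_const (c := k)) (hint 0 t₂) fun s hs =>
        S.le_marginalPrice h1 h2 hk h2T hs.1
    rw [intervalIntegral.integral_const, smul_eq_mul, sub_zero] at this
    exact (mul_pos ht₂ S.k_pos).trans_le this
  refine le_of_forall_pos_le_add fun ε' hε' => ?_
  set ε := min ε' (∫ s in 0..t₂, marginalPrice u k xs ys xo t₁ c t₂ s)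
  have hε : 0 < ε := lt_min hε' hpos
  have hεle : ε ≤ ∫ s in 0..t₂, marginalPrice u k xs ys xo t₁ c t₂ s := min_le_right _ _
  have hsolv := S.solvable2_bunchingMenu h1 h2 ht₂ hε.le hεle
  set q := S.bunchingMenu h1 h2 ht₂ hε.le
  have htgt : ∀ a : (Ω × ℝ≥0) × ℝ≥0, target t₁ c t₂ (demand u k xs xo a.1.2) ∈ Icc 0 ys :=
    fun a => target_mem h0 h2T (S.demand_mem _)
  have hmeas : Measurable fun x : ℝ => target t₁ c t₂ (demand u k xs xo x) :=
    (monotone_target h1 h2).measurable.comp S.continuous_demand.measurable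
  have hmeas' : Measurable fun a : (Ω × ℝ≥0) × ℝ≥0 => target t₁ c t₂ (demand u k xs xo a.1.2) :=
    hmeas.comp (g := fun x : ℝ => target t₁ c t₂ (demand u k xs xo x))
      (f := fun a : (Ω × ℝ≥0) × ℝ≥0 => (a.1.2 : ℝ)) (by fun_prop)
  obtain ⟨hi, hlayer⟩ := integral_primitive_comp (μ := σ.law P q) hmeas'
    (fun a => (htgt a).1) (fun a => (htgt a).2) S.efficient.pos_right.le
    (G := fun s => marginalPrice u k xs ys xo t₁ c t₂ s - k)
    (fun a b => (hint a b).sub intervalIntegrable_const)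
    (fun s hs => sub_nonneg.2 (S.le_marginalPrice h1 h2 hk h2T hs))
  have hle : (fun a : (Ω × ℝ≥0) × ℝ≥0 =>
      (∫ s in 0..target t₁ c t₂ (demand u k xs xo a.1.2),
        (marginalPrice u k xs ys xo t₁ c t₂ s - k)) - ε) ≤ᵐ[σ.law P q] gain2 q k := by
    filter_upwards [hσ.ae_best2 S.utility hsolv,
      ae_law_of_firstDist q (S.ae_firstDist_order hσ)] with a ha hax
    exact S.profit_bunchingMenu h0 h1 h2 h2T hk ht₂ hε hεle (S.demand_mem _)
      (fun s hs => S.marginal_demand_le a.1.2.coe_nonneg hax hs) ha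
  have h3 := (integral_le_expect (hi.sub (integrable_const ε)) hle).trans
    (hσ.optimal2 q hsolv)
  rw [EReal.coe_le_coe_iff] at h3
  simp only [Pi.sub_apply] at h3
  rw [integral_sub hi (integrable_const ε), hlayer, integral_const,
    probReal_univ, one_smul] at h3
  have hD : ∀ s, (σ.law P q).real {a | s ≤ target t₁ c t₂ (demand u k xs xo a.1.2)} =
      demandProfile u k xs xo (σ.firstDist P) (cutoff t₁ c t₂ s) := fun s => by
    rw [demandProfile, ← σ.map_law q, map_measureReal_apply (by fun_prop)
      (measurableSet_le measurable_const S.continuous_demand.measurable)]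
    simp only [le_target_iff h1 h2]
    rfl
  simp only [hD] at h3
  linarith [min_le_left ε' (∫ s in 0..t₂, marginalPrice u k xs ys xo t₁ c t₂ s)]

/-- The profit of seller 2 if all consumers buy their demand at the efficient prices. -/
lemma integral_demand (S : Setting u k xs ys xo e) :
    Integrable (fun a => ∫ s in 0..demand u k xs xo a.1.2, (marginal u k xs ys xo s s - k))
      (σ.law P σ.offer2) ∧
    ∫ a, (∫ s in 0..demand u k xs xo a.1.2, (marginal u k xs ys xo s s - k))
      ∂σ.law P σ.offer2 = ∫ s in 0..ys, (marginal u k xs ys xo s s - k) *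
        demandProfile u k xs xo (σ.firstDist P) s := by
  have hdiag : Continuous fun s => marginal u k xs ys xo s s - k :=
    (S.continuous_marginal.comp (by fun_prop : Continuous fun s : ℝ => (s, s))).sub
      continuous_const
  -- The layer cake formula asks for a nonnegative integrand on all of `[0, ∞)`; truncation changes
  -- nothing on `[0, ys]`.
  have hnn : ∀ s, 0 ≤ s → 0 ≤ max (marginal u k xs ys xo s s - k) 0 :=
    fun s _ => le_max_right _ _
  have hmax : ∀ s ∈ Icc 0 ys,
      max (marginal u k xs ys xo s s - k) 0 = marginal u k xs ys xo s s - k := fun s hs =>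
    max_eq_left (sub_nonneg.2 (S.le_marginal_diag hs))
  have hmeas' : Measurable fun a : (Ω × ℝ≥0) × ℝ≥0 => demand u k xs xo a.1.2 :=
    S.continuous_demand.measurable.comp (g := demand u k xs xo)
      (f := fun a : (Ω × ℝ≥0) × ℝ≥0 => (a.1.2 : ℝ)) (by fun_prop)
  obtain ⟨hi, hlayer⟩ := integral_primitive_comp (μ := σ.law P σ.offer2) hmeas'
    (fun a => (S.demand_mem _).1) (fun a => (S.demand_mem _).2) S.efficient.pos_right.le
    (G := fun s => max (marginal u k xs ys xo s s - k) 0)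
    (fun a b => (hdiag.max continuous_const).intervalIntegrable a b) hnn
  have hcongr : ∀ x, ∫ s in 0..demand u k xs xo x, max (marginal u k xs ys xo s s - k) 0 =
      ∫ s in 0..demand u k xs xo x, (marginal u k xs ys xo s s - k) := fun x =>
    intervalIntegral.integral_congr fun s hs => by
      rw [uIcc_of_le (S.demand_mem x).1] at hs
      exact hmax s ⟨hs.1, hs.2.trans (S.demand_mem x).2⟩
  simp only [hcongr] at hi hlayer
  refine ⟨hi, hlayer.trans (intervalIntegral.integral_congr fun s hs => ?_)⟩
  rw [uIcc_of_le S.efficient.pos_right.le] at hs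
  simp only [hmax s hs]
  congr 1
  rw [demandProfile, firstDist, map_measureReal_apply (by fun_prop)
    (measurableSet_le measurable_const S.continuous_demand.measurable)]
  rfl

/-- The degenerate case `t₁ = c = t₂ = ys`, in which no quantity in `[0, ys]` is bunched. -/
lemma integral_diag_le_profit2 (S : Setting u k xs ys xo e) (hσ : σ.IsEquilibrium P u k) :
    ∫ s in 0..ys, (marginal u k xs ys xo s s - k) *
      demandProfile u k xs xo (σ.firstDist P) s ≤ σ.profit2 P k := by
  refine le_trans (le_of_eq (intervalIntegral.integral_congr fun s hs => ?_))
    (S.integral_bunching_le_profit2 hσ S.efficient.pos_right.le le_rfl le_rfl le_rfl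
      S.efficient.pos_right S.marginal_ys.ge)
  rw [uIcc_of_le S.efficient.pos_right.le] at hs
  have hc : cutoff ys ys ys s = s := if_pos hs.2
  simp only [S.marginalPrice_of_le hs.2, hc]

/-- With `I` the expected area under the diagonal margins, `I ≤ profit2 ≤ I + Σ - V` and `Σ ≤ V`
force equality. A pointwise bound with equal integrals then holds with equality almost surely. -/
lemma joint_value_and_ae (S : Setting u k xs ys xo e) (hσ : σ.IsEquilibrium P u k) :
    σ.profit1 P k + indirect u σ.offer2 0 = jointPayoff u k xo ∧
      ∀ᵐ a ∂σ.law P σ.offer2, gain2 σ.offer2 k a =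
        ∫ s in 0..demand u k xs xo a.1.2, (marginal u k xs ys xo s s - k) := by
  obtain ⟨hi, hval⟩ := S.integral_demand (P := P) (σ := σ)
  have hle : ∀ᵐ a ∂σ.law P σ.offer2, gain2 σ.offer2 k a ≤
      (∫ s in 0..demand u k xs xo a.1.2, (marginal u k xs ys xo s s - k)) +
        (jointPayoff u k xo - (σ.profit1 P k + indirect u σ.offer2 0)) := by
    filter_upwards [hσ.ae_indirect_eq S.utility, hσ.ae_best2 S.utility hσ.solvable2] with a h1 h2
    rcases S.gain2_le hσ h2 h1 with h | h
    · exact h.2.2.le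
    · exact h.le
  have hi' := hi.add (integrable_const
    (jointPayoff u k xo - (σ.profit1 P k + indirect u σ.offer2 0)))
  have hmono := integral_mono_ae hσ.integrable2 hi' hle
  simp only [Pi.add_apply] at hmono
  rw [integral_add hi (integrable_const _), hval, integral_const, probReal_univ, one_smul]
    at hmono
  have hprofit := S.integral_diag_le_profit2 hσ
  have hjoint := S.jointPayoff_le hσ
  change σ.profit2 P k ≤ _ at hmono
  have heq : σ.profit1 P k + indirect u σ.offer2 0 = jointPayoff u k xo := by linarith
  refine ⟨heq, ?_⟩
  rw [heq, sub_self] at hle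
  have hdiff : ∀ᵐ a ∂σ.law P σ.offer2, 0 ≤
      (∫ s in 0..demand u k xs xo a.1.2, (marginal u k xs ys xo s s - k)) -
        gain2 σ.offer2 k a := by
    filter_upwards [hle] with a ha
    linarith
  have hzero : ∫ a, ((∫ s in 0..demand u k xs xo a.1.2, (marginal u k xs ys xo s s - k)) -
      gain2 σ.offer2 k a) ∂σ.law P σ.offer2 = 0 := by
    refine le_antisymm ?_ (integral_nonneg_of_ae hdiff)
    rw [integral_sub hi hσ.integrable2, hval]
    change _ - σ.profit2 P k ≤ 0
    linarith
  filter_upwards [(integral_eq_zero_iff_of_nonneg_ae hdiff (hi.sub hσ.integrable2)).1 hzero]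
    with a ha
  simp only [Pi.zero_apply] at ha
  linarith

/-- The consumer and seller 1 share the joint payoff `Σ`. -/
lemma joint_value (S : Setting u k xs ys xo e) (hσ : σ.IsEquilibrium P u k) :
    σ.profit1 P k + indirect u σ.offer2 0 = jointPayoff u k xo :=
  (S.joint_value_and_ae hσ).1

/-- Equilibrium consumption lies on the curve `y = ŷ(x)`, between `xo` and `xs`. -/
lemma ae_on_curve (S : Setting u k xs ys xo e) (hσ : σ.IsEquilibrium P u k) :
    ∀ᵐ a ∂σ.law P σ.offer2, (a.1.2 : ℝ) ∈ uIcc xo xs ∧ (a.2 : ℝ) = yhat u k a.1.2 := by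
  filter_upwards [hσ.ae_indirect_eq S.utility, hσ.ae_best2 S.utility hσ.solvable2,
    (S.joint_value_and_ae hσ).2] with a h1 h2 h3
  rcases S.gain2_le hσ h2 h1 with h | h
  · exact ⟨h.1, h.2.1⟩
  · rw [S.joint_value hσ, sub_self, add_zero] at h
    exact absurd h3 h.ne

lemma ae_firstDist_mem (S : Setting u k xs ys xo e) (hσ : σ.IsEquilibrium P u k) :
    ∀ᵐ x ∂σ.firstDist P, x ∈ uIcc xo xs := by
  refine ae_firstDist ?_ measurableSet_uIcc
  filter_upwards [S.ae_on_curve hσ] with a ha using ha.1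

lemma profit2_eq (S : Setting u k xs ys xo e) (hσ : σ.IsEquilibrium P u k) :
    σ.profit2 P k = ∫ s in 0..ys, (marginal u k xs ys xo s s - k) *
      demandProfile u k xs xo (σ.firstDist P) s := by
  rw [profit2, integral_congr_ae (S.joint_value_and_ae hσ).2]
  exact S.integral_demand.2

/-- Equilibrium profit and the deviation bound are integrals over `[0, ys]` whose integrands agree
outside `(t₁, t₂)` up to endpoints; cancelling the common parts leaves the bunching inequality. -/
theorem isDemandProfile (S : Setting u k xs ys xo e) (hσ : σ.IsEquilibrium P u k) :
    IsDemandProfile (fun t s => marginal u k xs ys xo t s - k) ys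
      (demandProfile u k xs xo (σ.firstDist P)) where
  pos := S.efficient.pos_right
  continuous_margin := S.continuous_marginal.sub continuous_const
  margin_diag_pos t h0 h := sub_pos.2 (S.lt_marginal_diag h0 h)
  margin_top := sub_nonneg.2 S.marginal_ys.ge
  antitone := antitone_demandProfile _
  nonneg _ := measureReal_nonneg
  le_one _ := measureReal_le_one
  bunching t₁ c t₂ h0 h12 h1 h2 h2T hw := by
    set D := demandProfile u k xs xo (σ.firstDist P)
    have hD : Antitone D := antitone_demandProfile _
    have ht₂ : 0 < t₂ := h0.trans_lt h12
    have hdiag : Continuous fun s => marginal u k xs ys xo s s - k :=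
      (S.continuous_marginal.comp (by fun_prop : Continuous fun s : ℝ => (s, s))).sub
        continuous_const
    have hcs : Continuous fun s => marginal u k xs ys xo c s - k :=
      (S.continuous_marginal.comp (by fun_prop : Continuous fun s : ℝ => (c, s))).sub
        continuous_const
    have hi : ∀ a b, IntervalIntegrable (fun s => (marginal u k xs ys xo s s - k) * D s)
        volume a b := fun a b =>
      hD.intervalIntegrable.continuousOn_mul hdiag.continuousOn
    have hmain := S.integral_bunching_le_profit2 hσ h0 h1 h2 h2T ht₂ (sub_nonneg.1 hw)
    rw [S.profit2_eq hσ] at hmain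
    set J : ℝ → ℝ := fun s => (marginalPrice u k xs ys xo t₁ c t₂ s - k) * D (cutoff t₁ c t₂ s)
    have e1 : EqOn (fun s => (marginal u k xs ys xo s s - k) * D s) J (Ioo 0 t₁) := by
      intro s hs
      have hc : cutoff t₁ c t₂ s = s := if_pos hs.2.le
      simp only [J, S.marginalPrice_of_le (hs.2.le.trans (h12.le.trans h2T)), hc]
    have e2 : EqOn (fun s => (marginal u k xs ys xo c s - k) * D c) J (Ioo t₁ t₂) := by
      intro s hs
      have hc : cutoff t₁ c t₂ s = c := by rw [cutoff, if_neg (not_le.2 hs.1), if_pos hs.2.le]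
      simp only [J, S.marginalPrice_of_le (hs.2.le.trans h2T), hc]
    have e3 : EqOn (fun s => (marginal u k xs ys xo s s - k) * D s) J (Ioo t₂ ys) := by
      intro s hs
      have hc : cutoff t₁ c t₂ s = s := by
        rw [cutoff, if_neg (not_le.2 (h12.trans hs.1)), if_neg (not_le.2 hs.1)]
      simp only [J, S.marginalPrice_of_le hs.2.le, hc]
    have i2 : IntervalIntegrable (fun s => (marginal u k xs ys xo c s - k) * D c) volume t₁ t₂ :=
      (hcs.mul continuous_const).intervalIntegrable _ _
    have j1 := (hi 0 t₁).congr_uIoo (by rwa [uIoo_of_le h0])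
    have j2 := i2.congr_uIoo (by rwa [uIoo_of_le h12.le])
    have j3 := (hi t₂ ys).congr_uIoo (by rwa [uIoo_of_le h2T])
    rw [← intervalIntegral.integral_add_adjacent_intervals (j1.trans j2) j3,
      ← intervalIntegral.integral_add_adjacent_intervals j1 j2,
      ← intervalIntegral.integral_congr_Ioo_of_le h0 e1,
      ← intervalIntegral.integral_congr_Ioo_of_le h12.le e2,
      ← intervalIntegral.integral_congr_Ioo_of_le h2T e3,
      intervalIntegral.integral_mul_const,
      ← intervalIntegral.integral_add_adjacent_intervals (hi 0 t₂) (hi t₂ ys),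
      ← intervalIntegral.integral_add_adjacent_intervals (hi 0 t₁) (hi t₁ t₂)] at hmain
    linarith

end Setting

end PrivateTransactions

/-! ### Distribution, support and prices in equilibrium -/

namespace PrivateTransactions

open Filter Topology

/-- The support of the image of a measure with compact support under a continuous map. -/
lemma support_map_of_isCompact {μ : Measure ℝ} {f : ℝ → ℝ × ℝ} (hf : Continuous f)
    {K : Set ℝ} (hK : IsCompact K) (hμK : K ∈ ae μ) (hsupp : μ.support = K) :
    (μ.map f).support = f '' K := by
  refine Subset.antisymm ?_ ?_
  · refine Measure.support_subset_of_isClosed (hK.image hf).isClosed ?_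
    rw [mem_ae_map_iff hf.aemeasurable (hK.image hf).measurableSet]
    exact mem_of_superset hμK (subset_preimage_image f K)
  · rintro _ ⟨x, hx, rfl⟩
    rw [← hsupp, Measure.mem_support_iff_forall] at hx
    rw [Measure.mem_support_iff_forall]
    intro U hU
    exact (hx _ (hf.continuousAt hU)).trans_le (Measure.le_map_apply hf.aemeasurable U)

namespace Setting

open Profile

variable {u : ℝ → ℝ → ℝ} {k xs ys xo e : ℝ} {Ω : Type*} [MeasurableSpace Ω] {P : Measure Ω}
  [IsProbabilityMeasure P] {σ : Profile Ω}

lemma tendsto_demandProfile (S : Setting u k xs ys xo e) (μ : Measure ℝ)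
    [IsProbabilityMeasure μ] : Tendsto (demandProfile u k xs xo μ) (𝓝[<] ys)
      (𝓝 (demandProfile u k xs xo μ ys)) := by
  have h := tendsto_measure_biInter_gt (μ := μ) (a := -ys)
    (s := fun r : ℝ => {x | -r ≤ demand u k xs xo x})
    (fun r _ => (measurableSet_le measurable_const
      S.continuous_demand.measurable).nullMeasurableSet)
    (fun i j _ hij x hx => (neg_le_neg hij).trans hx) ⟨-ys + 1, by simp, measure_ne_top _ _⟩
  have hset : ⋂ r > -ys, {x | -r ≤ demand u k xs xo x} = {x | ys ≤ demand u k xs xo x} := by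
    ext x
    simp only [mem_iInter, mem_ofPred_eq]
    constructor
    · intro hx
      by_contra! hlt
      have := hx (-((demand u k xs xo x + ys) / 2)) (by linarith)
      linarith
    · intro hx r hr
      linarith
  rw [hset] at h
  have h2 := (ENNReal.tendsto_toReal (measure_ne_top μ {x | ys ≤ demand u k xs xo x})).comp
    (h.comp tendsto_neg_nhdsLT)
  refine h2.congr fun t => ?_
  simp [demandProfile, measureReal_def]

lemma demandProfile_ys (S : Setting u k xs ys xo e) (hσ : σ.IsEquilibrium P u k) :
    demandProfile u k xs xo (σ.firstDist P) ys = 0 :=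
  S.demandProfile_top (S.isDemandProfile hσ) (S.tendsto_demandProfile _)

lemma demandProfile_pos (S : Setting u k xs ys xo e) (hσ : σ.IsEquilibrium P u k) {t : ℝ}
    (h0 : 0 ≤ t) (ht : t < ys) : 0 < demandProfile u k xs xo (σ.firstDist P) t := by
  rw [S.demandProfile_eq (S.isDemandProfile hσ) (S.demandProfile_zero _) h0 ht]
  exact Real.exp_pos _

/-- If no mass lay between `t` and `t'`, the quantities in between could be sold to the same buyers
at the higher marginal utility of type `t'`. For `t' = ys` the absence of a top atom decides. -/
lemma demandProfile_lt (S : Setting u k xs ys xo e) (hσ : σ.IsEquilibrium P u k) {t t' : ℝ}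
    (h0 : 0 ≤ t) (h : t < t') (ht' : t' ≤ ys) :
    demandProfile u k xs xo (σ.firstDist P) t' < demandProfile u k xs xo (σ.firstDist P) t := by
  rcases ht'.eq_or_lt with rfl | hlt
  · rw [S.demandProfile_ys hσ]
    exact S.demandProfile_pos hσ h0 h
  set D := demandProfile u k xs xo (σ.firstDist P)
  have hprof := S.isDemandProfile hσ
  by_contra! hle
  obtain ⟨s, hs, hs2⟩ := hprof.exists_mem_Ioo h0 h h.le le_rfl ht'
    (hprof.margin_diag_pos t' (h0.trans h.le) hlt).le
  have hDs : D s = D t' :=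
    le_antisymm ((hprof.antitone hs.1.le).trans hle) (hprof.antitone hs.2.le)
  rw [show demandProfile u k xs xo (σ.firstDist P) s = _ from hDs] at hs2
  have h1 := le_of_mul_le_mul_right hs2 (S.demandProfile_pos hσ (h0.trans h.le) hlt)
  have h2 := S.marginal_lt_left s ⟨h0.trans hs.1.le, hs.2.le.trans ht'⟩
    ⟨h0.trans h.le, ht'⟩ hs.2
  linarith

/-- A demand in an interval of positive length has positive probability. -/
lemma measure_demand_pos (S : Setting u k xs ys xo e) (hσ : σ.IsEquilibrium P u k) {t t' : ℝ}
    (h0 : 0 ≤ t) (h : t < t') (ht' : t' ≤ ys) :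
    0 < (σ.firstDist P) {x | demand u k xs xo x ∈ Ico t t'} := by
  have hset : {x | demand u k xs xo x ∈ Ico t t'} =
      {x | t ≤ demand u k xs xo x} \ {x | t' ≤ demand u k xs xo x} := by
    ext x; simp
  have hdiff := measureReal_sdiff (μ := σ.firstDist P) (s₁ := {x | t ≤ demand u k xs xo x})
    (s₂ := {x | t' ≤ demand u k xs xo x}) (fun x hx => h.le.trans hx)
    (measurableSet_le measurable_const S.continuous_demand.measurable)
  have hlt := S.demandProfile_lt hσ h0 h ht'
  rw [demandProfile, demandProfile] at hlt
  rw [hset, pos_iff_ne_zero]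
  intro hz
  rw [measureReal_def, hz, ENNReal.toReal_zero] at hdiff
  linarith

/-- By continuity of `x̂`, a short interval of demands at `ŷ(x)` is mapped into a given neighborhood
of `x`, and such intervals have positive mass. -/
lemma support_firstDist (S : Setting u k xs ys xo e) (hσ : σ.IsEquilibrium P u k) :
    (σ.firstDist P).support = uIcc xo xs := by
  refine Subset.antisymm
    (Measure.support_subset_of_isClosed isCompact_uIcc.isClosed (S.ae_firstDist_mem hσ)) ?_
  intro x hx
  rw [Measure.mem_support_iff_forall]
  intro U hU
  have hI := S.yhat_mem hx
  have hcont := S.continuous_xhat.continuousAt (x := yhat u k x)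
  rw [ContinuousAt, S.xhat_yhat hx] at hcont
  obtain ⟨r, hr, hball⟩ := Metric.mem_nhds_iff.1 (hcont hU)
  obtain ⟨a, b, ha0, hab, hbT, hsub⟩ : ∃ a b, 0 ≤ a ∧ a < b ∧ b ≤ ys ∧
      Ico a b ⊆ Metric.ball (yhat u k x) r := by
    rcases hI.2.eq_or_lt with h | h
    · refine ⟨max 0 (ys - r / 2), ys, le_max_left _ _,
        max_lt S.efficient.pos_right (by linarith), le_rfl, fun s hs => ?_⟩
      rw [Metric.mem_ball, Real.dist_eq, h, abs_lt]
      constructor <;> linarith [hs.1, hs.2, le_max_right 0 (ys - r / 2)]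
    · refine ⟨yhat u k x, min ys (yhat u k x + r), hI.1, lt_min h (by linarith), min_le_left _ _,
        fun s hs => ?_⟩
      rw [Metric.mem_ball, Real.dist_eq, abs_lt]
      constructor <;> linarith [hs.1, hs.2, min_le_right ys (yhat u k x + r)]
  refine (S.measure_demand_pos hσ ha0 hab hbT).trans_le (measure_mono_ae ?_)
  filter_upwards [S.ae_firstDist_mem hσ] with x' hx' hx''
  have : xhat u k xs ys xo (demand u k xs xo x') ∈ U := hball (hsub hx'')
  rwa [S.xhat_demand hx'] at this

lemma measureReal_beyond (S : Setting u k xs ys xo e) (hσ : σ.IsEquilibrium P u k) {z : ℝ}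
    (hz : z ∈ uIcc xo xs) : (σ.firstDist P).real {x | 0 ≤ e * (x - z)} =
      demandProfile u k xs xo (σ.firstDist P) (yhat u k z) := by
  refine measureReal_congr ?_
  filter_upwards [S.ae_firstDist_mem hσ] with x hx
  refine propext ⟨fun (h : 0 ≤ e * (x - z)) => ?_, fun (h : yhat u k z ≤ demand u k xs xo x) => ?_⟩
  · change yhat u k z ≤ demand u k xs xo x
    rw [demand_of_mem hx]
    rcases h.eq_or_lt with h | h
    · have : x = z := by rcases S.sign with rfl | rfl <;> linarith
      rw [this]
    · exact (S.yhat_lt_yhat hz hx h).le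
  · change 0 ≤ e * (x - z)
    rw [demand_of_mem hx] at h
    by_contra! hlt
    exact absurd (S.yhat_lt_yhat hx hz (by linarith)) (not_lt.2 h)

/-- An atom at `z` would be a jump of the continuous demand profile at `ŷ(z)`. -/
lemma measureReal_singleton (S : Setting u k xs ys xo e) (hσ : σ.IsEquilibrium P u k) {z : ℝ}
    (hz : z ∈ uIcc xo xs) (hzs : yhat u k z < ys) : (σ.firstDist P).real {z} = 0 := by
  set D := demandProfile u k xs xo (σ.firstDist P)
  have hI := S.yhat_mem hz
  have hcont : Tendsto D (𝓝[>] yhat u k z) (𝓝 (D (yhat u k z))) := by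
    have h1 : ContinuousWithinAt D (Ico 0 ys) (yhat u k z) :=
      (S.isDemandProfile hσ).continuousOn (yhat u k z) ⟨hI.1, hzs⟩
    refine h1.mono_left ?_
    rw [← nhdsWithin_Ioo_eq_nhdsGT hzs]
    exact nhdsWithin_mono _ fun s hs => ⟨hI.1.trans hs.1.le, hs.2⟩
  have hlim : Tendsto (fun t => D (yhat u k z) - D t) (𝓝[>] yhat u k z) (𝓝 0) := by
    simpa using hcont.const_sub (D (yhat u k z))
  refine le_antisymm (ge_of_tendsto hlim ?_) measureReal_nonneg
  filter_upwards [self_mem_nhdsWithin] with t (ht : yhat u k z < t)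
  have hdiff := measureReal_sdiff (μ := σ.firstDist P) (s₁ := {x | yhat u k z ≤ demand u k xs xo x})
    (s₂ := {x | t ≤ demand u k xs xo x}) (fun x hx => ht.le.trans hx)
    (measurableSet_le measurable_const S.continuous_demand.measurable)
  refine le_trans (measureReal_mono ?_) hdiff.le
  rintro x rfl
  refine ⟨(demand_of_mem hz).ge, fun hh => ?_⟩
  rw [mem_ofPred_eq, demand_of_mem hz] at hh
  exact absurd ht (not_lt.2 hh)

lemma demandProfile_yhat (S : Setting u k xs ys xo e) (hσ : σ.IsEquilibrium P u k) {z : ℝ}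
    (hz : z ∈ uIcc xo xs) (hzs : yhat u k z < ys) :
    demandProfile u k xs xo (σ.firstDist P) (yhat u k z) =
      Real.exp (-∫ x in xo..z, hazard u k x) := by
  rw [S.demandProfile_eq (S.isDemandProfile hσ) (S.demandProfile_zero _) (S.yhat_mem hz).1 hzs,
    S.xhat_yhat hz]

lemma yhat_lt_ys (S : Setting u k xs ys xo e) {z : ℝ} (hz : z ∈ uIcc xo xs) (hne : z ≠ xs) :
    yhat u k z < ys :=
  lt_of_le_of_ne (S.yhat_mem hz).2 fun h =>
    hne (S.yhat_injOn hz right_mem_uIcc (h.trans S.yhat_xs.symm))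

/-- Demand increases with `x`, so the demand profile gives the mass of `[z, ∞)`; passing to `(-∞,
z]` requires that `z` carry no atom. -/
lemma cdf_super (S : Setting u k xs ys xo 1) (hσ : σ.IsEquilibrium P u k) (z : ℝ) :
    (σ.firstDist P).real (Iic z) = distSuper u k xs xo z := by
  have hord : xo < xs := by linarith [S.order]
  have hI := S.ae_firstDist_mem hσ
  rw [uIcc_of_le hord.le] at hI
  unfold distSuper
  split_ifs with h1 h2
  · rw [measureReal_eq_zero_iff, measure_eq_zero_iff_ae_notMem]
    filter_upwards [hI] with x hx hxz
    exact absurd (hx.1.trans hxz) (not_le.2 h1)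
  · have hz : z ∈ uIcc xo xs := by rw [uIcc_of_le hord.le]; exact ⟨not_lt.1 h1, h2.le⟩
    have hzs := S.yhat_lt_ys hz h2.ne
    have hb := S.measureReal_beyond hσ hz
    have hset : {x : ℝ | 0 ≤ 1 * (x - z)} = Ici z := by
      ext x; simp
    rw [hset, S.demandProfile_yhat hσ hz hzs] at hb
    have hunion : (σ.firstDist P).real (Iic z) + (σ.firstDist P).real (Ici z) =
        1 + (σ.firstDist P).real {z} := by
      have := measureReal_union_add_inter (μ := σ.firstDist P) (s := Iic z) (t := Ici z)
        measurableSet_Ici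
      rw [Iic_union_Ici, Iic_inter_Ici, Icc_self, probReal_univ] at this
      exact this.symm
    rw [hb, S.measureReal_singleton hσ hz hzs] at hunion
    have hexp : ∫ t in xo..z, du21 u t (yhat u k t) / (k - du2 u t (yhat u k t)) =
        -∫ x in xo..z, hazard u k x := by
      rw [← intervalIntegral.integral_neg]
      congr 1
      ext t
      rw [hazard, ← neg_sub, div_neg]
    rw [hexp]
    linarith
  · rw [measureReal_def, ENNReal.toReal_eq_one_iff, ← mem_ae_iff_prob_eq_one measurableSet_Iic]
    filter_upwards [hI] with x hx
    exact hx.2.trans (not_lt.1 h2)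

/-- Demand decreases with `x`, so the demand profile is itself the distribution function, and its
zero at `ys` gives the value at `xs`. -/
lemma cdf_sub (S : Setting u k xs ys xo (-1)) (hσ : σ.IsEquilibrium P u k) (z : ℝ) :
    (σ.firstDist P).real (Iic z) = distSub u k xs xo z := by
  have hord : xs < xo := by linarith [S.order]
  have hI := S.ae_firstDist_mem hσ
  rw [uIcc_of_ge hord.le] at hI
  have hset : ∀ z, {x : ℝ | 0 ≤ -1 * (x - z)} = Iic z := fun z => by
    ext x
    simp only [mem_ofPred_eq, mem_Iic]
    constructor <;> intro h <;> linarith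
  unfold distSub
  split_ifs with h1 h2
  · refine le_antisymm ?_ measureReal_nonneg
    have hb := S.measureReal_beyond hσ (right_mem_uIcc (a := xo) (b := xs))
    rw [hset, S.yhat_xs, S.demandProfile_ys hσ] at hb
    rw [← hb]
    exact measureReal_mono (Iic_subset_Iic.2 h1)
  · have hz : z ∈ uIcc xo xs := by rw [uIcc_of_ge hord.le]; exact ⟨(not_le.1 h1).le, h2⟩
    have hb := S.measureReal_beyond hσ hz
    rw [hset, S.demandProfile_yhat hσ hz (S.yhat_lt_ys hz (not_le.1 h1).ne')] at hb
    rw [hb, intervalIntegral.integral_symm z xo, neg_neg]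
  · rw [measureReal_def, ENNReal.toReal_eq_one_iff, ← mem_ae_iff_prob_eq_one measurableSet_Iic]
    filter_upwards [hI] with x hx
    exact hx.2.trans (not_le.1 h2).le

/-- The price of the demanded bundle, as a continuous function on `ℝ`. -/
noncomputable def itemPrice (u : ℝ → ℝ → ℝ) (k xs xo x : ℝ) : ℝ :=
  u (max x 0) (demand u k xs xo x) - k * x - jointPayoff u k xo

lemma continuous_itemPrice (S : Setting u k xs ys xo e) :
    Continuous (itemPrice u k xs xo) :=
  ((S.utility.continuousOn_uncurry.comp_continuous
    (f := fun x : ℝ => (max x 0, demand u k xs xo x))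
    ((by fun_prop : Continuous fun x : ℝ => max x 0).prodMk S.continuous_demand)
    fun x => mk_mem_quadrant (le_max_right _ _) (S.demand_mem x).1).sub (by fun_prop)).sub
    continuous_const

lemma itemPrice_of_mem (S : Setting u k xs ys xo e) {x : ℝ} (hx : x ∈ uIcc xo xs) :
    itemPrice u k xs xo x = qhat u k xo x := by
  rw [itemPrice, demand_of_mem hx, max_eq_left (S.pos_of_mem hx).le, qhat]

lemma ae_price_eq (S : Setting u k xs ys xo e) (hσ : σ.IsEquilibrium P u k) :
    ∀ᵐ a ∂σ.law P σ.offer2, (σ.offer2.price a.2 : ℝ) = itemPrice u k xs xo a.1.2 ∧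
      (a.2 : ℝ) = demand u k xs xo a.1.2 := by
  filter_upwards [hσ.ae_indirect_eq S.utility, hσ.ae_best2 S.utility hσ.solvable2,
    S.ae_on_curve hσ] with a h1 h2 h3
  rw [S.joint_value hσ] at h1
  rw [S.itemPrice_of_mem h3.1, demand_of_mem h3.1, price_eq_of_best2 h2 h1, qhat, h3.2]
  exact ⟨rfl, rfl⟩

lemma exists_law_near (S : Setting u k xs ys xo e) (hσ : σ.IsEquilibrium P u k) {x : ℝ}
    (hx : x ∈ uIcc xo xs) {V : Set ℝ} (hV : V ∈ 𝓝 x) {p : (Ω × ℝ≥0) × ℝ≥0 → Prop}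
    (hp : ∀ᵐ a ∂σ.law P σ.offer2, p a) : ∃ a, (a.1.2 : ℝ) ∈ V ∧ p a := by
  rw [← S.support_firstDist hσ, Measure.mem_support_iff_forall] at hx
  obtain ⟨W, hWV, hW, hxW⟩ := mem_nhds_iff.1 hV
  have hpos := hx W (hW.mem_nhds hxW)
  rw [firstDist, Measure.map_apply (by fun_prop) hW.measurableSet] at hpos
  obtain ⟨a, ha, hpa⟩ := Measure.exists_mem_of_measure_ne_zero_of_ae hpos.ne' (ae_restrict_of_ae hp)
  exact ⟨a, hWV ha, hpa⟩

/-- A price above `q(x)` would, by lower semicontinuity, stay above it at nearby demands. By full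
support some of these are bought on the path, at prices near `q(x)`. -/
lemma price_yhat_le (S : Setting u k xs ys xo e) (hσ : σ.IsEquilibrium P u k) {x : ℝ}
    (hx : x ∈ uIcc xo xs) :
    (σ.offer2.price (yhat u k x).toNNReal : ℝ) ≤ qhat u k xo x := by
  by_contra! hlt
  obtain ⟨r, hr1, hr2⟩ := exists_between hlt
  have hlsc : LowerSemicontinuous fun y => (σ.offer2.price y : ℝ) :=
    NNReal.continuous_coe.comp_lowerSemicontinuous σ.offer2.lsc NNReal.coe_mono
  have hdem : Continuous fun x => (demand u k xs xo x).toNNReal :=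
    continuous_real_toNNReal.comp S.continuous_demand
  rw [← demand_of_mem hx] at hr2
  rw [← S.itemPrice_of_mem hx] at hr1
  have ev1 : ∀ᶠ x' in 𝓝 x, r < σ.offer2.price (demand u k xs xo x').toNNReal :=
    hdem.continuousAt.eventually (hlsc _ r hr2)
  have ev2 : ∀ᶠ x' in 𝓝 x, itemPrice u k xs xo x' < r :=
    S.continuous_itemPrice.continuousAt.eventually (gt_mem_nhds hr1)
  obtain ⟨a, ha, h1, h2⟩ := S.exists_law_near hσ hx (ev1.and ev2) (S.ae_price_eq hσ)
  have ha1 : r < σ.offer2.price (demand u k xs xo a.1.2).toNNReal := ha.1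
  have ha2 : itemPrice u k xs xo a.1.2 < r := ha.2
  rw [← h2, Real.toNNReal_coe, h1] at ha1
  exact lt_asymm ha1 ha2

/-- At a price of at most `q(x)` the bundle `ŷ(x)` gives the consumer at least `Σ + kx`, the most
seller 1's optimality permits. Any other optimum would also satisfy `u₁(x, y) = k`, whose solution
is unique. -/
lemma best2_iff_yhat (S : Setting u k xs ys xo e) (hσ : σ.IsEquilibrium P u k) {x y : ℝ≥0}
    (hx : (x : ℝ) ∈ uIcc xo xs) : Best2 u σ.offer2 x y ↔ (y : ℝ) = yhat u k x := by
  have hbound := hσ.indirect_sub_le_profit1 S.utility x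
  rw [S.joint_value hσ] at hbound
  have hbest : Best2 u σ.offer2 x (yhat u k x).toNNReal := by
    rw [hσ.solvable2.best2_iff]
    have := S.price_yhat_le hσ hx
    rw [payoff2, Real.coe_toNNReal _ (S.yhat_mem hx).1]
    rw [qhat] at this
    linarith
  constructor
  · intro hy
    have hval : indirect u σ.offer2 x - k * x =
        σ.profit1 P k + indirect u σ.offer2 0 := by
      rw [S.joint_value hσ]
      refine le_antisymm hbound ?_
      have := S.price_yhat_le hσ hx
      rw [hbest.indirect_eq, payoff2, Real.coe_toNNReal _ (S.yhat_mem hx).1]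
      rw [qhat] at this
      linarith
    exact S.eq_yhat hx y.coe_nonneg (S.du1_eq_of_isMax (S.pos_of_mem hx) y.coe_nonneg
      (hσ.isMax_of_eq S.utility hy hval))
  · intro hy
    rw [← hy, Real.toNNReal_coe] at hbest
    exact hbest

/-- A lower price would let the consumer and seller 1 share more than `Σ`. -/
lemma price_eq_qhat (S : Setting u k xs ys xo e) (hσ : σ.IsEquilibrium P u k) {x y : ℝ≥0}
    (hx : (x : ℝ) ∈ uIcc xo xs) (hy : (y : ℝ) = yhat u k x) :
    (σ.offer2.price y : ℝ) = qhat u k xo x := by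
  have hle := S.price_yhat_le hσ hx
  rw [← hy, Real.toNNReal_coe] at hle
  refine le_antisymm hle ?_
  have hbound := hσ.indirect_sub_le_profit1 S.utility x
  rw [S.joint_value hσ] at hbound
  have := hσ.solvable2.payoff2_le x y
  rw [payoff2] at this
  rw [qhat, ← hy]
  linarith

/-- The allocation of every equilibrium, up to the form of the distribution function. -/
theorem hasAllocation (S : Setting u k xs ys xo e) (hσ : σ.IsEquilibrium P u k) {F : ℝ → ℝ}
    (hF : ∀ z, (σ.firstDist P).real (Iic z) = F z) :
    HasAllocation σ P u k xo F (uIcc xo xs) where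
  cdf_eq := hF
  support_eq := S.support_firstDist hσ
  consumption := (S.ae_on_curve hσ).mono fun _ h => h.2
  items := by
    have hf : Continuous fun x => (itemPrice u k xs xo x, demand u k xs xo x) :=
      S.continuous_itemPrice.prodMk S.continuous_demand
    have hmap : σ.itemDist P =
        (σ.firstDist P).map fun x => (itemPrice u k xs xo x, demand u k xs xo x) := by
      rw [itemDist, firstDist, Measure.map_map hf.measurable (by fun_prop)]
      refine Measure.map_congr ?_
      filter_upwards [S.ae_price_eq hσ] with a ha
      exact Prod.ext ha.1 ha.2
    rw [hmap, support_map_of_isCompact hf isCompact_uIcc (S.ae_firstDist_mem hσ)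
      (S.support_firstDist hσ)]
    exact image_congr fun x hx => by rw [S.itemPrice_of_mem hx, demand_of_mem hx]
  optimal_item _ _ hx := S.best2_iff_yhat hσ hx
  item_price _ _ hx hy := S.price_eq_qhat hσ hx hy
  profit2_eq := by
    have h1 : ∫ x, (qhat u k xo x - k * yhat u k x) ∂σ.firstDist P =
        ∫ x, (itemPrice u k xs xo x - k * demand u k xs xo x) ∂σ.firstDist P := by
      refine integral_congr_ae ?_
      filter_upwards [S.ae_firstDist_mem hσ] with x hx
      rw [S.itemPrice_of_mem hx, demand_of_mem hx]
    have hcont : Continuous fun x => itemPrice u k xs xo x - k * demand u k xs xo x :=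
      S.continuous_itemPrice.sub (continuous_const.mul S.continuous_demand)
    rw [h1, firstDist, integral_map (by fun_prop) hcont.aestronglyMeasurable, profit2]
    refine integral_congr_ae ?_
    filter_upwards [S.ae_price_eq hσ] with a ha
    rw [gain2, ha.1, ha.2]
  joint_eq := by rw [hσ.consumerPayoff_eq S.utility, S.joint_value hσ]

/-- If the utility is supermodular, the consumer obtains her reservation utility. -/
lemma indirect_zero_eq (S : Setting u k xs ys xo 1) (hσ : σ.IsEquilibrium P u k) :
    indirect u σ.offer2 0 = u 0 0 := by
  have hxo := Real.coe_toNNReal _ S.observable.pos.le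
  have hbest : Best2 u σ.offer2 xo.toNNReal 0 := by
    rw [S.best2_iff_yhat hσ (by rw [hxo]; exact left_mem_uIcc), hxo, S.yhat_xo, NNReal.coe_zero]
  obtain ⟨y, hy⟩ := hσ.solvable2 0
  refine le_antisymm ?_ ?_
  -- After consuming `xo` the consumer optimally buys nothing, so the price of `y` is at least its
  -- value to her. By supermodularity `y` is worth no more after consuming `0`. For a submodular
  -- utility this last comparison is reversed.
  · have h1 := hbest y
    rw [hy.indirect_eq]
    simp only [payoff2, σ.offer2.price_zero, NNReal.coe_zero, sub_zero, hxo] at h1 ⊢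
    have h2 := S.integral_du2 (x := 0) le_rfl (le_refl (0 : ℝ)) y.coe_nonneg
    have h3 := S.integral_du2 S.observable.pos.le (le_refl (0 : ℝ)) y.coe_nonneg
    have h4 := intervalIntegral.integral_mono_on y.coe_nonneg
      (S.intervalIntegrable_du2 (x := 0) le_rfl (le_refl (0 : ℝ)) y.coe_nonneg)
      (S.intervalIntegrable_du2 S.observable.pos.le (le_refl (0 : ℝ)) y.coe_nonneg)
      fun s hs => by
        have := (S.utility.strictMonoOn_du2 S.mixed_pos hs.1).monotoneOn
          (self_mem_Ici (a := (0 : ℝ))) (show xo ∈ Ici 0 from S.observable.pos.le)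
          S.observable.pos.le
        simpa using this
    linarith
  · simpa [payoff2, σ.offer2.price_zero] using hσ.solvable2.payoff2_le 0 0

end Setting

end PrivateTransactions

/-! ### The two cases of the theorem -/

open PrivateTransactions in
theorem theorem2 (u : ℝ → ℝ → ℝ) (k xs ys xo : ℝ) (hu : IsUtility u)
    (hs : IsEfficient u k xs ys) (ho : IsObservableOutcome u k xo) :
    (Supermodular u → xo < xs ∧
      ∀ {Ω : Type*} [MeasurableSpace Ω] (P : Measure Ω) [IsProbabilityMeasure P] (σ : Profile Ω),
        σ.IsEquilibrium P u k →
          HasAllocation σ P u k xo (distSuper u k xs xo) (Icc xo xs) ∧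
          σ.consumerPayoff P u = u 0 0 ∧
          σ.profit1 P k = jointPayoff u k xo - u 0 0) ∧
    (Submodular u → xs < xo ∧
      ∀ {Ω : Type*} [MeasurableSpace Ω] (P : Measure Ω) [IsProbabilityMeasure P] (σ : Profile Ω),
        σ.IsEquilibrium P u k →
          HasAllocation σ P u k xo (distSub u k xs xo) (Icc xs xo)) := by
  constructor
  · intro hsuper
    have S : Setting u k xs ys xo 1 := ⟨hu, hs, ho, Or.inl rfl, fun x y hx hy => by
      simpa using hsuper x y hx hy⟩
    have hord : xo < xs := by linarith [S.order]
    refine ⟨hord, fun P _ σ hσ => ?_⟩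
    have h := S.hasAllocation hσ (S.cdf_super hσ)
    rw [uIcc_of_le hord.le] at h
    have hjoint := S.joint_value hσ
    rw [S.indirect_zero_eq hσ] at hjoint
    exact ⟨h, by rw [hσ.consumerPayoff_eq hu, S.indirect_zero_eq hσ], by linarith⟩
  · intro hsub
    have S : Setting u k xs ys xo (-1) := ⟨hu, hs, ho, Or.inr rfl, fun x y hx hy => by
      linarith [hsub x y hx hy]⟩
    have hord : xs < xo := by linarith [S.order]
    refine ⟨hord, fun P _ σ hσ => ?_⟩
    have h := S.hasAllocation hσ (S.cdf_sub hσ)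
    rwa [uIcc_of_ge hord.le] at h
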